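/- Let $\mathbb A=(A,\Omega)$, $A=\{0,\dots,l-1\}$, be a fixed finite algebra whose basic operation $\Omega:A^m\to A$ is an idempotent special WNU operation, and let $\Gamma_{\mathcal A}$ be the list of all unary and binary relations on $A$ invariant under $\Omega$. Recall that $V^1$ is the two-sorted theory (numbers and finite sets of numbers) axiomatized by 2-BASIC, comprehension for $\Sigma^{1,b}_0$-formulas and number induction for $\Sigma^{1,b}_1$-formulas. In $V^1$, an instance $\Theta=(\mathcal X,\ddot{\mathcal A})$ over $\Gamma_{\mathcal A}$ consists of a digraph $\mathcal X=(V_{\mathcal X},E_{\mathcal X})$ with $V_{\mathcal X}=\{0,\dots,n-1\}$, domains $D_0,\dots,D_{n-1}\subseteq A$ and relations $E^{ij}\subseteq D_i\times D_j$ $(i,j<n)$, all $D_i$ and $E^{ij}$ being in $\Gamma_{\mathcal A}$; pairs are coded by $\langle x,y\rangle=(x+y)(x+y+1)/2+y$. A solution assigns to each vertex $i$ an $a_i\in D_i$ with $(a_i,a_j)\in E^{ij}$ for all edges $(i,j)$ of $\mathcal X$. The solution set is subdirect if for every vertex $i$ and $a\in D_i$ there is a solution with value $a$ at $i$. The instance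 is $1$-consistent if for each edge $(i,j)$ of $\mathcal X$ every $a\in D_i$ has some $b\in D_j$ with $E^{ij}(a,b)$, and every $b\in D_j$ has some $a\in D_i$ with $E^{ij}(a,b)$. It is cycle-consistent if it is $1$-consistent and for every undirected cycle $\mathcal C_t$ on $\{0,\dots,t-1\}$, $t<n$, every homomorphism $H:\mathcal C_t\to\mathcal X$ and every $a\in D_{H(0)}$ there is a homomorphism $H':\mathcal C_t\to\ddot{\mathcal A}$ with $H'(p)\in D_{H(p)}$ for all $p$ and $H'(0)=a$. It is linked if for every vertex $i$ and all $a,b\in D_i$ there are an undirected path $\mathcal P_t$ on $\{0,\dots,t\}$, $t<nl$, a homomorphism $H:\mathcal P_t\to\mathcal X$ with $H(0)=H(t)=i$ and a homomorphism $H':\mathcal P_t\to\ddot{\mathcal A}$ with $H'(p)\in D_{H(p)}$ for all $p$, $H'(0)=a$, $H'(t)=b$. It is fragmented if the vertex set is a disjoint union of two nonempty sets with no edge of $\mathcal X$ between them. A subinstance is $(\mathcal X',\ddot{\mathcal A})$ with $V_{\mathcal X'}\subseteq V_{\mathcal X}$ and $E_{\mathcal X'}\subseteq E_{\mathcal X}\cap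 V_{\mathcal X'}^2$; its properties refer to the vertices and edges of $\mathcal X'$ only. An instance is irreducible if each of its subinstances is fragmented, or linked, or has a subdirect solution set. For $i<n$ and a maximal congruence $\sigma$ on $(D_i,\Omega)$ define the relations $I_t=I_{t,i,\sigma}$ $(t\le n)$ by: $I_0(k,a,b)$ iff $k=i$ and $(a,b)\in\sigma$; and $I_{t+1}(k,a,b)$ iff $I_t(k,a,b)$, or there are $j<n$ and a constraint $C$ between $j$ and $k$ (an edge $(j,k)$ of $\mathcal X$ with relation $E^{jk}$, or an edge $(k,j)$ of $\mathcal X$ with relation $E^{kj}$) such that $a$, $b$ are related by $C$ to some $a'$, $b'\in D_j$ respectively with $I_t(j,a',b')$, and no $e\in D_k$ is related by $C$ to two elements $c,d\in D_j$ with $\neg I_t(j,c,d)$. Let $\mathcal X_{i,\sigma}$ be the subgraph of $\mathcal X$ induced on $\{j<n:\exists a,b\ I_n(j,a,b)\}$. The irreducibility check returns "OK" on $\Theta$ if for every $i<n$ and every maximal congruence $\sigma$ on $D_i$ the subinstance $(\mathcal X_{i,\sigma},\ddot{\mathcal A})$ has a subdirect solution set. Lemma. $V^1$ proves: for every cycle-consistent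 instance $\Theta_{ir}=(\mathcal X,\ddot{\mathcal A}_{ir})$ over $\Gamma_{\mathcal A}$ on which the irreducibility check returns "OK", the instance $\Theta_{ir}$ is irreducible. -/

import Mathlib

/-! # Two-sorted bounded arithmetic, the theory `V¹`, and binary CSP instances inside it -/

namespace BA

/-! ## Syntax of the two-sorted language `{0, 1, +, ·, |·|, =₁, =₂, ≤, ∈}`

Variables of either sort are named by natural numbers. -/

/-- A variable of the second sort (finite sets of numbers, i.e. strings). -/
structure SetVar where
  idx : ℕ

/-- Terms of the first sort. -/
inductive NumTerm where
  | var (x : ℕ)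
  | zero
  | one
  | add (s t : NumTerm)
  | mul (s t : NumTerm)
  | len (X : SetVar)

instance : Zero NumTerm := ⟨.zero⟩
instance : One NumTerm := ⟨.one⟩
instance : Add NumTerm := ⟨.add⟩
instance : Mul NumTerm := ⟨.mul⟩

/-- The numeral of `k`. -/
def num : ℕ → NumTerm
  | 0 => 0
  | k + 1 => num k + 1

/-- Two-sorted first-order formulas. -/
inductive Formula where
  | eqN (s t : NumTerm)
  | eqS (X Y : SetVar)
  | le (s t : NumTerm)
  | mem (t : NumTerm) (X : SetVar)
  | neg (φ : Formula)
  | and (φ ψ : Formula)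
  | or (φ ψ : Formula)
  | allN (x : ℕ) (φ : Formula)
  | exN (x : ℕ) (φ : Formula)
  | allS (X : SetVar) (φ : Formula)
  | exS (X : SetVar) (φ : Formula)

/-- The number variable `x` occurs in the term. -/
def NumTerm.HasNumVar (x : ℕ) : NumTerm → Prop
  | .var y => x = y
  | .zero => False
  | .one => False
  | .add s t => s.HasNumVar x ∨ t.HasNumVar x
  | .mul s t => s.HasNumVar x ∨ t.HasNumVar x
  | .len _ => False

/-- The set variable `X` occurs in the term. -/
def NumTerm.HasSetVar (X : SetVar) : NumTerm → Prop
  | .var _ => False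
  | .zero => False
  | .one => False
  | .add s t => s.HasSetVar X ∨ t.HasSetVar X
  | .mul s t => s.HasSetVar X ∨ t.HasSetVar X
  | .len Y => X = Y

/-- The set variable `X` occurs free in the formula. -/
def Formula.HasFreeSetVar (X : SetVar) : Formula → Prop
  | .eqN s t => s.HasSetVar X ∨ t.HasSetVar X
  | .eqS Y Z => X = Y ∨ X = Z
  | .le s t => s.HasSetVar X ∨ t.HasSetVar X
  | .mem t Y => t.HasSetVar X ∨ X = Y
  | .neg φ => φ.HasFreeSetVar X
  | .and φ ψ => φ.HasFreeSetVar X ∨ ψ.HasFreeSetVar X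
  | .or φ ψ => φ.HasFreeSetVar X ∨ ψ.HasFreeSetVar X
  | .allN _ φ => φ.HasFreeSetVar X
  | .exN _ φ => φ.HasFreeSetVar X
  | .allS Y φ => X ≠ Y ∧ φ.HasFreeSetVar X
  | .exS Y φ => X ≠ Y ∧ φ.HasFreeSetVar X

/-- Substitution of the term `r` for the number variable `x` in a term. -/
def NumTerm.subst (x : ℕ) (r : NumTerm) : NumTerm → NumTerm
  | .var y => if y = x then r else .var y
  | .zero => .zero
  | .one => .one
  | .add s t => .add (NumTerm.subst x r s) (NumTerm.subst x r t)
  | .mul s t => .mul (NumTerm.subst x r s) (NumTerm.subst x r t)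
  | .len X => .len X

/-- Substitution of the term `r` for the free occurrences of the number variable `x`.
It is used only for terms `r` that contain no variable other than `x`
(namely `0` and `x + 1`), so that no variable of `r` can be captured. -/
def Formula.subst (x : ℕ) (r : NumTerm) : Formula → Formula
  | .eqN s t => .eqN (NumTerm.subst x r s) (NumTerm.subst x r t)
  | .eqS X Y => .eqS X Y
  | .le s t => .le (NumTerm.subst x r s) (NumTerm.subst x r t)
  | .mem t X => .mem (NumTerm.subst x r t) X
  | .neg φ => .neg (Formula.subst x r φ)
  | .and φ ψ => .and (Formula.subst x r φ) (Formula.subst x r ψ)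
  | .or φ ψ => .or (Formula.subst x r φ) (Formula.subst x r ψ)
  | .allN y φ => if y = x then .allN y φ else .allN y (Formula.subst x r φ)
  | .exN y φ => if y = x then .exN y φ else .exN y (Formula.subst x r φ)
  | .allS Y φ => .allS Y (Formula.subst x r φ)
  | .exS Y φ => .exS Y (Formula.subst x r φ)

namespace Formula

def imp (φ ψ : Formula) : Formula := .or (.neg φ) ψ
def iff (φ ψ : Formula) : Formula := .and (imp φ ψ) (imp ψ φ)
def lt (s t : NumTerm) : Formula := .and (.le s t) (.neg (.eqN s t))

/-- `∃ x ≤ t, φ`. -/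
def exNLe (x : ℕ) (t : NumTerm) (φ : Formula) : Formula := .exN x (.and (.le (.var x) t) φ)
/-- `∀ x ≤ t, φ`. -/
def allNLe (x : ℕ) (t : NumTerm) (φ : Formula) : Formula := .allN x (imp (.le (.var x) t) φ)
/-- `∃ X ≤ t, φ`, that is, `∃ X, |X| ≤ t ∧ φ`. -/
def exSLe (X : SetVar) (t : NumTerm) (φ : Formula) : Formula := .exS X (.and (.le (.len X) t) φ)
/-- `∀ X ≤ t, φ`, that is, `∀ X, |X| ≤ t → φ`. -/
def allSLe (X : SetVar) (t : NumTerm) (φ : Formula) : Formula := .allS X (imp (.le (.len X) t) φ)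

/-- `Σ₀^{1,b}`-formulas: all number quantifiers bounded, no set quantifiers. -/
inductive IsSigma0 : Formula → Prop
  | eqN (s t : NumTerm) : IsSigma0 (.eqN s t)
  | eqS (X Y : SetVar) : IsSigma0 (.eqS X Y)
  | le (s t : NumTerm) : IsSigma0 (.le s t)
  | mem (t : NumTerm) (X : SetVar) : IsSigma0 (.mem t X)
  | neg {φ : Formula} : IsSigma0 φ → IsSigma0 (.neg φ)
  | and {φ ψ : Formula} : IsSigma0 φ → IsSigma0 ψ → IsSigma0 (.and φ ψ)
  | or {φ ψ : Formula} : IsSigma0 φ → IsSigma0 ψ → IsSigma0 (.or φ ψ)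
  | exNLe {x : ℕ} {t : NumTerm} {φ : Formula} :
      ¬ t.HasNumVar x → IsSigma0 φ → IsSigma0 (exNLe x t φ)
  | allNLe {x : ℕ} {t : NumTerm} {φ : Formula} :
      ¬ t.HasNumVar x → IsSigma0 φ → IsSigma0 (allNLe x t φ)

mutual
/-- `Σ₁^{1,b}`-formulas. -/
inductive IsSigma1 : Formula → Prop
  | sigma0 {φ : Formula} : IsSigma0 φ → IsSigma1 φ
  | and {φ ψ : Formula} : IsSigma1 φ → IsSigma1 ψ → IsSigma1 (.and φ ψ)
  | or {φ ψ : Formula} : IsSigma1 φ → IsSigma1 ψ → IsSigma1 (.or φ ψ)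
  | neg {φ : Formula} : IsPi1 φ → IsSigma1 (.neg φ)
  | exSLe {X : SetVar} {t : NumTerm} {φ : Formula} :
      ¬ t.HasSetVar X → IsSigma1 φ → IsSigma1 (exSLe X t φ)
/-- `Π₁^{1,b}`-formulas. -/
inductive IsPi1 : Formula → Prop
  | sigma0 {φ : Formula} : IsSigma0 φ → IsPi1 φ
  | and {φ ψ : Formula} : IsPi1 φ → IsPi1 ψ → IsPi1 (.and φ ψ)
  | or {φ ψ : Formula} : IsPi1 φ → IsPi1 ψ → IsPi1 (.or φ ψ)
  | neg {φ : Formula} : IsSigma1 φ → IsPi1 (.neg φ)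
  | allSLe {X : SetVar} {t : NumTerm} {φ : Formula} :
      ¬ t.HasSetVar X → IsPi1 φ → IsPi1 (allSLe X t φ)
end

end Formula

/-! ## Semantics and provability -/

/-- A two-sorted structure for the language; `=₁` and `=₂` are interpreted by equality.
The second sort is an arbitrary nonempty type, as always in first-order logic. -/
structure Model where
  Num : Type
  Str : Type
  [strNonempty : Nonempty Str]
  zero : Num
  one : Num
  add : Num → Num → Num
  mul : Num → Num → Num
  len : Str → Num
  le : Num → Num → Prop
  mem : Num → Str → Prop

/-- Value of a term under an assignment. -/
def NumTerm.eval (M : Model) (v : ℕ → M.Num) (w : ℕ → M.Str) : NumTerm → M.Num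
  | .var x => v x
  | .zero => M.zero
  | .one => M.one
  | .add s t => M.add (s.eval M v w) (t.eval M v w)
  | .mul s t => M.mul (s.eval M v w) (t.eval M v w)
  | .len X => M.len (w X.idx)

/-- Tarskian truth of a formula in a structure under an assignment. -/
def Formula.Realize (M : Model) (v : ℕ → M.Num) (w : ℕ → M.Str) : Formula → Prop
  | .eqN s t => s.eval M v w = t.eval M v w
  | .eqS X Y => w X.idx = w Y.idx
  | .le s t => M.le (s.eval M v w) (t.eval M v w)
  | .mem t X => M.mem (t.eval M v w) (w X.idx)
  | .neg φ => ¬ φ.Realize M v w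
  | .and φ ψ => φ.Realize M v w ∧ ψ.Realize M v w
  | .or φ ψ => φ.Realize M v w ∨ ψ.Realize M v w
  | .allN x φ => ∀ a : M.Num, φ.Realize M (Function.update v x a) w
  | .exN x φ => ∃ a : M.Num, φ.Realize M (Function.update v x a) w
  | .allS X φ => ∀ A : M.Str, φ.Realize M v (Function.update w X.idx A)
  | .exS X φ => ∃ A : M.Str, φ.Realize M v (Function.update w X.idx A)

/-- `M` satisfies the universal closure of `φ`. -/
def Model.Satisfies (M : Model) (φ : Formula) : Prop :=
  ∀ (v : ℕ → M.Num) (w : ℕ → M.Str), φ.Realize M v w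

/-- The theory axiomatized by `T` proves `φ`: a theory is closed under logical consequence and
universal closure, so this says that `φ` holds in every two-sorted structure in which all axioms
hold. By the completeness theorem (and the Löwenheim–Skolem theorem, the language being
countable) this is the same as derivability of `φ` from `T` in first-order logic. -/
def Proves (T : Set Formula) (φ : Formula) : Prop :=
  ∀ M : Model, (∀ ψ ∈ T, M.Satisfies ψ) → M.Satisfies φ

/-! ## Writing formulas

An `Fm` is a formula that is told which variable names are not yet in use: the number variables
from the first argument on and the set variables from the second argument on. A quantifier takes
the first unused name, so bound variables never clash. -/

abbrev Fm := ℕ → ℕ → Formula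

namespace Fm

def close (φ : Fm) : Formula := φ 0 0

def eq (s t : NumTerm) : Fm := fun _ _ => .eqN s t
def eqS (X Y : SetVar) : Fm := fun _ _ => .eqS X Y
def le (s t : NumTerm) : Fm := fun _ _ => .le s t
def mem (t : NumTerm) (X : SetVar) : Fm := fun _ _ => .mem t X
def not (φ : Fm) : Fm := fun n s => .neg (φ n s)
def and (φ ψ : Fm) : Fm := fun n s => .and (φ n s) (ψ n s)
def or (φ ψ : Fm) : Fm := fun n s => .or (φ n s) (ψ n s)
def imp (φ ψ : Fm) : Fm := fun n s => .imp (φ n s) (ψ n s)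
def iff (φ ψ : Fm) : Fm := fun n s => .iff (φ n s) (ψ n s)
def lt (s t : NumTerm) : Fm := fun _ _ => .lt s t
def top : Fm := eq 0 0
def bot : Fm := not top

def allN (f : NumTerm → Fm) : Fm := fun n s => .allN n (f (.var n) (n + 1) s)
def exN (f : NumTerm → Fm) : Fm := fun n s => .exN n (f (.var n) (n + 1) s)
def allS (f : SetVar → Fm) : Fm := fun n s => .allS ⟨s⟩ (f ⟨s⟩ n (s + 1))
def exS (f : SetVar → Fm) : Fm := fun n s => .exS ⟨s⟩ (f ⟨s⟩ n (s + 1))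

/-- `∀ x ≤ t`. -/
def allLe (t : NumTerm) (f : NumTerm → Fm) : Fm := allN fun x => imp (le x t) (f x)
/-- `∃ x ≤ t`. -/
def exLe (t : NumTerm) (f : NumTerm → Fm) : Fm := exN fun x => and (le x t) (f x)
/-- `∀ x < t`. -/
def allLt (t : NumTerm) (f : NumTerm → Fm) : Fm := allLe t fun x => imp (not (eq x t)) (f x)
/-- `∃ x < t`. -/
def exLt (t : NumTerm) (f : NumTerm → Fm) : Fm := exLe t fun x => and (not (eq x t)) (f x)
/-- `∀ X, |X| ≤ t → …`. -/
def allSLe (t : NumTerm) (f : SetVar → Fm) : Fm := allS fun X => imp (le (.len X) t) (f X)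
/-- `∃ X, |X| ≤ t ∧ …`. -/
def exSLe (t : NumTerm) (f : SetVar → Fm) : Fm := exS fun X => and (le (.len X) t) (f X)

/-- Finite conjunction and disjunction, taken outside the formal language. -/
def bigAnd {ι : Type} (L : List ι) (f : ι → Fm) : Fm := L.foldr (fun i φ => and (f i) φ) top
def bigOr {ι : Type} (L : List ι) (f : ι → Fm) : Fm := L.foldr (fun i φ => or (f i) φ) bot

end Fm

infixr:70 " ⋏ " => Fm.and
infixr:65 " ⋎ " => Fm.or
infixr:60 " ⟹ " => Fm.imp
infix:62 " ⟺ " => Fm.iff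

/-! ## The theory `V¹` -/

open Fm in
/-- The axioms 2-BASIC. -/
def twoBasic : List Fm :=
  [ allN fun x => not (eq (x + 1) 0),
    allN fun x => allN fun y => eq (x + 1) (y + 1) ⟹ eq x y,
    allN fun x => eq (x + 0) x,
    allN fun x => allN fun y => eq (x + (y + 1)) ((x + y) + 1),
    allN fun x => eq (x * 0) 0,
    allN fun x => allN fun y => eq (x * (y + 1)) ((x * y) + x),
    allN fun x => allN fun y => (le x y ⋏ le y x) ⟹ eq x y,
    allN fun x => allN fun y => le x (x + y),
    allN fun x => le 0 x,
    allN fun x => allN fun y => le x y ⋎ le y x,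
    allN fun x => allN fun y => le x y ⟺ lt x (y + 1),
    allN fun x => not (eq x 0) ⟹ exLe x fun y => eq (y + 1) x,
    allS fun X => allN fun y => mem y X ⟹ lt y (.len X),
    allS fun X => allN fun y => eq (y + 1) (.len X) ⟹ mem y X,
    allS fun X => allS fun Y =>
      (eq (.len X) (.len Y) ⋏ allLt (.len X) fun i => mem i X ⟺ mem i Y) ⟺ eqS X Y ]

/-- Induction for `φ` in the variable `x`: `φ(0) ∧ ∀ x (φ(x) → φ(x + 1)) → ∀ x φ(x)`. -/
def indAxiom (x : ℕ) (φ : Formula) : Formula :=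
  .imp (.and (φ.subst x 0) (.allN x (.imp φ (φ.subst x (.var x + 1))))) (.allN x φ)

/-- Comprehension for `φ` in the variable `y`: `∀ x ∃ X ≤ x ∀ y < x (y ∈ X ↔ φ(y))`. -/
def compAxiom (x y : ℕ) (X : SetVar) (φ : Formula) : Formula :=
  .allN x (.exSLe X (.var x)
    (.allN y (.imp (.lt (.var y) (.var x)) (.iff (.mem (.var y) X) φ))))

/-- The theory `V¹`: 2-BASIC, comprehension for `Σ₀^{1,b}`-formulas and number induction for
`Σ₁^{1,b}`-formulas. -/
def V1 : Set Formula :=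
  {ψ | (∃ φ ∈ twoBasic, ψ = φ.close) ∨
    (∃ (x y : ℕ) (X : SetVar) (φ : Formula), x ≠ y ∧ φ.IsSigma0 ∧ ¬ φ.HasFreeSetVar X ∧
      ψ = compAxiom x y X φ) ∨
    (∃ (x : ℕ) (φ : Formula), φ.IsSigma1 ∧ ψ = indAxiom x φ)}

/-! ## The fixed finite algebra `𝔸 = ({0, …, l - 1}, Ω)` and its invariant relations -/

section Algebra

variable {l m : ℕ}

/-- `Ω` is an idempotent special weak near-unanimity operation. -/
structure IsSpecialWNU (Ω : (Fin m → Fin l) → Fin l) : Prop where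
  wnu : ∀ (x y : Fin l) (i j : Fin m),
    Ω (Function.update (fun _ => x) i y) = Ω (Function.update (fun _ => x) j y)
  idempotent : ∀ x : Fin l, Ω (fun _ => x) = x
  special : ∀ (x y : Fin l) (i : Fin m),
    Ω (Function.update (fun _ => x) i (Ω (Function.update (fun _ => x) i y))) =
      Ω (Function.update (fun _ => x) i y)

/-- `Ω` preserves the unary relation `D`. -/
def Preserves1 (Ω : (Fin m → Fin l) → Fin l) (D : Finset (Fin l)) : Prop :=
  ∀ a : Fin m → Fin l, (∀ r, a r ∈ D) → Ω a ∈ D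

/-- `Ω` preserves the binary relation `R`. -/
def Preserves2 (Ω : (Fin m → Fin l) → Fin l) (R : Finset (Fin l × Fin l)) : Prop :=
  ∀ a b : Fin m → Fin l, (∀ r, (a r, b r) ∈ R) → (Ω a, Ω b) ∈ R

open Classical in
/-- The list of all unary relations invariant under `Ω`, i.e. of all subuniverses. -/
noncomputable def Gamma1 (Ω : (Fin m → Fin l) → Fin l) : List (Finset (Fin l)) :=
  (Finset.univ.filter (Preserves1 Ω)).toList

open Classical in
/-- The list of all binary relations invariant under `Ω`. -/
noncomputable def Gamma2 (Ω : (Fin m → Fin l) → Fin l) : List (Finset (Fin l × Fin l)) :=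
  (Finset.univ.filter (Preserves2 Ω)).toList

/-- `σ` is a congruence on the subalgebra `(D, Ω)`. -/
structure IsCongruence (Ω : (Fin m → Fin l) → Fin l) (D : Finset (Fin l))
    (σ : Finset (Fin l × Fin l)) : Prop where
  subset : σ ⊆ D ×ˢ D
  refl : ∀ a ∈ D, (a, a) ∈ σ
  symm : ∀ a b, (a, b) ∈ σ → (b, a) ∈ σ
  trans : ∀ a b c, (a, b) ∈ σ → (b, c) ∈ σ → (a, c) ∈ σ
  compatible : Preserves2 Ω σ

/-- `σ` is a maximal congruence on `(D, Ω)`: it is not the full relation, and the only other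
congruence above it is the full relation. -/
structure IsMaximalCongruence (Ω : (Fin m → Fin l) → Fin l) (D : Finset (Fin l))
    (σ : Finset (Fin l × Fin l)) : Prop where
  congruence : IsCongruence Ω D σ
  ne_full : σ ≠ D ×ˢ D
  maximal : ∀ τ, IsCongruence Ω D τ → σ ⊆ τ → τ = σ ∨ τ = D ×ˢ D

open Classical in
/-- The list of all maximal congruences on `(D, Ω)`. -/
noncomputable def maximalCongruences (Ω : (Fin m → Fin l) → Fin l) (D : Finset (Fin l)) :
    List (Finset (Fin l × Fin l)) :=
  (Finset.univ.filter (IsMaximalCongruence Ω D)).toList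

end Algebra

/-! ## Pairing and coded objects -/

open Fm

/-- `(x + y + 1)²`, a strict upper bound of the pair code `⟨x, y⟩`. -/
def pairBd (x y : NumTerm) : NumTerm := (x + y + 1) * (x + y + 1)

/-- `z = ⟨x, y⟩ = (x + y)(x + y + 1) / 2 + y`. -/
def isPair (z x y : NumTerm) : Fm :=
  eq ((1 + 1) * z) ((x + y) * (x + y + 1) + (1 + 1) * y)

/-- `X(x, y)`, that is, `⟨x, y⟩ ∈ X`. -/
def mem2 (X : SetVar) (x y : NumTerm) : Fm :=
  exLe (pairBd x y) fun z => isPair z x y ⋏ mem z X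

/-- `X(x, y, z, u)`, that is, `⟨⟨⟨x, y⟩, z⟩, u⟩ ∈ X`. -/
def mem4 (X : SetVar) (x y z u : NumTerm) : Fm :=
  exLe (pairBd x y) fun p => isPair p x y ⋏
    exLe (pairBd p z) fun q => isPair q p z ⋏ mem2 X q u

/-- `X(x, ⟨y, z⟩)`. -/
def memPairR (X : SetVar) (x y z : NumTerm) : Fm :=
  exLe (pairBd y z) fun p => isPair p y z ⋏ mem2 X x p

/-- `H` is a well-defined map from the set `A` of numbers below `n` to the set `B` of numbers
below `k`. -/
def isMap (n : NumTerm) (A : SetVar) (k : NumTerm) (B H : SetVar) : Fm :=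
  (allLt n fun i => mem i A ⟹ exLt k fun j => mem j B ⋏ mem2 H i j) ⋏
  (allLt n fun i => mem i A ⟹ allLt k fun j₁ => allLt k fun j₂ =>
    (mem j₁ B ⋏ mem j₂ B ⋏ mem2 H i j₁ ⋏ mem2 H i j₂) ⟹ eq j₁ j₂)

/-- A digraph in the formal language: a set `V` of vertices below `size` and a set `E` of pairs. -/
structure DiG where
  size : NumTerm
  V : SetVar
  E : SetVar

/-- A target digraph with domains: `V(i, a)` says `a ∈ Dᵢ` (for `i < n`, `a < l`), and
`E(⟨i, a⟩, ⟨j, b⟩)` says `Eⁱʲ(a, b)`. -/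
structure Target where
  n : NumTerm
  l : NumTerm
  V : SetVar
  E : SetVar

/-- `a ∈ Dᵢ`. -/
def Target.dom (A : Target) (i a : NumTerm) : Fm := mem2 A.V i a

/-- `Eⁱʲ(a, b)`. -/
def Target.edge (A : Target) (i a j b : NumTerm) : Fm :=
  exLe (pairBd i a) fun u => isPair u i a ⋏ memPairR A.E u j b

/-- `H` is a homomorphism between the digraphs `G` and `K`. -/
def isHom (G K : DiG) (H : SetVar) : Fm :=
  isMap G.size G.V K.size K.V H ⋏
  (allLt G.size fun i₁ => allLt G.size fun i₂ => allLt K.size fun j₁ => allLt K.size fun j₂ =>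
    (mem2 G.E i₁ i₂ ⋏ mem2 H i₁ j₁ ⋏ mem2 H i₂ j₂) ⟹ mem2 K.E j₁ j₂)

/-- `H` is a homomorphism from the digraph `G` to the relation `E` on the superdomain of `A`. -/
def isHomT (G : DiG) (A : Target) (H : SetVar) : Fm :=
  isMap G.size G.V (pairBd A.n A.l) A.V H ⋏
  (allLt G.size fun i₁ => allLt G.size fun i₂ =>
    allLt (pairBd A.n A.l) fun j₁ => allLt (pairBd A.n A.l) fun j₂ =>
      (mem2 G.E i₁ i₂ ⋏ mem2 H i₁ j₁ ⋏ mem2 H i₂ j₂) ⟹ mem2 A.E j₁ j₂)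

/-- `H` is a solution of the instance `(X, A)`: a homomorphism that sends each `i` to `Dᵢ`. -/
def isSolution (X : DiG) (A : Target) (H : SetVar) : Fm :=
  isHomT X A H ⋏
  (allLt X.size fun i => allLt (pairBd A.n A.l) fun s =>
    mem2 H i s ⟹ exLt A.l fun a => isPair s i a ⋏ A.dom i a)

/-- `H'` is a homomorphism from `G` to `A` that lies over the map `H` from `G` to the variables:
if `H(p) = k`, then `H'(p) = ⟨k, c⟩` for some `c ∈ Dₖ`. -/
def isLift (G : DiG) (A : Target) (H H' : SetVar) : Fm :=
  isHomT G A H' ⋏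
  (allLt G.size fun p => allLt A.n fun k =>
    mem2 H p k ⟹ exLt A.l fun c => A.dom k c ⋏ memPairR H' p k c)

/-! ## CSP instances and their properties -/

/-- `(X, A)` is an instance: `X` is a digraph on `V = {0, …, n - 1}`, the elements of `A.V` are
pairs `⟨i, a⟩` with `i < n`, `a < l`, and `A.E` relates only elements of the domains. -/
def isInstance (X : DiG) (A : Target) : Fm :=
  eq (.len X.V) X.size ⋏ (allLt X.size fun i => mem i X.V) ⋏
  (allLt (.len X.E) fun z => mem z X.E ⟹
    exLt X.size fun i => exLt X.size fun j => isPair z i j) ⋏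
  (allLt (.len A.V) fun z => mem z A.V ⟹
    exLt A.n fun i => exLt A.l fun a => isPair z i a) ⋏
  (allLt (.len A.E) fun u => allLt (.len A.E) fun v => mem2 A.E u v ⟹
    exLt A.n fun i => exLt A.n fun j => exLt A.l fun a => exLt A.l fun b =>
      isPair u i a ⋏ isPair v j b ⋏ A.dom i a ⋏ A.dom j b)

open Classical in
/-- The truth value of a fact about the fixed finite algebra, as a formula. -/
noncomputable def const (p : Prop) : Fm := if p then top else bot

section

variable {l m : ℕ}

/-- `Dᵢ = D`, for a set `D` known in advance. -/
noncomputable def domIs (A : Target) (i : NumTerm) (D : Finset (Fin l)) : Fm :=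
  bigAnd (List.finRange l) fun a => A.dom i (num a) ⟺ const (a ∈ D)

/-- `Eⁱʲ = R`, for a relation `R` known in advance. -/
noncomputable def edgeIs (A : Target) (i j : NumTerm) (R : Finset (Fin l × Fin l)) : Fm :=
  bigAnd (List.finRange l) fun a => bigAnd (List.finRange l) fun b =>
    A.edge i (num a) j (num b) ⟺ const ((a, b) ∈ R)

/-- `(X, A)` is a CSP instance over the language of all unary and binary relations invariant
under `Ω`. -/
noncomputable def isInstanceOver (Ω : (Fin m → Fin l) → Fin l) (X : DiG) (A : Target) : Fm :=
  isInstance X A ⋏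
  (allLt A.n fun i => bigOr (Gamma1 Ω) fun D => domIs A i D) ⋏
  (allLt A.n fun i => allLt A.n fun j => bigOr (Gamma2 Ω) fun R => edgeIs A i j R)

end

/-- `4t²`. -/
def fourSq (t : NumTerm) : NumTerm := (1 + 1 + 1 + 1) * (t * t)

/-- `1`-consistency. -/
def oneConsistent (X : DiG) (A : Target) : Fm :=
  allLt A.n fun i => allLt A.l fun a => A.dom i a ⟹ allLt A.n fun j =>
    (mem2 X.E i j ⟹ exLt A.l fun b => A.dom j b ⋏ A.edge i a j b) ⋏
    (mem2 X.E j i ⟹ exLt A.l fun b => A.dom j b ⋏ A.edge j b i a)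

/-- `C` is an undirected cycle of length `C.size ≥ 1` on the vertices `0, …, C.size - 1`. -/
def isCycle (C : DiG) : Fm :=
  (allLt C.size fun i => mem i C.V) ⋏
  (exLt C.size fun s => eq (s + 1) C.size ⋏ (mem2 C.E 0 s ⋎ mem2 C.E s 0)) ⋏
  (allLt C.size fun i => lt (i + 1) C.size ⟹ (mem2 C.E i (i + 1) ⋎ mem2 C.E (i + 1) i)) ⋏
  (allLt C.size fun i => allLt C.size fun j => mem2 C.E i j ⟹
    (eq j (i + 1) ⋎ eq i (j + 1) ⋎ (eq i 0 ⋏ eq (j + 1) C.size) ⋎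
      (eq j 0 ⋏ eq (i + 1) C.size)))

/-- Cycle-consistency: `1`-consistency, and for every undirected cycle `C` of length `t < n` with
a homomorphism `H` to `X` and `H(0) = k`, and for every `a ∈ Dₖ`, there is a homomorphism from `C`
to `A` over `H` that sends `0` to `⟨k, a⟩`. -/
def cycleConsistent (X : DiG) (A : Target) : Fm :=
  oneConsistent X A ⋏
  allLt A.n fun k => allLt A.l fun a => A.dom k a ⟹
    allLt A.n fun t => allSLe t fun VC => allSLe (fourSq t) fun EC =>
      allSLe (pairBd t A.n) fun H =>
        (isCycle ⟨t, VC, EC⟩ ⋏ isHom ⟨t, VC, EC⟩ X H ⋏ mem2 H 0 k) ⟹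
          exSLe (pairBd t (pairBd A.n A.l)) fun H' =>
            isLift ⟨t, VC, EC⟩ A H H' ⋏ memPairR H' 0 k a

/-- `P` is an undirected path of length `t` on the vertices `0, …, t` (here `P.size = t + 1`). -/
def isPath (t : NumTerm) (P : DiG) : Fm :=
  (allLe t fun i => mem i P.V) ⋏
  (allLt t fun i => mem2 P.E i (i + 1) ⋎ mem2 P.E (i + 1) i) ⋏
  (allLe t fun i => allLe t fun j => mem2 P.E i j ⟹ (eq j (i + 1) ⋎ eq i (j + 1)))

/-- `a ∈ Dᵢ` and `b ∈ Dⱼ` are linked in `(X, A)`: some undirected path of length `t < nl`, mapped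
to `X` by `H` with `H(0) = i`, `H(t) = j`, has a homomorphism to `A` over `H` that sends `0` to
`⟨i, a⟩` and `t` to `⟨j, b⟩`. -/
def areLinked (a b i j : NumTerm) (X : DiG) (A : Target) : Fm :=
  exLt (A.n * A.l) fun t => exSLe (t + 1) fun VP => exSLe (fourSq t) fun EP =>
    exSLe (pairBd (t + 1) A.n) fun H =>
      isPath t ⟨t + 1, VP, EP⟩ ⋏ isHom ⟨t + 1, VP, EP⟩ X H ⋏ mem2 H 0 i ⋏ mem2 H t j ⋏
      exSLe (pairBd (t + 1) (pairBd A.n A.l)) fun H' =>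
        isLift ⟨t + 1, VP, EP⟩ A H H' ⋏ memPairR H' 0 i a ⋏ memPairR H' t j b

/-- The instance `(X, A)` is linked. -/
def linked (X : DiG) (A : Target) : Fm :=
  allLt X.size fun i => mem i X.V ⟹ allLt A.l fun a => allLt A.l fun b =>
    (A.dom i a ⋏ A.dom i b) ⟹ areLinked a b i i X A

/-- The instance with input digraph `X` is fragmented: `X.V` is the disjoint union of two
nonempty sets without edges between them. -/
def fragmented (X : DiG) : Fm :=
  exSLe X.size fun V₁ => exSLe X.size fun V₂ =>
    (allLt X.size fun i => mem i V₁ ⟹ mem i X.V) ⋏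
    (allLt X.size fun i => mem i V₂ ⟹ mem i X.V) ⋏
    (exLt X.size fun i => mem i V₁) ⋏ (exLt X.size fun i => mem i V₂) ⋏
    (allLt X.size fun i => mem i X.V ⟹ (mem i V₁ ⟺ not (mem i V₂))) ⋏
    (allLt X.size fun i => allLt X.size fun j => (mem i V₁ ⋏ mem j V₂) ⟹
      (not (mem2 X.E i j) ⋏ not (mem2 X.E j i)))

/-- The solution set of `(X, A)` is subdirect: every `a ∈ Dᵢ`, `i` a variable, is the value at `i`
of some solution. -/
def subdirectSolutions (X : DiG) (A : Target) : Fm :=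
  allLt X.size fun i => mem i X.V ⟹ allLt A.l fun a => A.dom i a ⟹
    exSLe (pairBd A.n (pairBd A.n A.l)) fun H => isSolution X A H ⋏ memPairR H i i a

/-- `(X', A)` is a subinstance of `(X, A)`. -/
def isSubinstance (X' X : DiG) : Fm :=
  (allLt X.size fun i => mem i X'.V ⟹ mem i X.V) ⋏
  (allLt X.size fun i => allLt X.size fun j =>
    mem2 X'.E i j ⟹ (mem2 X.E i j ⋏ mem i X'.V ⋏ mem j X'.V))

/-- The instance `(X, A)` is irreducible: every subinstance is fragmented, or linked, or its
solution set is subdirect. -/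
def irreducible (X : DiG) (A : Target) : Fm :=
  allSLe X.size fun V' => allSLe (fourSq X.size) fun E' =>
    isSubinstance ⟨X.size, V', E'⟩ X ⟹
      (fragmented ⟨X.size, V', E'⟩ ⋎ linked ⟨X.size, V', E'⟩ A ⋎
        subdirectSolutions ⟨X.size, V', E'⟩ A)

/-! ## The irreducibility check -/

section

variable {l m : ℕ}

/-- `(a, b) ∈ σ`, for a relation `σ` known in advance. -/
def relHolds (σ : List (Fin l × Fin l)) (a b : NumTerm) : Fm :=
  bigOr σ fun p => eq a (num p.1) ⋏ eq b (num p.2)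

/-- `I(t, k, a, b)`, for `t ≤ n`, is the propagation in `(X, A)` of the congruence `σ` on `Dᵢ`:
* `I(0, k, a, b)` iff `k = i` and `(a, b) ∈ σ`;
* `I(t + 1, k, a, b)` iff `I(t, k, a, b)`, or for some `j` and some constraint between `j` and `k`
  (an edge `(j, k)` or an edge `(k, j)` of `X`), `a` and `b` have neighbours `a'`, `b'` along this
  constraint with `I(t, j, a', b')`, and no `e ∈ Dₖ` has along this constraint two neighbours
  `c, d ∈ Dⱼ` with `¬ I(t, j, c, d)`. -/
noncomputable def isPropagation (X : DiG) (A : Target) (i : NumTerm) (σ : Finset (Fin l × Fin l))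
    (I : SetVar) : Fm :=
  (allLt A.n fun k => allLt A.l fun a => allLt A.l fun b =>
    mem4 I 0 k a b ⟺ (eq k i ⋏ relHolds σ.toList a b)) ⋏
  (allLt A.n fun t => allLt A.n fun k => allLt A.l fun a => allLt A.l fun b =>
    mem4 I (t + 1) k a b ⟺
      (mem4 I t k a b ⋎
        exLt A.n fun j => exLt A.l fun a' => exLt A.l fun b' => mem4 I t j a' b' ⋏
          ((mem2 X.E j k ⋏ A.edge j a' k a ⋏ A.edge j b' k b ⋏
              not (exLt A.l fun c => exLt A.l fun d => exLt A.l fun e =>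
                A.dom j c ⋏ A.dom j d ⋏ A.dom k e ⋏ not (mem4 I t j c d) ⋏
                  A.edge j c k e ⋏ A.edge j d k e)) ⋎
            (mem2 X.E k j ⋏ A.edge k a j a' ⋏ A.edge k b j b' ⋏
              not (exLt A.l fun c => exLt A.l fun d => exLt A.l fun e =>
                A.dom j c ⋏ A.dom j d ⋏ A.dom k e ⋏ not (mem4 I t j c d) ⋏
                  A.edge k e j c ⋏ A.edge k e j d)))))

/-- `X'` is the subgraph of `X` induced on the variables `j` that are reached by the propagation
`I` after `n` steps. -/
def isReachedSubgraph (X' X : DiG) (A : Target) (I : SetVar) : Fm :=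
  (allLt X.size fun j => mem j X'.V ⟺
    exLt A.l fun a => exLt A.l fun b => mem4 I A.n j a b) ⋏
  (allLt X.size fun s => allLt X.size fun s' =>
    mem2 X'.E s s' ⟹ (mem s X'.V ⋏ mem s' X'.V)) ⋏
  (allLt X.size fun s => allLt X.size fun s' =>
    (mem s X'.V ⋏ mem s' X'.V) ⟹ (mem2 X'.E s s' ⟺ mem2 X.E s s'))

/-- The irreducibility check returns "OK" on `(X, A)`: for every variable `i` and every maximal
congruence `σ` on `Dᵢ`, the subinstance on the variables reached by the propagation of `σ` has a
subdirect solution set. -/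
noncomputable def checkOK (Ω : (Fin m → Fin l) → Fin l) (X : DiG) (A : Target) : Fm :=
  allLt X.size fun i =>
    bigAnd (Gamma1 Ω) fun D => domIs A i D ⟹
      bigAnd (maximalCongruences Ω D) fun σ =>
        allSLe (pairBd (pairBd (pairBd A.n A.n) A.l) A.l) fun I =>
          isPropagation X A i σ I ⟹
            allSLe X.size fun V' => allSLe (fourSq X.size) fun E' =>
              isReachedSubgraph ⟨X.size, V', E'⟩ X A I ⟹
                subdirectSolutions ⟨X.size, V', E'⟩ A

/-- The sentence "for every cycle-consistent instance `(X, A)` over the invariant relations of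
`Ω` on which the irreducibility check returns OK, `(X, A)` is irreducible". -/
noncomputable def checkedIsIrreducible (Ω : (Fin m → Fin l) → Fin l) : Formula :=
  close <| allN fun n => allS fun VX => allS fun EX => allS fun VA => allS fun EA =>
    let X : DiG := ⟨n, VX, EX⟩
    let A : Target := ⟨n, num l, VA, EA⟩
    (isInstanceOver Ω X A ⋏ cycleConsistent X A ⋏ checkOK Ω X A) ⟹ irreducible X A

end

end BA

-- Provability means truth in all models, so one argues inside an arbitrary model `M` of V¹. Let a
-- subinstance `Y` of the instance be neither fragmented nor linked, with `a`, `b` in the domain of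
-- `i` not joined by any path of length below `n * l`. It has to be shown that the solution set of
-- `Y` is subdirect.
--
-- Since `Y` is not fragmented, it has a spanning tree with root `i` (`exists_spanning_tree`). A set
-- of pairs (tree vertex, value) is closed if every constraint of the tree respects it in both
-- directions, and two values at the root are related if no closed set separates them. This is a
-- congruence of the root domain (`IsTreeInstance.isCongruence`): complements of closed sets are
-- closed, and for compatibility a closed set is pulled back along `Ω` with all arguments but one
-- fixed to solutions of the tree, which exist by 1-consistency. The congruence is proper, because
-- the component of `(i, b)` in the graph of all values of `Y` yields a closed set that omits `(i,
-- a)` (`exists_separating`). So it lies in a maximal congruence `σ`.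
--
-- Every pair outside `σ` is separated by some closed set. Choose one for each pair; there are
-- finitely many. Induction along the tree shows that at each tree vertex the propagation of `σ`
-- relates all values which the chosen sets do not separate (`code_mem_of_tree`). Hence it reaches
-- every vertex of `Y`, and `Y` is a subgraph of the subgraph on which the check guarantees
-- subdirect solutions. A solution there is also a solution on `Y`.
--
-- Two points make this an argument in V¹. Reachability is not given by a bounded formula, so the
-- search order is built by Σ₁-induction and its termination is the pigeonhole principle
-- (`exists_search`). Being related at the root quantifies over all sets, but the root domain has
-- standard finite size: the congruence is formed in the metatheory, and before the propagation is
-- analysed it is replaced by finitely many set parameters, so that Σ₀-induction applies.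
--
-- The translation between formulas and predicates of the model is done by instance search:
-- `Definable` recognizes the predicates to which the axiom schemes apply, and `FVal` computes the
-- meaning of the formula to be proved.

namespace BA

/-! ## Bounded formulas with parameters from a model -/

/-- A model of `V¹`. -/
class Model.IsV1 (M : Model) : Prop where
  sat : ∀ ψ ∈ V1, M.Satisfies ψ

instance (M : Model) : Zero M.Num := ⟨M.zero⟩
instance (M : Model) : One M.Num := ⟨M.one⟩
instance (M : Model) : Add M.Num := ⟨M.add⟩
instance (M : Model) : Mul M.Num := ⟨M.mul⟩
instance (M : Model) : LE M.Num := ⟨M.le⟩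

/-- An environment for de Bruijn variables of both sorts. -/
structure Env (M : Model) where
  num : ℕ → M.Num
  str : ℕ → M.Str

namespace Env

variable {M : Model}

def headN (e : Env M) : M.Num := e.num 0
def headS (e : Env M) : M.Str := e.str 0
def tailN (e : Env M) : Env M := ⟨fun i => e.num (i + 1), e.str⟩
def pushN (e : Env M) (a : M.Num) : Env M := ⟨fun i => Nat.casesOn i a e.num, e.str⟩
def pushS (e : Env M) (X : M.Str) : Env M := ⟨e.num, fun i => Nat.casesOn i X e.str⟩

@[simp] theorem headN_pushN (e : Env M) (a : M.Num) : (e.pushN a).headN = a := rfl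
@[simp] theorem tailN_pushN (e : Env M) (a : M.Num) : (e.pushN a).tailN = e := rfl
@[simp] theorem headS_pushS (e : Env M) (X : M.Str) : (e.pushS X).headS = X := rfl
@[simp] theorem headS_pushN (e : Env M) (a : M.Num) : (e.pushN a).headS = e.headS := rfl
@[simp] theorem headN_pushS (e : Env M) (X : M.Str) : (e.pushS X).headN = e.headN := rfl

end Env

/-- Set terms: a de Bruijn variable or a parameter. -/
inductive PStr (M : Model) where
  | var (i : ℕ)
  | par (X : M.Str)

/-- Number terms with parameters. -/
inductive PTerm (M : Model) where
  | var (i : ℕ)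
  | par (a : M.Num)
  | zero
  | one
  | add (s t : PTerm M)
  | mul (s t : PTerm M)
  | len (X : PStr M)

/-- Bounded formulas with parameters. -/
inductive PForm (M : Model) where
  | eq (s t : PTerm M)
  | le (s t : PTerm M)
  | mem (t : PTerm M) (X : PStr M)
  | neg (φ : PForm M)
  | and (φ ψ : PForm M)
  | all (t : PTerm M) (φ : PForm M)

section

variable {M : Model}

def PStr.eval (e : Env M) : PStr M → M.Str
  | var i => e.str i
  | par X => X

def PTerm.eval (e : Env M) : PTerm M → M.Num
  | var i => e.num i
  | par a => a
  | zero => 0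
  | one => 1
  | add s t => s.eval e + t.eval e
  | mul s t => s.eval e * t.eval e
  | len X => M.len (X.eval e)

def PForm.Realize (e : Env M) : PForm M → Prop
  | eq s t => s.eval e = t.eval e
  | le s t => s.eval e ≤ t.eval e
  | mem t X => M.mem (t.eval e) (X.eval e)
  | neg φ => ¬ φ.Realize e
  | and φ ψ => φ.Realize e ∧ ψ.Realize e
  -- The bound is evaluated outside the binder, so it cannot contain the bound variable, as the
  -- definition of bounded quantifiers demands.
  | all t φ => ∀ a, a ≤ t.eval e → φ.Realize (e.pushN a)

def PStr.pars : PStr M → List M.Str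
  | var _ => []
  | par X => [X]

def PTerm.parsN : PTerm M → List M.Num
  | par a => [a]
  | add s t => s.parsN ++ t.parsN
  | mul s t => s.parsN ++ t.parsN
  | _ => []

def PTerm.parsS : PTerm M → List M.Str
  | len X => X.pars
  | add s t => s.parsS ++ t.parsS
  | mul s t => s.parsS ++ t.parsS
  | _ => []

def PForm.parsN : PForm M → List M.Num
  | eq s t => s.parsN ++ t.parsN
  | le s t => s.parsN ++ t.parsN
  | mem t _ => t.parsN
  | neg φ => φ.parsN
  | and φ ψ => φ.parsN ++ ψ.parsN
  | all t φ => t.parsN ++ φ.parsN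

def PForm.parsS : PForm M → List M.Str
  | eq s t => s.parsS ++ t.parsS
  | le s t => s.parsS ++ t.parsS
  | mem t X => t.parsS ++ X.pars
  | neg φ => φ.parsS
  | and φ ψ => φ.parsS ++ ψ.parsS
  | all t φ => t.parsS ++ φ.parsS

/-! Names: a free number variable `i` gets the name `3 * i`, the parameter at position `j` of the
list of parameters the name `3 * j + 1`, and the variable bound at depth `d` the name `3 * d + 2`.
A set variable `i` gets the name `3 * i`, a parameter the name `3 * j + 1`. -/

open Classical in
noncomputable def PStr.toVar (K : List M.Str) : PStr M → SetVar
  | var i => ⟨3 * i⟩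
  | par X => ⟨3 * K.idxOf X + 1⟩

open Classical in
noncomputable def PTerm.toTerm (L : List M.Num) (K : List M.Str) (ν : ℕ → ℕ) :
    PTerm M → NumTerm
  | var i => .var (ν i)
  | par a => .var (3 * L.idxOf a + 1)
  | zero => .zero
  | one => .one
  | add s t => .add (s.toTerm L K ν) (t.toTerm L K ν)
  | mul s t => .mul (s.toTerm L K ν) (t.toTerm L K ν)
  | len X => .len (X.toVar K)

noncomputable def PForm.toFormula (L : List M.Num) (K : List M.Str) :
    ℕ → (ℕ → ℕ) → PForm M → Formula
  | _, ν, eq s t => .eqN (s.toTerm L K ν) (t.toTerm L K ν)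
  | _, ν, le s t => .le (s.toTerm L K ν) (t.toTerm L K ν)
  | _, ν, mem t X => .mem (t.toTerm L K ν) (X.toVar K)
  | d, ν, neg φ => .neg (φ.toFormula L K d ν)
  | d, ν, and φ ψ => .and (φ.toFormula L K d ν) (ψ.toFormula L K d ν)
  | d, ν, all t φ => .allNLe (3 * d + 2) (t.toTerm L K ν)
      (φ.toFormula L K (d + 1) (fun i => Nat.casesOn i (3 * d + 2) ν))

/-- `v` and `w` interpret the names of free variables and parameters as `e` does. -/
structure Interprets (L : List M.Num) (K : List M.Str) (ν : ℕ → ℕ) (e : Env M)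
    (v : ℕ → M.Num) (w : ℕ → M.Str) : Prop where
  num : ∀ i, v (ν i) = e.num i
  parN : ∀ j (h : j < L.length), v (3 * j + 1) = L[j]
  str : ∀ i, w (3 * i) = e.str i
  parS : ∀ j (h : j < K.length), w (3 * j + 1) = K[j]

variable {L : List M.Num} {K : List M.Str} {ν : ℕ → ℕ} {e : Env M}
  {v : ℕ → M.Num} {w : ℕ → M.Str}

theorem PStr.toVar_eval (h : Interprets L K ν e v w) (X : PStr M) (hX : X.pars ⊆ K) :
    w (X.toVar K).idx = X.eval e := by
  classical
  cases X with
  | var i => exact h.str i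
  | par X =>
    have hX : X ∈ K := hX (by simp [pars])
    have := h.parS _ (List.idxOf_lt_length_iff.2 hX)
    simp only [toVar, eval]
    convert this
    simp

theorem PTerm.toTerm_eval (h : Interprets L K ν e v w) (t : PTerm M) (hL : t.parsN ⊆ L)
    (hK : t.parsS ⊆ K) : (t.toTerm L K ν).eval M v w = t.eval e := by
  classical
  induction t with
  | var i => exact h.num i
  | par a =>
    have ha : a ∈ L := hL (by simp [parsN])
    have := h.parN _ (List.idxOf_lt_length_iff.2 ha)
    simp only [toTerm, eval, NumTerm.eval]
    convert this
    simp
  | zero => rfl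
  | one => rfl
  | add s t hs ht =>
    simp only [parsN, parsS, List.append_subset] at hL hK
    simp only [toTerm, eval, NumTerm.eval, hs hL.1 hK.1, ht hL.2 hK.2]; rfl
  | mul s t hs ht =>
    simp only [parsN, parsS, List.append_subset] at hL hK
    simp only [toTerm, eval, NumTerm.eval, hs hL.1 hK.1, ht hL.2 hK.2]; rfl
  | len X => simp only [toTerm, eval, NumTerm.eval, PStr.toVar_eval h X hK]

theorem Formula.realize_imp (φ ψ : Formula) :
    (Formula.imp φ ψ).Realize M v w ↔ (φ.Realize M v w → ψ.Realize M v w) := by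
  simp only [Formula.imp, Formula.Realize]; tauto

theorem Formula.realize_iff (φ ψ : Formula) :
    (Formula.iff φ ψ).Realize M v w ↔ (φ.Realize M v w ↔ ψ.Realize M v w) := by
  simp only [Formula.iff, Formula.Realize, Formula.realize_imp]; tauto

/-- The condition on `ν` says that no variable in scope carries a name reserved for binders at depth
`d` or deeper. Updating such a name therefore changes no other variable, and nothing is captured. -/
theorem PForm.realize_toFormula (φ : PForm M) : ∀ {d ν e v}, Interprets L K ν e v w →
    (∀ i d', d ≤ d' → ν i ≠ 3 * d' + 2) → φ.parsN ⊆ L → φ.parsS ⊆ K →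
    ((φ.toFormula L K d ν).Realize M v w ↔ φ.Realize e) := by
  induction φ with
  | eq s t =>
    intro d ν e v h _ hL hK
    simp only [parsN, parsS, List.append_subset] at hL hK
    simp only [toFormula, Formula.Realize, Realize, s.toTerm_eval h hL.1 hK.1,
      t.toTerm_eval h hL.2 hK.2]
  | le s t =>
    intro d ν e v h _ hL hK
    simp only [parsN, parsS, List.append_subset] at hL hK
    simp only [toFormula, Formula.Realize, Realize, s.toTerm_eval h hL.1 hK.1,
      t.toTerm_eval h hL.2 hK.2]
    rfl
  | mem t X =>
    intro d ν e v h _ hL hK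
    simp only [parsN, parsS, List.append_subset] at hL hK
    simp only [toFormula, Formula.Realize, Realize, t.toTerm_eval h hL hK.1,
      X.toVar_eval h hK.2]
  | neg φ ih =>
    intro d ν e v h hν hL hK
    simp only [toFormula, Formula.Realize, Realize, ih h hν hL hK]
  | and φ ψ ih₁ ih₂ =>
    intro d ν e v h hν hL hK
    simp only [parsN, parsS, List.append_subset] at hL hK
    simp only [toFormula, Formula.Realize, Realize, ih₁ h hν hL.1 hK.1, ih₂ h hν hL.2 hK.2]
  | all t φ ih =>
    intro d ν e v h hν hL hK
    simp only [parsN, parsS, List.append_subset] at hL hK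
    have h' : ∀ a, Interprets L K (fun i => Nat.casesOn i (3 * d + 2) ν) (e.pushN a)
        (Function.update v (3 * d + 2) a) w := fun a =>
      { num := by
          rintro (_ | i)
          · simp [Env.pushN]
          · simp only [Env.pushN]
            rw [Function.update_of_ne (hν i d le_rfl)]
            exact h.num i
        parN := fun j hj => by
          rw [Function.update_of_ne (by omega)]
          exact h.parN j hj
        str := h.str
        parS := h.parS }
    have hν' : ∀ i d', d + 1 ≤ d' →
        (Nat.casesOn i (3 * d + 2) ν : ℕ) ≠ 3 * d' + 2 := by
      rintro (_ | i) d' hd'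
      · simp; omega
      · exact hν i d' (by omega)
    have ht : ∀ a, (t.toTerm L K ν).eval M (Function.update v (3 * d + 2) a) w = t.eval e := by
      intro a
      refine t.toTerm_eval ⟨fun i => ?_, (h' a).parN, h.str, h.parS⟩ hL.1 hK.1
      rw [Function.update_of_ne (hν i d le_rfl)]
      exact h.num i
    simp only [toFormula, Formula.allNLe, Formula.Realize, Realize, Formula.realize_imp,
      NumTerm.eval, Function.update_self, ht, ih (h' _) hν' hL.2 hK.2]
    rfl

-- Syntactic side conditions of the axiom schemes

theorem PTerm.not_hasNumVar_toTerm (t : PTerm M) {x : ℕ} (hν : ∀ i, ν i ≠ x) (hx : x % 3 = 2) :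
    ¬ (t.toTerm L K ν).HasNumVar x := by
  induction t with
  | var i => simpa [toTerm, NumTerm.HasNumVar] using (hν i).symm
  | par a => simp only [toTerm, NumTerm.HasNumVar]; omega
  | zero => simp [toTerm, NumTerm.HasNumVar]
  | one => simp [toTerm, NumTerm.HasNumVar]
  | add s t hs ht => simp [toTerm, NumTerm.HasNumVar, hs, ht]
  | mul s t hs ht => simp [toTerm, NumTerm.HasNumVar, hs, ht]
  | len X => simp [toTerm, NumTerm.HasNumVar]

theorem PForm.isSigma0_toFormula (φ : PForm M) : ∀ {d ν},
    (∀ i d', d ≤ d' → ν i ≠ 3 * d' + 2) → (φ.toFormula L K d ν).IsSigma0 := by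
  induction φ with
  | eq s t => exact fun _ => .eqN _ _
  | le s t => exact fun _ => .le _ _
  | mem t X => exact fun _ => .mem _ _
  | neg φ ih => exact fun h => .neg (ih h)
  | and φ ψ ih₁ ih₂ => exact fun h => .and (ih₁ h) (ih₂ h)
  | all t φ ih =>
    intro d ν h
    refine .allNLe (t.not_hasNumVar_toTerm (fun i => h i d le_rfl) (by omega)) (ih ?_)
    rintro (_ | i) d' hd'
    · simp; omega
    · exact h i d' (by omega)

theorem PStr.toVar_ne (X : PStr M) (Y : SetVar) (hY : Y.idx % 3 = 2) : Y ≠ X.toVar K := by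
  rintro rfl
  cases X <;> simp only [toVar] at hY <;> omega

theorem PTerm.not_hasSetVar_toTerm (t : PTerm M) (Y : SetVar) (hY : Y.idx % 3 = 2) :
    ¬ (t.toTerm L K ν).HasSetVar Y := by
  induction t with
  | add s t hs ht => simp [toTerm, NumTerm.HasSetVar, hs, ht]
  | mul s t hs ht => simp [toTerm, NumTerm.HasSetVar, hs, ht]
  | len X => exact X.toVar_ne Y hY
  | _ => simp [toTerm, NumTerm.HasSetVar]

theorem PForm.not_hasFreeSetVar_toFormula (φ : PForm M) (Y : SetVar) (hY : Y.idx % 3 = 2) :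
    ∀ {d ν}, ¬ (φ.toFormula L K d ν).HasFreeSetVar Y := by
  induction φ with
  | eq s t => simp [toFormula, Formula.HasFreeSetVar, PTerm.not_hasSetVar_toTerm _ Y hY]
  | le s t => simp [toFormula, Formula.HasFreeSetVar, PTerm.not_hasSetVar_toTerm _ Y hY]
  | mem t X =>
    simp [toFormula, Formula.HasFreeSetVar, PTerm.not_hasSetVar_toTerm _ Y hY, X.toVar_ne Y hY]
  | neg φ ih => simp [toFormula, Formula.HasFreeSetVar, ih]
  | and φ ψ ih₁ ih₂ => simp [toFormula, Formula.HasFreeSetVar, ih₁, ih₂]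
  | all t φ ih =>
    simp [toFormula, Formula.allNLe, Formula.imp, Formula.HasFreeSetVar, NumTerm.HasSetVar,
      PTerm.not_hasSetVar_toTerm _ Y hY, ih]

/-! ## Substitution -/

theorem NumTerm.eval_subst (x : ℕ) (r t : NumTerm) :
    (NumTerm.subst x r t).eval M v w = t.eval M (Function.update v x (r.eval M v w)) w := by
  induction t with
  | var y =>
    by_cases h : y = x
    · subst h; simp [subst, eval]
    · simp [subst, eval, h]
  | zero => rfl
  | one => rfl
  | add s t hs ht => simp [subst, eval, hs, ht]
  | mul s t hs ht => simp [subst, eval, hs, ht]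
  | len X => rfl

/-- The value of `r` depends on no number variable except `x` and on no set variable. -/
def NumTerm.DependsOnlyOn (M : Model) (x : ℕ) (r : NumTerm) : Prop :=
  ∀ v v' : ℕ → M.Num, ∀ w w' : ℕ → M.Str, v x = v' x → r.eval M v w = r.eval M v' w'

/-- Substitution does not rename binders. This is harmless because the value of `r` is unaffected by
updating a bound variable other than `x`. -/
theorem Formula.realize_subst {x : ℕ} {r : NumTerm} (hr : r.DependsOnlyOn M x) (φ : Formula) :
    ∀ {v w}, (Formula.subst x r φ).Realize M v w ↔
      φ.Realize M (Function.update v x (r.eval M v w)) w := by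
  induction φ with
  | eqN s t => simp [subst, Realize, NumTerm.eval_subst]
  | eqS X Y => simp [subst, Realize]
  | le s t => simp [subst, Realize, NumTerm.eval_subst]
  | mem t X => simp [subst, Realize, NumTerm.eval_subst]
  | neg φ ih => simp [subst, Realize, ih]
  | and φ ψ ih₁ ih₂ => simp [subst, Realize, ih₁, ih₂]
  | or φ ψ ih₁ ih₂ => simp [subst, Realize, ih₁, ih₂]
  | allN y φ ih =>
    intro v w
    by_cases h : y = x
    · subst h; simp [subst, Realize]
    · simp only [subst, h, if_false, Realize, ih]
      refine forall_congr' fun a => ?_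
      rw [Function.update_comm h, hr (Function.update v y a) v w w (by simp [Ne.symm h])]
  | exN y φ ih =>
    intro v w
    by_cases h : y = x
    · subst h; simp [subst, Realize]
    · simp only [subst, h, if_false, Realize, ih]
      refine exists_congr fun a => ?_
      rw [Function.update_comm h, hr (Function.update v y a) v w w (by simp [Ne.symm h])]
  | allS Y φ ih =>
    intro v w
    simp only [subst, Realize, ih]
    refine forall_congr' fun A => ?_
    rw [hr v v (Function.update w Y.idx A) w rfl]
  | exS Y φ ih =>
    intro v w
    simp only [subst, Realize, ih]
    refine exists_congr fun A => ?_
    rw [hr v v (Function.update w Y.idx A) w rfl]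

end

/-! ## Comprehension and induction for bounded formulas with parameters -/

section

variable {M : Model}

/-- An assignment that interprets given parameters. -/
def assignN (L : List M.Num) (e : Env M) (i : ℕ) : M.Num :=
  if h : i % 3 = 1 ∧ i / 3 < L.length then L[i / 3]'h.2 else e.num (i / 3)

def assignS (K : List M.Str) (e : Env M) (i : ℕ) : M.Str :=
  if h : i % 3 = 1 ∧ i / 3 < K.length then K[i / 3]'h.2 else e.str (i / 3)

theorem interprets_assign (L : List M.Num) (K : List M.Str) (e : Env M) :
    Interprets L K (fun i => 3 * i) e (assignN L e) (assignS K e) where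
  num i := by
    rw [assignN, dif_neg (by omega)]; congr 1; omega
  parN j h := by
    have h2 : (3 * j + 1) / 3 = j := by omega
    rw [assignN, dif_pos ⟨by omega, by omega⟩]
    simp only [h2]
  str i := by
    rw [assignS, dif_neg (by omega)]; congr 1; omega
  parS j h := by
    have h2 : (3 * j + 1) / 3 = j := by omega
    rw [assignS, dif_pos ⟨by omega, by omega⟩]
    simp only [h2]

variable [hM : M.IsV1]

theorem PForm.comprehension (φ : PForm M) (e : Env M) (N : M.Num) :
    ∃ X : M.Str, M.len X ≤ N ∧ ∀ y, (y ≤ N ∧ y ≠ N) → (M.mem y X ↔ φ.Realize (e.pushN y)) := by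
  have hν : ∀ i d', 0 ≤ d' → 3 * i ≠ 3 * d' + 2 := by intros; omega
  -- Translation starts at depth 1, so the bound names are 5, 8, and so on. The number name 2 is
  -- free for the length bound and the set name 2 for the new set; the number name 0 is the de
  -- Bruijn variable 0, the candidate element.
  have hax := hM.sat (compAxiom 2 0 ⟨2⟩ (φ.toFormula φ.parsN φ.parsS 1 (fun i => 3 * i)))
    (Or.inr (Or.inl ⟨2, 0, ⟨2⟩, _, by decide, φ.isSigma0_toFormula (fun i d' _ => hν i d' (by omega)),
      φ.not_hasFreeSetVar_toFormula ⟨2⟩ rfl, rfl⟩))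
  have h := hax (assignN φ.parsN (e.pushN N)) (assignS φ.parsS (e.pushN N)) N
  obtain ⟨X, hX, h⟩ := h
  refine ⟨X, ?_, fun y hy => ?_⟩
  · have hX' : M.le (M.len X) N := by simpa [Formula.Realize, NumTerm.eval] using hX
    exact hX'
  · have h := h y
    rw [Formula.realize_imp, Formula.realize_iff] at h
    have hy1 : M.le y N := hy.1
    have h := h ⟨by simpa [Formula.Realize, NumTerm.eval, Formula.lt] using hy1,
      by simpa [Formula.Realize, NumTerm.eval, Formula.lt] using hy.2⟩
    simp only [Formula.Realize, NumTerm.eval, Function.update_self] at h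
    rw [h]
    have hi := interprets_assign φ.parsN φ.parsS (e.pushN N)
    refine φ.realize_toFormula (e := e.pushN y) ⟨?_, ?_, ?_, ?_⟩ (fun i d' _ => hν i d' (by omega))
      (List.Subset.refl _) (List.Subset.refl _)
    · rintro (_ | i)
      · simp [Env.pushN]
      · rw [Function.update_of_ne (by omega), Function.update_of_ne (by omega)]
        exact hi.num (i + 1)
    · intro j hj
      rw [Function.update_of_ne (by omega), Function.update_of_ne (by omega)]
      exact hi.parN j hj
    · intro i
      rw [Function.update_of_ne (show 3 * i ≠ 2 by omega)]
      exact hi.str i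
    · intro j hj
      rw [Function.update_of_ne (show 3 * j + 1 ≠ 2 by omega)]
      exact hi.parS j hj

theorem PForm.sigma1_induction (φ : PForm M) (e : Env M) (B : M.Num)
    (h0 : ∃ Z, M.len Z ≤ B ∧ φ.Realize ((e.pushN 0).pushS Z))
    (hs : ∀ x, (∃ Z, M.len Z ≤ B ∧ φ.Realize ((e.pushN x).pushS Z)) →
      ∃ Z, M.len Z ≤ B ∧ φ.Realize ((e.pushN (x + 1)).pushS Z)) (x : M.Num) :
    ∃ Z, M.len Z ≤ B ∧ φ.Realize ((e.pushN x).pushS Z) := by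
  have hν : ∀ i d', 1 ≤ d' → 3 * i ≠ 3 * d' + 2 := by intros; omega
  -- Number name 0 is the induction variable, number name 2 holds `B`, and set name 0 is the witness
  -- `Z`.
  let ψ : Formula := .exSLe ⟨0⟩ (.var 2) (φ.toFormula φ.parsN φ.parsS 1 (fun i => 3 * i))
  have hψ : ψ.IsSigma1 := .exSLe (by simp [NumTerm.HasSetVar]) (.sigma0 (φ.isSigma0_toFormula hν))
  obtain ⟨Z₀, -⟩ := id h0
  let v := Function.update (assignN φ.parsN (e.pushN 0)) 2 B
  let w := assignS φ.parsS ((e.pushN 0).pushS Z₀)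
  have key : ∀ a, ψ.Realize M (Function.update v 0 a) w ↔
      ∃ Z, M.len Z ≤ B ∧ φ.Realize ((e.pushN a).pushS Z) := by
    intro a
    refine exists_congr fun Z => and_congr ?_ ?_
    · simp only [Formula.Realize, NumTerm.eval, Function.update_self, v,
        Function.update_of_ne (show 2 ≠ 0 by decide)]
      rfl
    · have hi := interprets_assign φ.parsN φ.parsS ((e.pushN 0).pushS Z₀)
      have hv : ∀ i, i ≠ 2 → v i = assignN φ.parsN ((e.pushN 0).pushS Z₀) i :=
        fun i hi => Function.update_of_ne hi _ _
      refine φ.realize_toFormula ⟨?_, ?_, ?_, ?_⟩ hν (List.Subset.refl _) (List.Subset.refl _)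
      · rintro (_ | i)
        · simp [Env.pushN, Env.pushS]
        · rw [Function.update_of_ne (by omega), hv _ (by omega)]
          exact hi.num (i + 1)
      · intro j hj
        rw [Function.update_of_ne (by omega), hv _ (by omega)]
        exact hi.parN j hj
      · rintro (_ | i)
        · simp [Env.pushN, Env.pushS]
        · rw [Function.update_of_ne (by simp)]
          exact hi.str (i + 1)
      · intro j hj
        rw [Function.update_of_ne (by simp)]
        exact hi.parS j hj
  have hax := hM.sat (indAxiom 0 ψ) (Or.inr (Or.inr ⟨0, ψ, hψ, rfl⟩)) v w
  have hd0 : (0 : NumTerm).DependsOnlyOn M 0 := fun _ _ _ _ _ => rfl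
  have hd1 : (NumTerm.var 0 + 1).DependsOnlyOn M 0 := fun v v' w w' h => by
    change M.add (v 0) M.one = M.add (v' 0) M.one
    rw [h]
  rw [indAxiom, Formula.realize_imp] at hax
  refine (key x).1 (hax ⟨?_, fun a => ?_⟩ x)
  · rw [Formula.realize_subst hd0]
    exact (key 0).2 h0
  · rw [Formula.realize_imp, Formula.realize_subst hd1, Function.update_idem]
    intro h
    have h1 : (NumTerm.var 0 + 1).eval M (Function.update v 0 a) w = a + 1 := by
      change M.add (Function.update v 0 a 0) M.one = _
      rw [Function.update_self]; rfl
    rw [h1]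
    exact (key _).2 (hs a ((key a).1 h))

end

/-! ## Definability -/

section

variable {M : Model}

/-- `f` drops leading variables. -/
class IsShift (f : Env M → Env M) : Prop where
  out : ∃ a b : ℕ, ∀ e, f e = ⟨fun i => e.num (i + a), fun i => e.str (i + b)⟩

/-- `f` is the value of a term with parameters. -/
class IsTerm (f : Env M → M.Num) : Prop where
  out : ∃ t : PTerm M, ∀ e, t.eval e = f e

/-- `X` is a set variable or a parameter. -/
class IsSet (X : Env M → M.Str) : Prop where
  out : ∃ t : PStr M, ∀ e, t.eval e = X e

/-- `P` is definable by a bounded formula with parameters. -/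
class Definable (P : Env M → Prop) : Prop where
  out : ∃ φ : PForm M, ∀ e, φ.Realize e ↔ P e

instance : IsShift (fun e : Env M => e) := ⟨0, 0, fun _ => rfl⟩

instance {f : Env M → Env M} [h : IsShift f] : IsShift (fun e => (f e).tailN) := by
  obtain ⟨a, b, h⟩ := h
  refine ⟨a + 1, b, fun e => ?_⟩
  simp only [h, Env.tailN, Env.mk.injEq, and_true]
  funext i; congr 1; omega

instance : IsShift (Env.tailN : Env M → Env M) := ⟨1, 0, fun _ => rfl⟩

instance : IsSet (Env.headS : Env M → M.Str) := ⟨.var 0, fun _ => rfl⟩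

instance : IsTerm (Env.headN : Env M → M.Num) := ⟨.var 0, fun _ => rfl⟩

instance (X : M.Str) : IsSet (fun _ : Env M => X) := ⟨.par X, fun _ => rfl⟩

instance {f : Env M → Env M} [h : IsShift f] : IsSet (fun e => (f e).headS) := by
  obtain ⟨a, b, h⟩ := h
  exact ⟨.var b, fun e => by simp [h, PStr.eval, Env.headS]⟩

instance (c : M.Num) : IsTerm (fun _ : Env M => c) := ⟨.par c, fun _ => rfl⟩

instance {f : Env M → Env M} [h : IsShift f] : IsTerm (fun e => (f e).headN) := by
  obtain ⟨a, b, h⟩ := h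
  exact ⟨.var a, fun e => by simp [h, PTerm.eval, Env.headN]⟩

instance {f g : Env M → M.Num} [hf : IsTerm f] [hg : IsTerm g] : IsTerm (fun e => f e + g e) := by
  obtain ⟨s, hs⟩ := hf
  obtain ⟨t, ht⟩ := hg
  exact ⟨.add s t, fun e => by simp [PTerm.eval, hs, ht]⟩

instance {f g : Env M → M.Num} [hf : IsTerm f] [hg : IsTerm g] : IsTerm (fun e => f e * g e) := by
  obtain ⟨s, hs⟩ := hf
  obtain ⟨t, ht⟩ := hg
  exact ⟨.mul s t, fun e => by simp [PTerm.eval, hs, ht]⟩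

instance {X : Env M → M.Str} [hX : IsSet X] : IsTerm (fun e => M.len (X e)) := by
  obtain ⟨t, ht⟩ := hX
  exact ⟨.len t, fun e => by simp [PTerm.eval, ht]⟩

theorem Definable.eq_term (f g : Env M → M.Num) [hf : IsTerm f] [hg : IsTerm g] :
    Definable (fun e => f e = g e) := by
  obtain ⟨s, hs⟩ := hf
  obtain ⟨t, ht⟩ := hg
  exact ⟨.eq s t, fun e => by simp [PForm.Realize, hs, ht]⟩

theorem Definable.le_term (f g : Env M → M.Num) [hf : IsTerm f] [hg : IsTerm g] :
    Definable (fun e => f e ≤ g e) := by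
  obtain ⟨s, hs⟩ := hf
  obtain ⟨t, ht⟩ := hg
  exact ⟨.le s t, fun e => by simp [PForm.Realize, hs, ht]⟩

theorem Definable.mem_term (f : Env M → M.Num) (X : Env M → M.Str) [hf : IsTerm f]
    [hX : IsSet X] : Definable (fun e => M.mem (f e) (X e)) := by
  obtain ⟨s, hs⟩ := hf
  obtain ⟨t, ht⟩ := hX
  exact ⟨.mem s t, fun e => by simp [PForm.Realize, hs, ht]⟩

instance Definable.not {P : Env M → Prop} [hP : Definable P] : Definable (fun e => ¬ P e) := by
  obtain ⟨φ, hφ⟩ := hP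
  exact ⟨.neg φ, fun e => by simp [PForm.Realize, hφ]⟩

instance Definable.and {P Q : Env M → Prop} [hP : Definable P] [hQ : Definable Q] :
    Definable (fun e => P e ∧ Q e) := by
  obtain ⟨φ, hφ⟩ := hP
  obtain ⟨ψ, hψ⟩ := hQ
  exact ⟨.and φ ψ, fun e => by simp [PForm.Realize, hφ, hψ]⟩

theorem Definable.congr {P Q : Env M → Prop} (hP : Definable P) (h : ∀ e, Q e ↔ P e) :
    Definable Q := by
  obtain ⟨φ, hφ⟩ := hP
  exact ⟨φ, fun e => (hφ e).trans (h e).symm⟩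

instance Definable.or {P Q : Env M → Prop} [Definable P] [Definable Q] :
    Definable (fun e => P e ∨ Q e) :=
  congr (P := fun e => ¬ (¬ P e ∧ ¬ Q e)) inferInstance fun e => by tauto

instance Definable.imp {P Q : Env M → Prop} [Definable P] [Definable Q] :
    Definable (fun e => P e → Q e) :=
  congr (P := fun e => ¬ (P e ∧ ¬ Q e)) inferInstance fun e => by tauto

instance Definable.iff {P Q : Env M → Prop} [Definable P] [Definable Q] :
    Definable (fun e => P e ↔ Q e) :=
  congr (P := fun e => (P e → Q e) ∧ (Q e → P e)) inferInstance fun e => by tauto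

theorem Definable.all_le_term (f : Env M → M.Num) {P : Env M → M.Num → Prop} [hf : IsTerm f]
    [hP : Definable fun e => P e.tailN e.headN] : Definable (fun e => ∀ x, x ≤ f e → P e x) := by
  obtain ⟨t, ht⟩ := hf
  obtain ⟨φ, hφ⟩ := hP
  exact ⟨.all t φ, fun e => by simp [PForm.Realize, hφ, ht]⟩

instance Definable.const (p : Prop) : Definable (fun _ : Env M => p) := by
  by_cases hp : p
  · exact congr (.eq_term (fun _ => 0) (fun _ => 0)) fun e => by simp [hp]
  · exact congr (P := fun _ => ¬ (0 : M.Num) = 0)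
      (@Definable.not _ _ (.eq_term (fun _ => 0) (fun _ => 0))) fun e => by simp [hp]

/-- Quantifiers over standard finite types unfold to finite conjunctions. This covers quantification
over tuples of elements of the algebra and over a finite family of set parameters. -/
instance Definable.all_fin {ι : Type} [Finite ι] {P : ι → Env M → Prop} [h : ∀ i, Definable (P i)] :
    Definable (fun e => ∀ i, P i e) := by
  have := Fintype.ofFinite ι
  classical
  have key : ∀ s : Finset ι, Definable (fun e => ∀ i ∈ s, P i e) := fun s => by
    induction s using Finset.induction_on with
    | empty => exact congr (const True) fun e => by simp
    | insert a s ha ih =>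
      exact congr (P := fun e => P a e ∧ ∀ i ∈ s, P i e) inferInstance fun e => by simp
  exact congr (key Finset.univ) fun e => by simp

instance Definable.ex_fin {ι : Type} [Finite ι] {P : ι → Env M → Prop} [h : ∀ i, Definable (P i)] :
    Definable (fun e => ∃ i, P i e) :=
  congr (P := fun e => ¬ ∀ i, ¬ P i e) inferInstance fun e => by simp

/-! ## The axioms 2-BASIC in a model -/

variable [hM : M.IsV1]

theorem realize_twoBasic {φ : Fm} (h : φ ∈ twoBasic) :
    φ.close.Realize M (fun _ => 0) (fun _ => Classical.choice M.strNonempty) :=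
  hM.sat _ (Or.inl ⟨φ, h, rfl⟩) _ _

theorem Num.add_one_ne_zero (x : M.Num) : x + 1 ≠ 0 :=
  realize_twoBasic (M := M) (φ := Fm.allN fun x => Fm.not (Fm.eq (x + 1) 0))
    (by simp [twoBasic]) x

theorem Num.add_one_inj {x y : M.Num} (h : x + 1 = y + 1) : x = y := by
  have := realize_twoBasic (M := M)
    (φ := Fm.allN fun x => Fm.allN fun y => Fm.eq (x + 1) (y + 1) ⟹ Fm.eq x y)
    (by simp [twoBasic]) x y
  exact (Formula.realize_imp _ _).1 this h

theorem Num.add_zero (x : M.Num) : x + 0 = x :=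
  realize_twoBasic (M := M) (φ := Fm.allN fun x => Fm.eq (x + 0) x) (by simp [twoBasic]) x

theorem Num.add_add_one (x y : M.Num) : x + (y + 1) = (x + y) + 1 :=
  realize_twoBasic (M := M)
    (φ := Fm.allN fun x => Fm.allN fun y => Fm.eq (x + (y + 1)) ((x + y) + 1))
    (by simp [twoBasic]) x y

theorem Num.mul_zero (x : M.Num) : x * 0 = 0 :=
  realize_twoBasic (M := M) (φ := Fm.allN fun x => Fm.eq (x * 0) 0) (by simp [twoBasic]) x

theorem Num.mul_add_one (x y : M.Num) : x * (y + 1) = x * y + x :=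
  realize_twoBasic (M := M)
    (φ := Fm.allN fun x => Fm.allN fun y => Fm.eq (x * (y + 1)) ((x * y) + x))
    (by simp [twoBasic]) x y

theorem Num.le_antisymm {x y : M.Num} (h₁ : x ≤ y) (h₂ : y ≤ x) : x = y := by
  have := realize_twoBasic (M := M)
    (φ := Fm.allN fun x => Fm.allN fun y => (Fm.le x y ⋏ Fm.le y x) ⟹ Fm.eq x y)
    (by simp [twoBasic]) x y
  exact (Formula.realize_imp _ _).1 this ⟨h₁, h₂⟩

theorem Num.le_add_right (x y : M.Num) : x ≤ x + y :=
  realize_twoBasic (M := M) (φ := Fm.allN fun x => Fm.allN fun y => Fm.le x (x + y))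
    (by simp [twoBasic]) x y

theorem Num.zero_le (x : M.Num) : 0 ≤ x :=
  realize_twoBasic (M := M) (φ := Fm.allN fun x => Fm.le 0 x) (by simp [twoBasic]) x

theorem Num.le_total (x y : M.Num) : x ≤ y ∨ y ≤ x :=
  realize_twoBasic (M := M)
    (φ := Fm.allN fun x => Fm.allN fun y => Fm.le x y ⋎ Fm.le y x) (by simp [twoBasic]) x y

theorem Num.le_iff (x y : M.Num) : x ≤ y ↔ x ≤ y + 1 ∧ x ≠ y + 1 := by
  have := realize_twoBasic (M := M)
    (φ := Fm.allN fun x => Fm.allN fun y => Fm.le x y ⟺ Fm.lt x (y + 1))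
    (by simp [twoBasic]) x y
  exact (Formula.realize_iff _ _).1 this

theorem Num.exists_pred {x : M.Num} (h : x ≠ 0) : ∃ y, y + 1 = x := by
  have := realize_twoBasic (M := M)
    (φ := Fm.allN fun x => Fm.not (Fm.eq x 0) ⟹ Fm.exLe x fun y => Fm.eq (y + 1) x)
    (by simp [twoBasic]) x
  obtain ⟨y, -, hy⟩ := (Formula.realize_imp _ _).1 this h
  exact ⟨y, hy⟩

theorem Num.lt_len {y : M.Num} {X : M.Str} (h : M.mem y X) : y ≤ M.len X ∧ y ≠ M.len X := by
  have := realize_twoBasic (M := M)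
    (φ := Fm.allS fun X => Fm.allN fun y => Fm.mem y X ⟹ Fm.lt y (.len X))
    (by simp [twoBasic]) X y
  exact (Formula.realize_imp _ _).1 this h

theorem sigma1_induction {P : M.Num → M.Str → Prop} [hP : Definable fun e => P e.headN e.headS]
    (B : M.Num) (h0 : ∃ Z, M.len Z ≤ B ∧ P 0 Z)
    (hs : ∀ x, (∃ Z, M.len Z ≤ B ∧ P x Z) → ∃ Z, M.len Z ≤ B ∧ P (x + 1) Z) (x : M.Num) :
    ∃ Z, M.len Z ≤ B ∧ P x Z := by
  obtain ⟨φ, hφ⟩ := hP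
  have := M.strNonempty
  have := φ.sigma1_induction ⟨fun _ => 0, fun _ => Classical.arbitrary _⟩ B
    (by simpa [hφ] using h0) (by simpa [hφ] using hs) x
  simpa [hφ] using this

/-- The case of Σ₁-induction in which the set witness plays no role. -/
theorem sigma0_induction {P : M.Num → Prop} [hP : Definable fun e => P e.headN] (h0 : P 0)
    (hs : ∀ x, P x → P (x + 1)) (x : M.Num) : P x := by
  obtain ⟨Z⟩ := M.strNonempty
  have hZ : M.len Z ≤ M.len Z := (Num.le_total _ _).elim id id
  exact (sigma1_induction (P := fun x _ => P x) (hP := hP) (M.len Z) ⟨Z, hZ, h0⟩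
    (fun x ⟨_, _, h⟩ => ⟨Z, hZ, hs x h⟩) x).elim fun _ h => h.2

/-! ## Numbers form an ordered commutative semiring -/

namespace Num

attribute [local instance] Definable.eq_term Definable.le_term

theorem zero_add (x : M.Num) : 0 + x = x :=
  sigma0_induction (P := fun x => 0 + x = x) (add_zero 0)
    (fun x h => by rw [add_add_one, h]) x

theorem add_assoc (x y z : M.Num) : x + y + z = x + (y + z) :=
  sigma0_induction (P := fun z => x + y + z = x + (y + z)) (by rw [add_zero, add_zero])
    (fun z h => by rw [add_add_one, add_add_one, add_add_one, h]) z

theorem one_add (x : M.Num) : 1 + x = x + 1 :=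
  sigma0_induction (P := fun x => 1 + x = x + 1) (by rw [add_zero, zero_add])
    (fun x h => by rw [add_add_one, h]) x

theorem add_comm (x y : M.Num) : x + y = y + x :=
  sigma0_induction (P := fun y => x + y = y + x) (by rw [add_zero, zero_add])
    (fun y h => by rw [add_add_one, h, add_assoc, add_assoc, one_add]) y

theorem zero_mul (x : M.Num) : 0 * x = 0 :=
  sigma0_induction (P := fun x => 0 * x = 0) (mul_zero 0)
    (fun x h => by rw [mul_add_one, h, add_zero]) x

theorem one_mul (x : M.Num) : 1 * x = x :=
  sigma0_induction (P := fun x => 1 * x = x) (mul_zero 1)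
    (fun x h => by rw [mul_add_one, h]) x

theorem add_one_mul (x y : M.Num) : (x + 1) * y = x * y + y :=
  sigma0_induction (P := fun y => (x + 1) * y = x * y + y) (by rw [mul_zero, mul_zero, add_zero])
    (fun y h => by
      rw [mul_add_one, h, mul_add_one, add_assoc, add_assoc, add_add_one y, add_add_one x,
        add_comm x y]) y

theorem mul_comm (x y : M.Num) : x * y = y * x :=
  sigma0_induction (P := fun y => x * y = y * x) (by rw [mul_zero, zero_mul])
    (fun y h => by rw [mul_add_one, h, add_one_mul]) y

theorem mul_add (x y z : M.Num) : x * (y + z) = x * y + x * z :=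
  sigma0_induction (P := fun z => x * (y + z) = x * y + x * z)
    (by rw [add_zero, mul_zero, add_zero])
    (fun z h => by rw [add_add_one, mul_add_one, mul_add_one, h, add_assoc]) z

theorem mul_assoc (x y z : M.Num) : x * y * z = x * (y * z) :=
  sigma0_induction (P := fun z => x * y * z = x * (y * z)) (by rw [mul_zero, mul_zero, mul_zero])
    (fun z h => by rw [mul_add_one, mul_add_one, mul_add, h]) z

instance : CommSemiring M.Num where
  add_assoc := add_assoc
  zero_add := zero_add
  add_zero := add_zero
  add_comm := add_comm
  nsmul := nsmulRec
  left_distrib := mul_add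
  right_distrib x y z := by rw [mul_comm, mul_add, mul_comm z x, mul_comm z y]
  zero_mul := zero_mul
  mul_zero := mul_zero
  mul_assoc := mul_assoc
  one_mul := one_mul
  mul_one x := by rw [mul_comm, one_mul]
  mul_comm := mul_comm

theorem add_right_cancel {x y z : M.Num} : x + z = y + z → x = y :=
  sigma0_induction (P := fun z => x + z = y + z → x = y) (by rw [add_zero, add_zero]; exact id)
    (fun z h h' => h (by rw [add_add_one, add_add_one] at h'; exact add_one_inj h')) z

/-- The existential has no bound, so induction cannot be applied to it. Instead, assuming that no
difference exists, one proves `¬ y ≤ x + y'` for all `y'` by induction and contradicts this at `y' =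
y`. -/
theorem exists_add_of_le {x y : M.Num} (h : x ≤ y) : ∃ z, y = x + z := by
  revert h
  refine fun h => by_contra fun hn => ?_
  have key : ∀ y', ¬ y ≤ x + y' :=
    sigma0_induction (P := fun y' => ¬ y ≤ x + y')
      (fun h' => hn ⟨0, by rw [add_zero] at h' ⊢; exact le_antisymm h' h⟩)
      (fun z hz h' => hz ((le_iff _ _).2 ⟨by rwa [add_add_one] at h',
        fun e => hn ⟨z + 1, by rw [e, add_add_one]⟩⟩))
  exact key y (by rw [add_comm]; exact le_add_right _ _)

noncomputable instance : LinearOrder M.Num where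
  le := (· ≤ ·)
  le_refl x := (le_total x x).elim id id
  le_trans x y z h₁ h₂ := by
    obtain ⟨a, rfl⟩ := exists_add_of_le h₁
    obtain ⟨b, rfl⟩ := exists_add_of_le h₂
    rw [add_assoc]; exact le_add_right _ _
  le_antisymm _ _ := le_antisymm
  le_total := le_total
  toDecidableLE := Classical.decRel _

theorem lt_iff_add_one_le {x y : M.Num} : x < y ↔ x + 1 ≤ y := by
  constructor
  · intro h
    obtain ⟨z, rfl⟩ := exists_add_of_le h.le
    have hz : z ≠ 0 := by rintro rfl; rw [add_zero] at h; exact lt_irrefl _ h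
    obtain ⟨w, rfl⟩ := exists_pred hz
    rw [add_comm w, ← add_assoc]; exact le_add_right _ _
  · intro h
    exact lt_of_lt_of_le (lt_of_le_of_ne (le_add_right x 1) fun h => add_one_ne_zero (0 : M.Num)
      (add_right_cancel (z := x) (by rw [zero_add, zero_add, add_comm, ← h]))) h

theorem lt_add_one_iff {x y : M.Num} : x < y + 1 ↔ x ≤ y := by
  rw [le_iff, lt_iff_le_and_ne]

theorem mul_lt_mul_left {a b c : M.Num} (hc : 0 < c) (h : a < b) : c * a < c * b := by
  obtain ⟨d, rfl⟩ := exists_add_of_le (lt_iff_add_one_le.1 h)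
  obtain ⟨c, rfl⟩ := exists_pred hc.ne'
  have : (c + 1) * (a + 1 + d) = ((c + 1) * a + 1) + (c + c * d + d) := by ring
  rw [this]
  exact lt_iff_add_one_le.2 (le_add_right _ _)

instance : IsStrictOrderedRing M.Num where
  add_le_add_left a b h c := by
    obtain ⟨d, rfl⟩ := exists_add_of_le h
    have : a + d + c = a + c + d := by ring
    rw [this]; exact le_add_right _ _
  zero_le_one := zero_le 1
  le_of_add_le_add_left a b c h := by
    obtain ⟨d, hd⟩ := exists_add_of_le h
    have : c = b + d := add_right_cancel (z := a) (by rw [add_comm c, hd]; ring)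
    rw [this]; exact le_add_right _ _
  exists_pair_ne := ⟨0, 1, fun h => add_one_ne_zero (0 : M.Num) (by rw [zero_add, h])⟩
  mul_lt_mul_of_pos_left a ha b c h := mul_lt_mul_left ha h
  mul_lt_mul_of_pos_right a ha b c h := by
    simpa only [mul_comm _ a] using mul_lt_mul_left ha h

instance : CanonicallyOrderedAdd M.Num where
  exists_add_of_le := exists_add_of_le
  le_add_self a b := by rw [add_comm]; exact le_add_right _ _
  le_self_add := le_add_right

end Num

end

/-! ## Renaming variables -/

section

variable {M : Model}

instance : Membership M.Num M.Str := ⟨fun X y => M.mem y X⟩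

def Env.rename (ρ σ : ℕ → ℕ) (e : Env M) : Env M := ⟨fun i => e.num (ρ i), fun i => e.str (σ i)⟩

def PStr.rename (σ : ℕ → ℕ) : PStr M → PStr M
  | var i => var (σ i)
  | par X => par X

def PTerm.rename (ρ σ : ℕ → ℕ) : PTerm M → PTerm M
  | var i => var (ρ i)
  | par a => par a
  | zero => zero
  | one => one
  | add s t => add (s.rename ρ σ) (t.rename ρ σ)
  | mul s t => mul (s.rename ρ σ) (t.rename ρ σ)
  | len X => len (X.rename σ)

def PForm.rename (σ : ℕ → ℕ) : (ℕ → ℕ) → PForm M → PForm M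
  | ρ, eq s t => eq (s.rename ρ σ) (t.rename ρ σ)
  | ρ, le s t => le (s.rename ρ σ) (t.rename ρ σ)
  | ρ, mem t X => mem (t.rename ρ σ) (X.rename σ)
  | ρ, neg φ => neg (φ.rename σ ρ)
  | ρ, and φ ψ => and (φ.rename σ ρ) (ψ.rename σ ρ)
  | ρ, all t φ => all (t.rename ρ σ) (φ.rename σ (fun i => Nat.casesOn i 0 (fun i => ρ i + 1)))

theorem PStr.eval_rename (ρ σ : ℕ → ℕ) (e : Env M) (X : PStr M) :
    (X.rename σ).eval e = X.eval (e.rename ρ σ) := by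
  cases X <;> rfl

theorem PTerm.eval_rename (ρ σ : ℕ → ℕ) (e : Env M) (t : PTerm M) :
    (t.rename ρ σ).eval e = t.eval (e.rename ρ σ) := by
  induction t with
  | add s t hs ht => simp [rename, eval, hs, ht]
  | mul s t hs ht => simp [rename, eval, hs, ht]
  | len X => simp [rename, eval, X.eval_rename ρ σ]
  | _ => rfl

theorem PForm.realize_rename (σ : ℕ → ℕ) (φ : PForm M) :
    ∀ {ρ : ℕ → ℕ} {e : Env M}, (φ.rename σ ρ).Realize e ↔ φ.Realize (e.rename ρ σ) := by
  induction φ with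
  | eq s t => simp [rename, Realize, PTerm.eval_rename]
  | le s t => simp [rename, Realize, PTerm.eval_rename]
  | mem t X => intro ρ e; simp [rename, Realize, PTerm.eval_rename, PStr.eval_rename ρ σ]
  | neg φ ih => simp [rename, Realize, ih]
  | and φ ψ ih₁ ih₂ => simp [rename, Realize, ih₁, ih₂]
  | all t φ ih =>
    intro ρ e
    simp only [rename, Realize, ih, PTerm.eval_rename]
    refine forall_congr' fun a => imp_congr_right fun _ => ?_
    have : (e.pushN a).rename (fun i => Nat.casesOn i 0 (fun i => ρ i + 1)) σ =
        (e.rename ρ σ).pushN a := by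
      simp only [Env.rename, Env.pushN, Env.mk.injEq, and_true]
      funext i
      cases i <;> rfl
    rw [this]

theorem Definable.rename {P : Env M → Prop} (h : Definable P) (ρ σ : ℕ → ℕ) :
    Definable (fun e => P (e.rename ρ σ)) := by
  obtain ⟨φ, hφ⟩ := h
  exact ⟨φ.rename σ ρ, fun e => by rw [PForm.realize_rename, hφ]⟩

theorem Definable.comp_tailN {P : Env M → Prop} (h : Definable P) :
    Definable (fun e => P e.tailN) :=
  h.rename (· + 1) id

/-! ## Definable functions -/

/-- `f` has a definable graph and is bounded by a term. -/
class DefinableFn (f : Env M → M.Num) : Prop where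
  bound : ∃ t : PTerm M, ∀ e, f e ≤ t.eval e
  graph : Definable (fun e => e.headN = f e.tailN)

theorem Definable.ex_le_term (f : Env M → M.Num) {P : Env M → M.Num → Prop} [hf : IsTerm f]
    (hP : Definable fun e => P e.tailN e.headN) : Definable (fun e => ∃ x, x ≤ f e ∧ P e x) :=
  congr (P := fun e => ¬ ∀ x, x ≤ f e → ¬ P e x)
    (@Definable.not _ _ (all_le_term f)) fun e => by simp

/-- The term bounding `f` lets `P e (f e)` be written with a bounded quantifier: some `x` below the
bound is the value of `f` and satisfies `P`. -/
theorem Definable.subst {f : Env M → M.Num} (hf : DefinableFn f) {P : Env M → M.Num → Prop}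
    (hP : Definable fun e => P e.tailN e.headN) : Definable (fun e => P e (f e)) := by
  obtain ⟨⟨t, ht⟩, hg⟩ := hf
  have : IsTerm t.eval := ⟨t, fun _ => rfl⟩
  refine congr (ex_le_term t.eval (P := fun e x => x = f e ∧ P e x)
    (@Definable.and _ _ _ hg hP)) fun e => ?_
  exact ⟨fun h => ⟨_, ht e, rfl, h⟩, fun ⟨x, _, hx, h⟩ => hx ▸ h⟩

theorem DefinableFn.comp_tailN {f : Env M → M.Num} (h : DefinableFn f) :
    DefinableFn (fun e => f e.tailN) := by
  obtain ⟨⟨t, ht⟩, hg⟩ := h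
  exact ⟨⟨t.rename (· + 1) id, fun e => by rw [PTerm.eval_rename]; exact ht _⟩,
    hg.rename (fun | 0 => 0 | i + 1 => i + 2) id⟩

theorem IsSet.comp_tailN {X : Env M → M.Str} (h : IsSet X) : IsSet (fun e => X e.tailN) := by
  obtain ⟨t, ht⟩ := h
  exact ⟨t, fun e => by rw [← ht]; cases t <;> rfl⟩

theorem IsShift.definableFn {f : Env M → M.Num} (hf : DefinableFn f) {s : Env M → Env M}
    [hs : IsShift s] : DefinableFn (fun e => f (s e)) := by
  obtain ⟨a, b, hs⟩ := hs
  obtain ⟨⟨t, ht⟩, hg⟩ := hf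
  obtain rfl : s = Env.rename (· + a) (· + b) := funext hs
  exact ⟨⟨t.rename (· + a) (· + b), fun e => by rw [PTerm.eval_rename]; exact ht _⟩,
    hg.rename (fun | 0 => 0 | i + 1 => i + a + 1) (· + b)⟩

theorem IsShift.isSet {X : Env M → M.Str} (hX : IsSet X) {s : Env M → Env M}
    [hs : IsShift s] : IsSet (fun e => X (s e)) := by
  obtain ⟨a, b, hs⟩ := hs
  obtain ⟨t, ht⟩ := hX
  obtain rfl : s = Env.rename (· + a) (· + b) := funext hs
  exact ⟨t.rename (· + b), fun e => by rw [PStr.eval_rename (· + a), ht]⟩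

/-- A definable relation between definable functions. -/
theorem Definable.app₂ {P : M.Num → M.Num → Prop} (hP : Definable fun e => P e.tailN.headN e.headN)
    (f g : Env M → M.Num) [hf : DefinableFn f] [hg : DefinableFn g] :
    Definable (fun e => P (f e) (g e)) :=
  subst hf (P := fun e x => P x (g e)) (subst hg.comp_tailN (P := fun e x => P e.headN x) hP)

theorem Definable.app₃ {P : M.Num → M.Num → M.Num → Prop}
    (hP : Definable fun e => P e.tailN.tailN.headN e.tailN.headN e.headN)
    (f g h : Env M → M.Num) [hf : DefinableFn f] [hg : DefinableFn g] [hh : DefinableFn h] :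
    Definable (fun e => P (f e) (g e) (h e)) :=
  subst hf (P := fun e x => P x (g e) (h e)) (subst hg.comp_tailN
    (P := fun e x => P e.headN x (h e.tailN)) (subst hh.comp_tailN.comp_tailN
      (P := fun e x => P e.tailN.headN e.headN x) hP))

variable [hM : M.IsV1]

theorem DefinableFn.of_isTerm {f : Env M → M.Num} (hf : IsTerm f) : DefinableFn f := by
  obtain ⟨t, ht⟩ := hf
  refine ⟨⟨t, fun e => (ht e).ge⟩, ?_⟩
  have : IsTerm (fun e => f e.tailN) :=
    ⟨t.rename (· + 1) id, fun e => by rw [PTerm.eval_rename]; exact ht _⟩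
  exact Definable.eq_term _ _

instance (c : M.Num) : DefinableFn (fun _ : Env M => c) := .of_isTerm inferInstance

instance : DefinableFn (Env.headN : Env M → M.Num) := .of_isTerm inferInstance

instance {f : Env M → Env M} [h : IsShift f] : DefinableFn (fun e => (f e).headN) :=
  .of_isTerm inferInstance

instance {X : Env M → M.Str} [IsSet X] : DefinableFn (fun e => M.len (X e)) :=
  .of_isTerm inferInstance

instance Definable.eq {f g : Env M → M.Num} [hf : DefinableFn f] [hg : DefinableFn g] :
    Definable (fun e => f e = g e) :=
  subst hf (P := fun e x => x = g e) hg.graph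

instance Definable.le {f g : Env M → M.Num} [hf : DefinableFn f] [hg : DefinableFn g] :
    Definable (fun e => f e ≤ g e) :=
  subst hf (P := fun e x => x ≤ g e) (subst hg.comp_tailN (P := fun e x => e.headN ≤ x)
    (le_term _ _))

instance Definable.lt {f g : Env M → M.Num} [hf : DefinableFn f] [hg : DefinableFn g] :
    Definable (fun e => f e < g e) :=
  congr (P := fun e => ¬ g e ≤ f e) inferInstance fun _ => not_le.symm

instance Definable.mem {f : Env M → M.Num} {X : Env M → M.Str} [hf : DefinableFn f]
    [hX : IsSet X] : Definable (fun e => f e ∈ X e) :=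
  have := hX.comp_tailN
  subst hf (P := fun e x => x ∈ X e) (mem_term _ _)

instance {f g : Env M → M.Num} [hf : DefinableFn f] [hg : DefinableFn g] :
    DefinableFn (fun e => f e + g e) := by
  refine ⟨?_, ?_⟩
  · obtain ⟨⟨s, hs⟩, _⟩ := hf
    obtain ⟨⟨t, ht⟩, _⟩ := hg
    exact ⟨.add s t, fun e => add_le_add (hs e) (ht e)⟩
  · exact .subst hf.comp_tailN (P := fun e x => e.headN = x + g e.tailN)
      (.subst hg.comp_tailN.comp_tailN (P := fun e y => e.tailN.headN = e.headN + y)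
        (.eq_term _ _))

instance {f g : Env M → M.Num} [hf : DefinableFn f] [hg : DefinableFn g] :
    DefinableFn (fun e => f e * g e) := by
  refine ⟨?_, ?_⟩
  · obtain ⟨⟨s, hs⟩, _⟩ := hf
    obtain ⟨⟨t, ht⟩, _⟩ := hg
    exact ⟨.mul s t, fun e => mul_le_mul' (hs e) (ht e)⟩
  · exact .subst hf.comp_tailN (P := fun e x => e.headN = x * g e.tailN)
      (.subst hg.comp_tailN.comp_tailN (P := fun e y => e.tailN.headN = e.headN * y)
        (.eq_term _ _))

instance {P : Env M → Prop} {d : ∀ e, Decidable (P e)} {f g : Env M → M.Num} [hP : Definable P]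
    [hf : DefinableFn f] [hg : DefinableFn g] :
    DefinableFn (fun e => @ite _ (P e) (d e) (f e) (g e)) := by
  refine ⟨?_, ?_⟩
  · obtain ⟨⟨s, hs⟩, _⟩ := hf
    obtain ⟨⟨t, ht⟩, _⟩ := hg
    refine ⟨.add s t, fun e => ?_⟩
    by_cases h : P e
    · rw [if_pos h]; exact (hs e).trans le_self_add
    · rw [if_neg h]; exact (ht e).trans le_add_self
  · have := hP.comp_tailN
    have := hf.graph
    have := hg.graph
    refine Definable.congr (P := fun e => (P e.tailN → e.headN = f e.tailN) ∧
      (¬ P e.tailN → e.headN = g e.tailN)) inferInstance fun e => ?_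
    by_cases h : P e.tailN <;> simp [h]

instance Definable.all_le {f : Env M → M.Num} {P : Env M → M.Num → Prop} [hf : DefinableFn f]
    [hP : Definable fun e => P e.tailN e.headN] : Definable (fun e => ∀ x, x ≤ f e → P e x) :=
  subst hf (P := fun e y => ∀ x, x ≤ y → P e x)
    (@all_le_term _ _ (fun e x => P e.tailN x) _
      (hP.rename (fun | 0 => 0 | i + 1 => i + 2) id))

instance Definable.all_lt {f : Env M → M.Num} {P : Env M → M.Num → Prop} [hf : DefinableFn f]
    [hP : Definable fun e => P e.tailN e.headN] : Definable (fun e => ∀ x, x < f e → P e x) :=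
  have := hf.comp_tailN
  congr (P := fun e => ∀ x, x ≤ f e → (x < f e → P e x)) inferInstance
    fun _ => ⟨fun h x _ => h x, fun h x hx => h x hx.le hx⟩

instance Definable.ex_le {f : Env M → M.Num} {P : Env M → M.Num → Prop} [hf : DefinableFn f]
    [hP : Definable fun e => P e.tailN e.headN] : Definable (fun e => ∃ x, x ≤ f e ∧ P e x) :=
  congr (P := fun e => ¬ ∀ x, x ≤ f e → ¬ P e x) inferInstance fun e => by simp

instance Definable.ex_lt {f : Env M → M.Num} {P : Env M → M.Num → Prop} [hf : DefinableFn f]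
    [hP : Definable fun e => P e.tailN e.headN] : Definable (fun e => ∃ x, x < f e ∧ P e x) :=
  congr (P := fun e => ¬ ∀ x, x < f e → ¬ P e x) inferInstance fun e => by simp

/-! ## Comprehension and the least number principle -/

theorem lt_len {y : M.Num} {X : M.Str} (h : y ∈ X) : y < M.len X :=
  lt_of_le_of_ne (Num.lt_len h).1 (Num.lt_len h).2

theorem comprehension (P : M.Num → Prop) [hP : Definable fun e => P e.headN] (N : M.Num) :
    ∃ X : M.Str, M.len X ≤ N ∧ ∀ y, y < N → (y ∈ X ↔ P y) := by
  obtain ⟨φ, hφ⟩ := hP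
  obtain ⟨X, hX, h⟩ := φ.comprehension ⟨fun _ => 0, fun _ => Classical.choice M.strNonempty⟩ N
  exact ⟨X, hX, fun y hy => (h y ⟨hy.le, hy.ne⟩).trans (hφ _)⟩

theorem exists_least {P : M.Num → Prop} [hP : Definable fun e => P e.headN] (h : ∃ x, P x) :
    ∃ x, P x ∧ ∀ y, y < x → ¬ P y := by
  by_contra! hn
  obtain ⟨x, hx⟩ := h
  have key : ∀ x, ∀ y, y < x → ¬ P y := sigma0_induction (P := fun x => ∀ y, y < x → ¬ P y)
    (fun y hy => absurd hy not_lt_zero)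
    (fun x ih y hy hPy => by
      obtain ⟨z, hz, hPz⟩ := hn y hPy
      exact ih z (hz.trans_le (Num.lt_add_one_iff.1 hy)) hPz)
  exact key (x + 1) x (Num.lt_add_one_iff.2 le_rfl) hx

end

section

variable {M : Model} [hM : M.IsV1]

/-! ## Pairing -/

theorem Num.even_mul_add_one (x : M.Num) : ∃ z, z ≤ x * (x + 1) ∧ (1 + 1) * z = x * (x + 1) :=
  sigma0_induction (P := fun x => ∃ z, z ≤ x * (x + 1) ∧ (1 + 1) * z = x * (x + 1))
    ⟨0, by simp, by simp⟩
    (fun x ⟨z, hz, h⟩ => ⟨z + (x + 1), by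
      calc z + (x + 1) ≤ x * (x + 1) + (x + 1) := by gcongr
        _ = (x + 1) * (x + 1) := by ring
        _ ≤ (x + 1) * (x + 1 + 1) := by gcongr; exact le_self_add, by
      calc (1 + 1) * (z + (x + 1)) = (1 + 1) * z + (1 + 1) * (x + 1) := by ring
        _ = (x + 1) * (x + 1 + 1) := by rw [h]; ring⟩) x

theorem Num.exists_pair (x y : M.Num) :
    ∃ z, (1 + 1) * z = (x + y) * (x + y + 1) + (1 + 1) * y := by
  obtain ⟨z, -, hz⟩ := Num.even_mul_add_one (x + y)
  exact ⟨z + y, by rw [mul_add, hz]⟩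

noncomputable def pair (x y : M.Num) : M.Num := Classical.choose (Num.exists_pair x y)

theorem two_mul_pair (x y : M.Num) :
    (1 + 1) * pair x y = (x + y) * (x + y + 1) + (1 + 1) * y :=
  Classical.choose_spec (Num.exists_pair x y)

theorem Num.two_pos : (0 : M.Num) < 1 + 1 := add_pos zero_lt_one zero_lt_one

theorem eq_pair_iff {x y z : M.Num} :
    z = pair x y ↔ (1 + 1) * z = (x + y) * (x + y + 1) + (1 + 1) * y := by
  rw [← two_mul_pair]
  exact ⟨fun h => by rw [h], fun h => mul_left_cancel₀ Num.two_pos.ne' h⟩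

theorem pair_lt (x y : M.Num) : pair x y < (x + y + 1) * (x + y + 1) := by
  refine lt_of_mul_lt_mul_left (a := (1 + 1 : M.Num)) ?_ (zero_le)
  rw [two_mul_pair]
  calc (x + y) * (x + y + 1) + (1 + 1) * y
      ≤ (x + y) * (x + y + 1) + (1 + 1) * y + (x * x + (1 + 1) * (x * y) + y * y
        + (1 + 1 + 1) * x + y) := le_self_add
    _ < (x + y) * (x + y + 1) + (1 + 1) * y + (x * x + (1 + 1) * (x * y) + y * y
        + (1 + 1 + 1) * x + y) + (1 + 1) := lt_add_of_pos_right _ Num.two_pos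
    _ = (1 + 1) * ((x + y + 1) * (x + y + 1)) := by ring

theorem pair_lt_of_lt {x y a b : M.Num} (hx : x < a) (hy : y < b) :
    pair x y < (a + b) * (a + b) := by
  refine (pair_lt x y).trans_le ?_
  have : x + y + 1 ≤ a + b := by
    rw [add_assoc]
    exact add_le_add hx.le (Num.lt_iff_add_one_le.1 hy)
  gcongr

theorem le_pair_left (x y : M.Num) : x ≤ pair x y := by
  refine le_of_mul_le_mul_left (a := (1 + 1 : M.Num)) ?_ Num.two_pos
  rw [two_mul_pair]
  rcases eq_or_ne x 0 with rfl | hx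
  · simp
  · obtain ⟨w, rfl⟩ := Num.exists_pred hx
    calc (1 + 1) * (w + 1) ≤ (1 + 1) * (w + 1) + (w * w + w + (1 + 1) * w * y + y * y +
          (1 + 1 + 1 + 1 + 1) * y) := le_self_add
      _ = _ := by ring

theorem le_pair_right (x y : M.Num) : y ≤ pair x y := by
  refine le_of_mul_le_mul_left (a := (1 + 1 : M.Num)) ?_ Num.two_pos
  rw [two_mul_pair]
  exact le_add_self

/-- With `s = x + y`, the doubled code lies between `s(s + 1)` and `s(s + 1) + 2s`, which is below
`(s + 1)(s + 2)`. So the code determines `s`, then `y`, then `x`. -/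
theorem pair_inj {x y x' y' : M.Num} (h : pair x y = pair x' y') : x = x' ∧ y = y' := by
  have key : ∀ x y x' y' : M.Num, pair x y = pair x' y' → ¬ x + y < x' + y' := by
    intro x y x' y' h hlt
    have h2 := congrArg ((1 + 1) * ·) h
    simp only [two_mul_pair] at h2
    refine absurd h2 (ne_of_lt ?_)
    have hs := Num.lt_iff_add_one_le.1 hlt
    calc (x + y) * (x + y + 1) + (1 + 1) * y
        ≤ (x + y) * (x + y + 1) + (1 + 1) * (x + y) := by gcongr; exact le_add_self
      _ < (x + y) * (x + y + 1) + (1 + 1) * (x + y) + (1 + 1) := lt_add_of_pos_right _ Num.two_pos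
      _ = (x + y + 1) * (x + y + 1 + 1) := by ring
      _ ≤ (x' + y') * (x' + y' + 1) := by gcongr
      _ ≤ _ := le_self_add
  have hs : x + y = x' + y' :=
    le_antisymm (not_lt.1 (key _ _ _ _ h.symm)) (not_lt.1 (key _ _ _ _ h))
  have h2 := congrArg ((1 + 1) * ·) h
  simp only [two_mul_pair, hs] at h2
  have hy : y = y' := mul_left_cancel₀ Num.two_pos.ne' (add_left_cancel h2)
  subst hy
  exact ⟨add_right_cancel hs, rfl⟩

@[simp] theorem pair_eq_pair {x y x' y' : M.Num} : pair x y = pair x' y' ↔ x = x' ∧ y = y' :=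
  ⟨pair_inj, fun h => by rw [h.1, h.2]⟩

instance {f g : Env M → M.Num} [hf : DefinableFn f] [hg : DefinableFn g] :
    DefinableFn (fun e => pair (f e) (g e)) := by
  refine ⟨?_, ?_⟩
  · have h : DefinableFn (fun e => (f e + g e + 1) * (f e + g e + 1)) := inferInstance
    obtain ⟨⟨t, ht⟩, _⟩ := h
    exact ⟨t, fun e => (pair_lt _ _).le.trans (ht e)⟩
  · have := hf.comp_tailN
    have := hg.comp_tailN
    exact Definable.congr inferInstance fun e => eq_pair_iff

/-! ## Coded functions -/

open Classical in
/-- The least `v` with `⟨p, v⟩ ∈ Z`, and `0` if there is none. -/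
noncomputable def app (Z : M.Str) (p : M.Num) : M.Num :=
  if h : ∃ v, pair p v ∈ Z ∧ ∀ u, u < v → pair p u ∉ Z then Classical.choose h else 0

theorem app_eq {Z : M.Str} {p v : M.Num} (h : pair p v ∈ Z) (hv : ∀ u, u < v → pair p u ∉ Z) :
    app Z p = v := by
  have h' : ∃ v, pair p v ∈ Z ∧ ∀ u, u < v → pair p u ∉ Z := ⟨v, h, hv⟩
  rw [app, dif_pos h']
  have hc := Classical.choose_spec h'
  exact le_antisymm (not_lt.1 fun hlt => hc.2 _ hlt h) (not_lt.1 fun hlt => hv _ hlt hc.1)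

theorem pair_app_mem {Z : M.Str} {p v : M.Num} (h : pair p v ∈ Z) :
    pair p (app Z p) ∈ Z ∧ ∀ u, u < app Z p → pair p u ∉ Z := by
  obtain ⟨w, hw, hw'⟩ := exists_least (P := fun v => pair p v ∈ Z) ⟨v, h⟩
  rw [app_eq hw hw']
  exact ⟨hw, hw'⟩

theorem app_of_not {Z : M.Str} {p : M.Num} (h : ∀ v, pair p v ∉ Z) : app Z p = 0 := by
  rw [app, dif_neg]
  rintro ⟨v, hv, -⟩
  exact h v hv

/-- A bounded description of the graph of `app`, which makes `app` definable. The second disjunct is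
the default value; searching below the length of `Z` is enough because a pair code is at least its
second component. -/
theorem eq_app_iff {Z : M.Str} {p y : M.Num} : y = app Z p ↔
    (pair p y ∈ Z ∧ ∀ u, u < y → pair p u ∉ Z) ∨ (y = 0 ∧ ∀ u, u < M.len Z → pair p u ∉ Z) := by
  constructor
  · rintro rfl
    by_cases h : ∃ v, pair p v ∈ Z
    · exact .inl (pair_app_mem h.choose_spec)
    · exact .inr ⟨app_of_not fun v hv => h ⟨v, hv⟩, fun u _ hu => h ⟨u, hu⟩⟩
  · rintro (⟨h, h'⟩ | ⟨rfl, h⟩)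
    · exact (app_eq h h').symm
    · exact (app_of_not fun v hv => h v ((le_pair_right p v).trans_lt (lt_len hv)) hv).symm

theorem app_le_len (Z : M.Str) (p : M.Num) : app Z p ≤ M.len Z := by
  by_cases h : ∃ v, pair p v ∈ Z
  · exact (le_pair_right p _).trans (lt_len (pair_app_mem h.choose_spec).1).le
  · rw [app_of_not fun v hv => h ⟨v, hv⟩]; exact zero_le

instance {Z : Env M → M.Str} {f : Env M → M.Num} [hZ : IsSet Z] [hf : DefinableFn f] :
    DefinableFn (fun e => app (Z e) (f e)) := by
  refine ⟨?_, ?_⟩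
  · obtain ⟨t, ht⟩ := hZ
    exact ⟨.len t, fun e => by simp only [PTerm.eval, ht]; exact app_le_len _ _⟩
  · have := hf.comp_tailN
    have := hf.comp_tailN.comp_tailN
    have := hZ.comp_tailN
    have := hZ.comp_tailN.comp_tailN
    exact Definable.congr inferInstance fun e => eq_app_iff

/-- Comprehension collects all admissible pairs, and `app` selects the least value. The explicit
length bound is what later Σ₁-inductions over coded functions need. -/
theorem exists_choice {P : M.Num → M.Num → Prop}
    [hP : Definable fun e => P e.tailN.headN e.headN] (N K : M.Num)
    (h : ∀ p, p < N → ∃ v, v < K ∧ P p v) :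
    ∃ Z, M.len Z ≤ (N + K) * (N + K) ∧ ∀ p, p < N → app Z p < K ∧ P p (app Z p) := by
  have := hP.app₂
  obtain ⟨Z, hZ, hZ'⟩ := comprehension
    (fun z => ∃ p, p < N ∧ ∃ v, v < K ∧ z = pair p v ∧ P p v) ((N + K) * (N + K))
  refine ⟨Z, hZ, fun p hp => ?_⟩
  have key : ∀ v, pair p v ∈ Z → v < K ∧ P p v := by
    intro v hv
    obtain ⟨p', _, v', hv', he, h⟩ := (hZ' _ ((lt_len hv).trans_le hZ)).1 hv
    obtain ⟨rfl, rfl⟩ := pair_inj he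
    exact ⟨hv', h⟩
  obtain ⟨v, hv, hPv⟩ := h p hp
  exact key _ (pair_app_mem ((hZ' (pair p v) (pair_lt_of_lt hp hv)).2
    ⟨p, hp, v, hv, rfl, hPv⟩)).1

theorem exists_seq (h : M.Num → M.Num) [hh : DefinableFn fun e => h e.headN] (N K : M.Num)
    (hK : ∀ p, p < N → h p < K) :
    ∃ Z, M.len Z ≤ (N + K) * (N + K) ∧ ∀ p, p < N → app Z p = h p := by
  have := hh.graph.rename (fun | 0 => 0 | i + 1 => i + 1) id
  obtain ⟨Z, hZ, hZ'⟩ := exists_choice (P := fun p v => v = h p) (hP := this) N K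
    fun p hp => ⟨_, hK p hp, rfl⟩
  exact ⟨Z, hZ, fun p hp => (hZ' p hp).2⟩

/-- Recursive choice along the numbers below `N`. -/
theorem exists_recursive_choice {R : M.Str → M.Num → M.Num → Prop}
    [hR : Definable fun e => R e.headS e.tailN.headN e.headN] (N K : M.Num)
    (hdep : ∀ Z Z' p v, (∀ q, q < p → app Z q = app Z' q) → R Z p v → R Z' p v)
    (hex : ∀ Z p, p < N → (∀ q, q < p → app Z q < K ∧ R Z q (app Z q)) → ∃ v, v < K ∧ R Z p v) :
    ∃ Z, M.len Z ≤ (N + K) * (N + K) ∧ ∀ p, p < N → app Z p < K ∧ R Z p (app Z p) := by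
  have hR' : ∀ f : Env M → M.Num, DefinableFn f → Definable (fun e => R e.headS e.headN (f e)) :=
    fun f hf => .subst hf (P := fun e x => R e.headS e.headN x) hR
  have : Definable (fun e => R e.tailN.headS e.headN (app e.tailN.headS e.headN)) :=
    hR' (fun e => app e.headS e.headN) inferInstance
  -- Induction on the number of values already chosen. The length bound is the same at every stage,
  -- and `hdep` lets the chosen values survive the passage to a new code.
  obtain ⟨Z, hZ, h⟩ := sigma1_induction
    (P := fun x Z => ∀ p, p < x → p < N → app Z p < K ∧ R Z p (app Z p)) ((N + K) * (N + K))
    ((comprehension (fun _ => False) _).imp fun Z hZ => ⟨hZ.1, fun p hp => absurd hp not_lt_zero⟩)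
    (fun x ⟨Z, hZ, h⟩ => by
      rcases lt_or_ge x N with hx | hx
      swap
      · exact ⟨Z, hZ, fun p hp hpN => h p (hpN.trans_le hx) hpN⟩
      obtain ⟨v, hv, hRv⟩ := hex Z x hx fun q hq => h q hq (hq.trans hx)
      obtain ⟨Z', hZ', h'⟩ := exists_seq (fun p => if p < x then app Z p else v) N K
        (fun p hp => by
          split_ifs with hpx
          · exact (h p hpx hp).1
          · exact hv)
      have hagree : ∀ q, q < x → app Z q = app Z' q := fun q hq => by
        rw [h' q (hq.trans hx), if_pos hq]
      refine ⟨Z', hZ', fun p hp hpN => ?_⟩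
      rcases (Num.lt_add_one_iff.1 hp).lt_or_eq with hpx | rfl
      · rw [← hagree p hpx]
        exact ⟨(h p hpx hpN).1, hdep _ _ _ _ (fun q hq => hagree q (hq.trans hpx)) (h p hpx hpN).2⟩
      · rw [h' p hpN, if_neg (lt_irrefl _)]
        exact ⟨hv, hdep _ _ _ _ hagree hRv⟩) N
  exact ⟨Z, hZ, fun p hp => h p hp hp⟩

/-! ## The pigeonhole principle -/

/-- From an injection of `{0, …, y + 1}` into the numbers below `y + 1` one gets an injection of
`{0, …, y}` into the numbers below `y`, by sending the argument with value `y` to the value of `y +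
1`. The induction variable `x` counts these reductions, with `x + y = N`; at `y = 0` there is no
possible value. -/
theorem pigeonhole {N : M.Num} {Z : M.Str} (hZ : ∀ p, p ≤ N → app Z p < N)
    (hinj : ∀ p, p ≤ N → ∀ q, q ≤ N → app Z p = app Z q → p = q) : False := by
  have key : ∀ x, ∃ Z, M.len Z ≤ (N + 1 + N) * (N + 1 + N) ∧ ∀ y, y ≤ N → x + y = N →
      (∀ p, p ≤ y → app Z p < y) ∧ ∀ p, p ≤ y → ∀ q, q ≤ y → app Z p = app Z q → p = q :=
    sigma1_induction (P := fun x Z => ∀ y, y ≤ N → x + y = N →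
      (∀ p, p ≤ y → app Z p < y) ∧ ∀ p, p ≤ y → ∀ q, q ≤ y → app Z p = app Z q → p = q) _
      (by
        obtain ⟨Z', hZ', h'⟩ := exists_seq (fun p => app Z p) (N + 1) N
          fun p hp => hZ p (Num.lt_add_one_iff.1 hp)
        refine ⟨Z', hZ', fun y _ hy => ?_⟩
        rw [zero_add] at hy
        subst hy
        have h'' : ∀ p, p ≤ y → app Z' p = app Z p := fun p hp => h' p (Num.lt_add_one_iff.2 hp)
        exact ⟨fun p hp => by rw [h'' p hp]; exact hZ p hp,
          fun p hp q hq => by rw [h'' p hp, h'' q hq]; exact hinj p hp q hq⟩)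
      (fun x ⟨Z, hZ, h⟩ => by
        by_cases hx : ∃ y, x + 1 + y = N
        swap
        · exact ⟨Z, hZ, fun y _ hy => absurd ⟨y, hy⟩ hx⟩
        obtain ⟨y, rfl⟩ := hx
        have hyN : y ≤ x + 1 + y := le_add_self
        obtain ⟨h₁, h₂⟩ := h (y + 1) (by rw [add_assoc, add_comm y]; exact le_add_self) (by ring)
        have hlt : ∀ p, p ≤ y → (if app Z p = y then app Z (y + 1) else app Z p) < y := by
          intro p hp
          have hpy : p < y + 1 := Num.lt_add_one_iff.2 hp
          split_ifs with hpe
          · refine lt_of_le_of_ne (Num.lt_add_one_iff.1 (h₁ _ le_rfl)) fun he => ?_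
            exact hpy.ne (h₂ p hpy.le _ le_rfl (hpe.trans he.symm))
          · exact lt_of_le_of_ne (Num.lt_add_one_iff.1 (h₁ _ hpy.le)) hpe
        obtain ⟨Z', hZ', h'⟩ := exists_seq
          (fun p => if p ≤ y then (if app Z p = y then app Z (y + 1) else app Z p) else 0)
          (x + 1 + y + 1) (x + 1 + y) (fun p hp => by
            by_cases hpy : p ≤ y
            · rw [if_pos hpy]; exact (hlt p hpy).trans_le hyN
            · rw [if_neg hpy, add_right_comm]
              exact add_pos_of_nonneg_of_pos zero_le zero_lt_one)
        refine ⟨Z', hZ', fun y' _ hy' => ?_⟩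
        obtain rfl : y' = y := add_left_cancel hy'
        have h'' : ∀ p, p ≤ y' → app Z' p = if app Z p = y' then app Z (y' + 1) else app Z p :=
          fun p hp => by rw [h' p (Num.lt_add_one_iff.2 (hp.trans hyN)), if_pos hp]
        refine ⟨fun p hp => by rw [h'' p hp]; exact hlt p hp, fun p hp q hq hpq => ?_⟩
        have hp1 : p < y' + 1 := Num.lt_add_one_iff.2 hp
        have hq1 : q < y' + 1 := Num.lt_add_one_iff.2 hq
        rw [h'' p hp, h'' q hq] at hpq
        split_ifs at hpq with c1 c2 c2
        · exact h₂ p hp1.le q hq1.le (c1.trans c2.symm)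
        · exact absurd (h₂ _ le_rfl q hq1.le hpq) hq1.ne'
        · exact absurd (h₂ p hp1.le _ le_rfl hpq) hp1.ne
        · exact h₂ p hp1.le q hq1.le hpq)
  obtain ⟨Z, -, h⟩ := key N
  exact absurd ((h 0 zero_le (add_zero N)).1 0 le_rfl) not_lt_zero

/-! ## Graph search -/

/-- The vertices reachable from `v₀` in a definable graph can be listed as the values at `0, …, s`
of an injective coded function, each but the first being adjacent to an earlier one. -/
theorem exists_search {Adj : M.Num → M.Num → Prop}
    [hAdj : Definable fun e => Adj e.tailN.headN e.headN] {N v₀ : M.Num} (hv₀ : v₀ < N) :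
    ∃ (f : M.Str) (s : M.Num), s < N ∧ app f 0 = v₀ ∧ (∀ p, p ≤ s → app f p < N) ∧
      (∀ p, p < s → ∃ q, q ≤ p ∧ Adj (app f q) (app f (p + 1))) ∧
      ∀ q, q ≤ s → ∀ y, y < N → Adj (app f q) y → ∃ p, p ≤ s ∧ app f p = y := by
  have hA := hAdj.app₂
  -- If no list is closed under adjacency, every list of the required form with `s < N` can be
  -- extended by a new vertex. Σ₁-induction then produces an injective list of `N + 1` numbers below
  -- `N`.
  by_contra! hcon
  have key : ∀ s, ∃ f, M.len f ≤ (N + 1 + N) * (N + 1 + N) ∧ (s ≤ N → app f 0 = v₀ ∧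
      (∀ p, p ≤ s → app f p < N) ∧
      (∀ p, p ≤ s → ∀ q, q ≤ s → app f p = app f q → p = q) ∧
      (∀ p, p < s → ∃ q, q ≤ p ∧ Adj (app f q) (app f (p + 1)))) :=
    sigma1_induction (P := fun s f => s ≤ N → app f 0 = v₀ ∧ (∀ p, p ≤ s → app f p < N) ∧
      (∀ p, p ≤ s → ∀ q, q ≤ s → app f p = app f q → p = q) ∧
      (∀ p, p < s → ∃ q, q ≤ p ∧ Adj (app f q) (app f (p + 1)))) _
      (by
        obtain ⟨f, hf, h⟩ := exists_seq (fun _ => v₀) (N + 1) N fun _ _ => hv₀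
        have h0 : app f 0 = v₀ := h 0 (Num.lt_add_one_iff.2 zero_le)
        refine ⟨f, hf, fun _ => ⟨h0, fun p hp => ?_, fun p hp q hq _ => ?_,
          fun p hp => absurd hp not_lt_zero⟩⟩
        · rw [nonpos_iff_eq_zero.1 hp, h0]; exact hv₀
        · rw [nonpos_iff_eq_zero.1 hp, nonpos_iff_eq_zero.1 hq])
      (fun s ⟨f, hf, h⟩ => by
        rcases lt_or_ge s N with hs | hs
        swap
        · exact ⟨f, hf, fun h => absurd (Num.lt_iff_add_one_le.2 h) (not_lt.2 hs)⟩
        obtain ⟨h0, hlt, hinj, hadj⟩ := h hs.le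
        obtain ⟨q, hq, y, hy, hqy, hnew⟩ := hcon f s hs h0 hlt hadj
        obtain ⟨f', hf', h'⟩ := exists_seq (fun p => if p ≤ s then app f p else y) (N + 1) N
          (fun p _ => by
            split_ifs with hp
            · exact hlt p hp
            · exact hy)
        have hold : ∀ p, p ≤ s → app f' p = app f p := fun p hp => by
          rw [h' p (Num.lt_add_one_iff.2 (hp.trans hs.le)), if_pos hp]
        have hss : s < s + 1 := Num.lt_add_one_iff.2 le_rfl
        have hlast : app f' (s + 1) = y := by
          rw [h' _ (Num.lt_add_one_iff.2 (Num.lt_iff_add_one_le.1 hs)), if_neg (not_le.2 hss)]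
        refine ⟨f', hf', fun _ => ⟨by rw [hold 0 zero_le, h0], fun p hp => ?_,
          fun p hp p' hp' he => ?_, fun p hp => ?_⟩⟩
        · rcases hp.lt_or_eq with hp | rfl
          · rw [hold p (Num.lt_add_one_iff.1 hp)]; exact hlt p (Num.lt_add_one_iff.1 hp)
          · rw [hlast]; exact hy
        · rcases hp.lt_or_eq with hp | rfl <;> rcases hp'.lt_or_eq with hp' | rfl
          · rw [Num.lt_add_one_iff] at hp hp'
            rw [hold p hp, hold p' hp'] at he
            exact hinj p hp p' hp' he
          · rw [Num.lt_add_one_iff] at hp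
            rw [hold p hp, hlast] at he
            exact absurd he (hnew p hp)
          · rw [Num.lt_add_one_iff] at hp'
            rw [hold p' hp', hlast] at he
            exact absurd he.symm (hnew p' hp')
          · rfl
        · rcases (Num.lt_add_one_iff.1 hp).lt_or_eq with hp | rfl
          · obtain ⟨r, hr, hrp⟩ := hadj p hp
            exact ⟨r, hr, by rwa [hold r (hr.trans hp.le), hold _ (Num.lt_iff_add_one_le.1 hp)]⟩
          · exact ⟨q, hq, by rwa [hold q hq, hlast]⟩)
  obtain ⟨f, -, h⟩ := key N
  obtain ⟨-, hlt, hinj, -⟩ := h le_rfl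
  exact pigeonhole hlt hinj

end

section

variable {M : Model}

/-! ## Truth values of formulas built with `Fm` -/

/-- An assignment, with the names from which on the variables are unused. -/
structure Cx (M : Model) where
  v : ℕ → M.Num
  w : ℕ → M.Str
  n : ℕ
  s : ℕ

def Cx.pushN (c : Cx M) (a : M.Num) : Cx M := ⟨Function.update c.v c.n a, c.w, c.n + 1, c.s⟩
def Cx.pushS (c : Cx M) (A : M.Str) : Cx M := ⟨c.v, Function.update c.w c.s A, c.n, c.s + 1⟩

/-- The term `t` contains only variables in use and has the value `a`. -/
class TVal (c : Cx M) (t : NumTerm) (a : M.Num) : Prop where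
  out : ∀ v w, (∀ x, x < c.n → v x = c.v x) → (∀ x, x < c.s → w x = c.w x) → t.eval M v w = a

/-- The set variable `X` is in use and has the value `A`. -/
class SVal (c : Cx M) (X : SetVar) (A : M.Str) : Prop where
  lt : X.idx < c.s
  out : c.w X.idx = A

/-- The formula `φ` is true if and only if `P`. -/
class FVal (c : Cx M) (φ : Fm) (P : Prop) : Prop where
  out : (φ c.n c.s).Realize M c.v c.w ↔ P

theorem TVal.eval {c : Cx M} {t : NumTerm} {a : M.Num} (h : TVal c t a) : t.eval M c.v c.w = a :=
  h.out _ _ (fun _ _ => rfl) (fun _ _ => rfl)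

theorem FVal.congr {c : Cx M} {φ : Fm} {P Q : Prop} (h : FVal c φ P) (hPQ : P ↔ Q) : FVal c φ Q :=
  ⟨h.out.trans hPQ⟩

instance (priority := high) (c : Cx M) (a : M.Num) : TVal (c.pushN a) (.var c.n) a :=
  ⟨fun v w hv _ => by
    rw [NumTerm.eval, hv c.n (Nat.lt_succ_self _)]; simp [Cx.pushN]⟩

instance (c : Cx M) (a b : M.Num) (t : NumTerm) [h : TVal c t a] : TVal (c.pushN b) t a :=
  ⟨fun v w hv hw => h.out v w (fun x hx => by
    rw [hv x (Nat.lt_succ_of_lt hx)]; simp [Cx.pushN, hx.ne]) hw⟩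

instance (c : Cx M) (a : M.Num) (B : M.Str) (t : NumTerm) [h : TVal c t a] :
    TVal (c.pushS B) t a :=
  ⟨fun v w hv hw => h.out v w hv (fun x hx => by
    rw [hw x (Nat.lt_succ_of_lt hx)]; simp [Cx.pushS, hx.ne])⟩

instance (priority := high) (c : Cx M) (A : M.Str) : SVal (c.pushS A) ⟨c.s⟩ A :=
  ⟨Nat.lt_succ_self _, by simp [Cx.pushS]⟩

instance (c : Cx M) (A : M.Str) (b : M.Num) (X : SetVar) [h : SVal c X A] :
    SVal (c.pushN b) X A := ⟨h.lt, h.out⟩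

instance (c : Cx M) (A B : M.Str) (X : SetVar) [h : SVal c X A] : SVal (c.pushS B) X A :=
  ⟨Nat.lt_succ_of_lt h.lt, by
    have := h.lt.ne
    simpa [Cx.pushS, this] using h.out⟩

variable [hM : M.IsV1] {c : Cx M}

instance : TVal c 0 0 := ⟨fun _ _ _ _ => rfl⟩

instance : TVal c 1 1 := ⟨fun _ _ _ _ => rfl⟩

instance {s t : NumTerm} {a b : M.Num} [hs : TVal c s a] [ht : TVal c t b] :
    TVal c (s + t) (a + b) :=
  ⟨fun v w hv hw => by
    change M.add (s.eval M v w) (t.eval M v w) = _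
    rw [hs.out v w hv hw, ht.out v w hv hw]; rfl⟩

instance {s t : NumTerm} {a b : M.Num} [hs : TVal c s a] [ht : TVal c t b] :
    TVal c (s * t) (a * b) :=
  ⟨fun v w hv hw => by
    change M.mul (s.eval M v w) (t.eval M v w) = _
    rw [hs.out v w hv hw, ht.out v w hv hw]; rfl⟩

instance {X : SetVar} {A : M.Str} [h : SVal c X A] : TVal c (.len X) (M.len A) :=
  ⟨fun v w hv hw => by rw [NumTerm.eval, hw _ h.lt, h.out]⟩

instance (k : ℕ) : TVal c (num k) (k : M.Num) := by
  induction k with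
  | zero => rw [Nat.cast_zero]; exact inferInstanceAs (TVal c 0 0)
  | succ k ih => rw [Nat.cast_succ]; exact inferInstanceAs (TVal c (num k + 1) _)

-- Truth values of the connectives, the quantifiers and the pairing

namespace FVal

instance eq {s t : NumTerm} {a b : M.Num} [hs : TVal c s a] [ht : TVal c t b] :
    FVal c (Fm.eq s t) (a = b) := ⟨by rw [Fm.eq, Formula.Realize, hs.eval, ht.eval]⟩

instance le {s t : NumTerm} {a b : M.Num} [hs : TVal c s a] [ht : TVal c t b] :
    FVal c (Fm.le s t) (a ≤ b) := ⟨by rw [Fm.le, Formula.Realize, hs.eval, ht.eval]; rfl⟩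

instance lt {s t : NumTerm} {a b : M.Num} [hs : TVal c s a] [ht : TVal c t b] :
    FVal c (Fm.lt s t) (a < b) :=
  ⟨by
    rw [lt_iff_le_and_ne]
    simp only [Fm.lt, Formula.lt, Formula.Realize, hs.eval, ht.eval]; rfl⟩

instance mem {t : NumTerm} {a : M.Num} {X : SetVar} {A : M.Str} [ht : TVal c t a]
    [hX : SVal c X A] : FVal c (Fm.mem t X) (a ∈ A) :=
  ⟨by rw [Fm.mem, Formula.Realize, ht.eval, hX.out]; rfl⟩

instance not {φ : Fm} {P : Prop} [h : FVal c φ P] : FVal c (Fm.not φ) (¬ P) :=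
  ⟨not_congr h.out⟩

instance and {φ ψ : Fm} {P Q : Prop} [h : FVal c φ P] [h' : FVal c ψ Q] :
    FVal c (φ ⋏ ψ) (P ∧ Q) := ⟨and_congr h.out h'.out⟩

instance or {φ ψ : Fm} {P Q : Prop} [h : FVal c φ P] [h' : FVal c ψ Q] :
    FVal c (φ ⋎ ψ) (P ∨ Q) := ⟨or_congr h.out h'.out⟩

instance imp {φ ψ : Fm} {P Q : Prop} [h : FVal c φ P] [h' : FVal c ψ Q] :
    FVal c (φ ⟹ ψ) (P → Q) := ⟨by rw [Fm.imp, Formula.realize_imp, h.out, h'.out]⟩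

instance iff {φ ψ : Fm} {P Q : Prop} [h : FVal c φ P] [h' : FVal c ψ Q] :
    FVal c (φ ⟺ ψ) (P ↔ Q) := ⟨by rw [Fm.iff, Formula.realize_iff, h.out, h'.out]⟩

instance top : FVal c Fm.top True := ⟨⟨fun _ => trivial, fun _ => rfl⟩⟩

instance bot : FVal c Fm.bot False := ⟨⟨fun h => h rfl, False.elim⟩⟩

instance allN {f : NumTerm → Fm} {P : M.Num → Prop}
    [h : ∀ a, FVal (c.pushN a) (f (.var c.n)) (P a)] : FVal c (Fm.allN f) (∀ a, P a) :=
  ⟨forall_congr' fun a => (h a).out⟩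

instance exN {f : NumTerm → Fm} {P : M.Num → Prop}
    [h : ∀ a, FVal (c.pushN a) (f (.var c.n)) (P a)] : FVal c (Fm.exN f) (∃ a, P a) :=
  ⟨exists_congr fun a => (h a).out⟩

instance allS {f : SetVar → Fm} {P : M.Str → Prop}
    [h : ∀ A, FVal (c.pushS A) (f ⟨c.s⟩) (P A)] : FVal c (Fm.allS f) (∀ A, P A) :=
  ⟨forall_congr' fun A => (h A).out⟩

instance exS {f : SetVar → Fm} {P : M.Str → Prop}
    [h : ∀ A, FVal (c.pushS A) (f ⟨c.s⟩) (P A)] : FVal c (Fm.exS f) (∃ A, P A) :=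
  ⟨exists_congr fun A => (h A).out⟩

instance allLe {t : NumTerm} {b : M.Num} {f : NumTerm → Fm} {P : M.Num → Prop} [TVal c t b]
    [h : ∀ a, FVal (c.pushN a) (f (.var c.n)) (P a)] :
    FVal c (Fm.allLe t f) (∀ a, a ≤ b → P a) := by
  unfold Fm.allLe; infer_instance

instance exLe {t : NumTerm} {b : M.Num} {f : NumTerm → Fm} {P : M.Num → Prop} [TVal c t b]
    [h : ∀ a, FVal (c.pushN a) (f (.var c.n)) (P a)] :
    FVal c (Fm.exLe t f) (∃ a, a ≤ b ∧ P a) := by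
  unfold Fm.exLe; infer_instance

instance allLt {t : NumTerm} {b : M.Num} {f : NumTerm → Fm} {P : M.Num → Prop} [TVal c t b]
    [h : ∀ a, FVal (c.pushN a) (f (.var c.n)) (P a)] :
    FVal c (Fm.allLt t f) (∀ a, a < b → P a) := by
  refine congr (P := ∀ a, a ≤ b → (¬ a = b) → P a) ?_ ?_
  · unfold Fm.allLt; infer_instance
  · exact forall_congr' fun a => by rw [lt_iff_le_and_ne, and_imp]

instance exLt {t : NumTerm} {b : M.Num} {f : NumTerm → Fm} {P : M.Num → Prop} [TVal c t b]
    [h : ∀ a, FVal (c.pushN a) (f (.var c.n)) (P a)] :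
    FVal c (Fm.exLt t f) (∃ a, a < b ∧ P a) := by
  refine congr (P := ∃ a, a ≤ b ∧ (¬ a = b) ∧ P a) ?_ ?_
  · unfold Fm.exLt; infer_instance
  · exact exists_congr fun a => by rw [lt_iff_le_and_ne, and_assoc]

instance allSLe {t : NumTerm} {b : M.Num} {f : SetVar → Fm} {P : M.Str → Prop} [TVal c t b]
    [h : ∀ A, FVal (c.pushS A) (f ⟨c.s⟩) (P A)] :
    FVal c (Fm.allSLe t f) (∀ A, M.len A ≤ b → P A) := by
  unfold Fm.allSLe; infer_instance

instance exSLe {t : NumTerm} {b : M.Num} {f : SetVar → Fm} {P : M.Str → Prop} [TVal c t b]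
    [h : ∀ A, FVal (c.pushS A) (f ⟨c.s⟩) (P A)] :
    FVal c (Fm.exSLe t f) (∃ A, M.len A ≤ b ∧ P A) := by
  unfold Fm.exSLe; infer_instance

instance bigAnd {ι : Type} {L : List ι} {f : ι → Fm} {P : ι → Prop} [h : ∀ i, FVal c (f i) (P i)] :
    FVal c (Fm.bigAnd L f) (∀ i ∈ L, P i) := by
  induction L with
  | nil => exact congr top (by simp)
  | cons i L ih => exact congr (@and _ c _ _ _ _ (h i) ih) (by simp)

instance bigOr {ι : Type} {L : List ι} {f : ι → Fm} {P : ι → Prop} [h : ∀ i, FVal c (f i) (P i)] :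
    FVal c (Fm.bigOr L f) (∃ i ∈ L, P i) := by
  induction L with
  | nil => exact congr bot (by simp)
  | cons i L ih => exact congr (@or _ c _ _ _ _ (h i) ih) (by simp)

instance const (p : Prop) : FVal c (BA.const p) p := by
  unfold BA.const
  split_ifs with h
  · exact congr top (by simp [h])
  · exact congr bot (by simp [h])

instance isPair {z x y : NumTerm} {z' x' y' : M.Num} [TVal c z z'] [TVal c x x'] [TVal c y y'] :
    FVal c (isPair z x y) (z' = pair x' y') := by
  refine congr ?_ eq_pair_iff.symm
  unfold BA.isPair
  infer_instance

instance pairBd {x y : NumTerm} {x' y' : M.Num} [TVal c x x'] [TVal c y y'] :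
    TVal c (pairBd x y) ((x' + y' + 1) * (x' + y' + 1)) := by
  unfold BA.pairBd; infer_instance

instance fourSq {x : NumTerm} {x' : M.Num} [TVal c x x'] :
    TVal c (fourSq x) ((1 + 1 + 1 + 1) * (x' * x')) := by
  unfold BA.fourSq; infer_instance

theorem exists_le_pair {x y : M.Num} {P : M.Num → Prop} :
    (∃ z, z ≤ (x + y + 1) * (x + y + 1) ∧ z = pair x y ∧ P z) ↔ P (pair x y) :=
  ⟨fun ⟨_, _, h, hP⟩ => h ▸ hP, fun h => ⟨_, (pair_lt x y).le, rfl, h⟩⟩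

theorem exPair {x y : NumTerm} {x' y' : M.Num} {f : NumTerm → Fm} {P : M.Num → Prop}
    [TVal c x x'] [TVal c y y'] [h : ∀ a, FVal (c.pushN a) (f (.var c.n)) (P a)] :
    FVal c (Fm.exLe (BA.pairBd x y) fun z => BA.isPair z x y ⋏ f z) (P (pair x' y')) :=
  congr inferInstance exists_le_pair

instance mem2 {X : SetVar} {A : M.Str} {x y : NumTerm} {x' y' : M.Num} [SVal c X A]
    [TVal c x x'] [TVal c y y'] : FVal c (mem2 X x y) (pair x' y' ∈ A) := by
  unfold BA.mem2
  exact exPair (P := fun z => z ∈ A)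

instance mem4 {X : SetVar} {A : M.Str} {x y z u : NumTerm} {x' y' z' u' : M.Num} [SVal c X A]
    [TVal c x x'] [TVal c y y'] [TVal c z z'] [TVal c u u'] :
    FVal c (mem4 X x y z u) (pair (pair (pair x' y') z') u' ∈ A) := by
  unfold BA.mem4
  exact exPair (P := fun p => pair (pair p z') u' ∈ A)
    (h := fun p => exPair (P := fun q => pair q u' ∈ A))

instance memPairR {X : SetVar} {A : M.Str} {x y z : NumTerm} {x' y' z' : M.Num} [SVal c X A]
    [TVal c x x'] [TVal c y y'] [TVal c z z'] :
    FVal c (memPairR X x y z) (pair x' (pair y' z') ∈ A) := by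
  unfold BA.memPairR
  exact exPair (P := fun p => pair x' p ∈ A)

end FVal

end

section

set_option synthInstance.maxSize 2000
set_option synthInstance.maxHeartbeats 400000

variable {M : Model} [hM : M.IsV1]

/-! ## Semantics of the CSP notions -/

/-- `Eⁱʲ(a, b)`. -/
abbrev EdgeIn (EA : M.Str) (i a j b : M.Num) : Prop := pair (pair i a) (pair j b) ∈ EA

/-- Semantics of `isMap`. -/
def IsMapIn (n : M.Num) (A : M.Str) (k : M.Num) (B H : M.Str) : Prop :=
  (∀ i, i < n → i ∈ A → ∃ j, j < k ∧ j ∈ B ∧ pair i j ∈ H) ∧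
  ∀ i, i < n → i ∈ A → ∀ j₁, j₁ < k → ∀ j₂, j₂ < k →
    (j₁ ∈ B ∧ j₂ ∈ B ∧ pair i j₁ ∈ H ∧ pair i j₂ ∈ H) → j₁ = j₂

/-- Semantics of `isHom`. -/
def IsHomIn (t : M.Num) (VG EG : M.Str) (n : M.Num) (VX EX H : M.Str) : Prop :=
  IsMapIn t VG n VX H ∧
  ∀ i₁, i₁ < t → ∀ i₂, i₂ < t → ∀ j₁, j₁ < n → ∀ j₂, j₂ < n →
    (pair i₁ i₂ ∈ EG ∧ pair i₁ j₁ ∈ H ∧ pair i₂ j₂ ∈ H) → pair j₁ j₂ ∈ EX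

/-- A bound for the codes of pairs of numbers below `n` and `l`. -/
abbrev pairBound (n l : M.Num) : M.Num := (n + l + 1) * (n + l + 1)

/-- Semantics of `isHomT`. -/
def IsHomTIn (t : M.Num) (VG EG : M.Str) (n l : M.Num) (VA EA H : M.Str) : Prop :=
  IsMapIn t VG (pairBound n l) VA H ∧
  ∀ i₁, i₁ < t → ∀ i₂, i₂ < t → ∀ j₁, j₁ < pairBound n l → ∀ j₂, j₂ < pairBound n l →
    (pair i₁ i₂ ∈ EG ∧ pair i₁ j₁ ∈ H ∧ pair i₂ j₂ ∈ H) → pair j₁ j₂ ∈ EA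

/-- Semantics of `isSolution`. -/
def IsSolutionIn (t : M.Num) (VG EG : M.Str) (n l : M.Num) (VA EA H : M.Str) : Prop :=
  IsHomTIn t VG EG n l VA EA H ∧
  ∀ i, i < t → ∀ s, s < pairBound n l →
    pair i s ∈ H → ∃ a, a < l ∧ s = pair i a ∧ pair i a ∈ VA

/-- Semantics of `isLift`. -/
def IsLiftIn (t : M.Num) (VG EG : M.Str) (n l : M.Num) (VA EA H H' : M.Str) : Prop :=
  IsHomTIn t VG EG n l VA EA H' ∧
  ∀ p, p < t → ∀ k, k < n → pair p k ∈ H →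
    ∃ c, c < l ∧ pair k c ∈ VA ∧ pair p (pair k c) ∈ H'

/-- Semantics of `isInstance`. -/
def IsInstanceIn (t : M.Num) (VX EX : M.Str) (n l : M.Num) (VA EA : M.Str) : Prop :=
  M.len VX = t ∧ (∀ i, i < t → i ∈ VX) ∧
  (∀ z, z < M.len EX → z ∈ EX → ∃ i, i < t ∧ ∃ j, j < t ∧ z = pair i j) ∧
  (∀ z, z < M.len VA → z ∈ VA → ∃ i, i < n ∧ ∃ a, a < l ∧ z = pair i a) ∧
  ∀ u, u < M.len EA → ∀ v, v < M.len EA → pair u v ∈ EA →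
    ∃ i, i < n ∧ ∃ j, j < n ∧ ∃ a, a < l ∧ ∃ b, b < l ∧
      u = pair i a ∧ v = pair j b ∧ pair i a ∈ VA ∧ pair j b ∈ VA

/-- Semantics of `oneConsistent`. -/
def OneConsistentIn (EX : M.Str) (n l : M.Num) (VA EA : M.Str) : Prop :=
  ∀ i, i < n → ∀ a, a < l → pair i a ∈ VA → ∀ j, j < n →
    (pair i j ∈ EX → ∃ b, b < l ∧ pair j b ∈ VA ∧ EdgeIn EA i a j b) ∧
    (pair j i ∈ EX → ∃ b, b < l ∧ pair j b ∈ VA ∧ EdgeIn EA j b i a)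

/-- Semantics of `isCycle`. -/
def IsCycleIn (t : M.Num) (VC EC : M.Str) : Prop :=
  (∀ i, i < t → i ∈ VC) ∧
  (∃ s, s < t ∧ s + 1 = t ∧ (pair 0 s ∈ EC ∨ pair s 0 ∈ EC)) ∧
  (∀ i, i < t → i + 1 < t → (pair i (i + 1) ∈ EC ∨ pair (i + 1) i ∈ EC)) ∧
  ∀ i, i < t → ∀ j, j < t → pair i j ∈ EC →
    (j = i + 1 ∨ i = j + 1 ∨ (i = 0 ∧ j + 1 = t) ∨ (j = 0 ∧ i + 1 = t))

/-- Semantics of `cycleConsistent`. -/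
def CycleConsistentIn (r : M.Num) (VX EX : M.Str) (n l : M.Num) (VA EA : M.Str) : Prop :=
  OneConsistentIn EX n l VA EA ∧
  ∀ k, k < n → ∀ a, a < l → pair k a ∈ VA → ∀ t, t < n →
    ∀ VC, M.len VC ≤ t → ∀ EC, M.len EC ≤ (1 + 1 + 1 + 1) * (t * t) →
    ∀ H, M.len H ≤ pairBound t n →
      (IsCycleIn t VC EC ∧ IsHomIn t VC EC r VX EX H ∧ pair 0 k ∈ H) →
        ∃ H', M.len H' ≤ pairBound t (pairBound n l) ∧
          (IsLiftIn t VC EC n l VA EA H H' ∧ pair 0 (pair k a) ∈ H')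

/-- Semantics of `isPath`. -/
def IsPathIn (t : M.Num) (VP EP : M.Str) : Prop :=
  (∀ i, i ≤ t → i ∈ VP) ∧
  (∀ i, i < t → pair i (i + 1) ∈ EP ∨ pair (i + 1) i ∈ EP) ∧
  ∀ i, i ≤ t → ∀ j, j ≤ t → pair i j ∈ EP → (j = i + 1 ∨ i = j + 1)

/-- Semantics of `areLinked`. -/
def AreLinkedIn (a b i j r : M.Num) (VX EX : M.Str) (n l : M.Num) (VA EA : M.Str) : Prop :=
  ∃ t, t < n * l ∧ ∃ VP, M.len VP ≤ t + 1 ∧ ∃ EP, M.len EP ≤ (1 + 1 + 1 + 1) * (t * t) ∧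
    ∃ H, M.len H ≤ pairBound (t + 1) n ∧
      (IsPathIn t VP EP ∧ IsHomIn (t + 1) VP EP r VX EX H ∧ pair 0 i ∈ H ∧ pair t j ∈ H ∧
      ∃ H', M.len H' ≤ pairBound (t + 1) (pairBound n l) ∧
        (IsLiftIn (t + 1) VP EP n l VA EA H H' ∧
          pair 0 (pair i a) ∈ H' ∧ pair t (pair j b) ∈ H'))

/-- Semantics of `linked`. -/
def LinkedIn (r : M.Num) (VX EX : M.Str) (n l : M.Num) (VA EA : M.Str) : Prop :=
  ∀ i, i < r → i ∈ VX → ∀ a, a < l → ∀ b, b < l → (pair i a ∈ VA ∧ pair i b ∈ VA) →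
    AreLinkedIn a b i i r VX EX n l VA EA

/-- Semantics of `fragmented`. -/
def FragmentedIn (r : M.Num) (VX EX : M.Str) : Prop :=
  ∃ V₁, M.len V₁ ≤ r ∧ ∃ V₂, M.len V₂ ≤ r ∧
    ((∀ i, i < r → i ∈ V₁ → i ∈ VX) ∧ (∀ i, i < r → i ∈ V₂ → i ∈ VX) ∧
    (∃ i, i < r ∧ i ∈ V₁) ∧ (∃ i, i < r ∧ i ∈ V₂) ∧
    (∀ i, i < r → i ∈ VX → (i ∈ V₁ ↔ ¬ i ∈ V₂)) ∧
    ∀ i, i < r → ∀ j, j < r → (i ∈ V₁ ∧ j ∈ V₂) → (¬ pair i j ∈ EX ∧ ¬ pair j i ∈ EX))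

/-- Semantics of `subdirectSolutions`. -/
def SubdirectSolutionsIn (r : M.Num) (VX EX : M.Str) (n l : M.Num) (VA EA : M.Str) : Prop :=
  ∀ i, i < r → i ∈ VX → ∀ a, a < l → pair i a ∈ VA →
    ∃ H, M.len H ≤ pairBound n (pairBound n l) ∧
      (IsSolutionIn r VX EX n l VA EA H ∧ pair i (pair i a) ∈ H)

/-- Semantics of `isSubinstance`. -/
def IsSubinstanceIn (r : M.Num) (VY EY VX EX : M.Str) : Prop :=
  (∀ i, i < r → i ∈ VY → i ∈ VX) ∧
  ∀ i, i < r → ∀ j, j < r → pair i j ∈ EY → (pair i j ∈ EX ∧ i ∈ VY ∧ j ∈ VY)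

/-- Semantics of `irreducible`. -/
def IrreducibleIn (r : M.Num) (VX EX : M.Str) (n l : M.Num) (VA EA : M.Str) : Prop :=
  ∀ VY, M.len VY ≤ r → ∀ EY, M.len EY ≤ (1 + 1 + 1 + 1) * (r * r) →
    IsSubinstanceIn r VY EY VX EX →
      (FragmentedIn r VY EY ∨ LinkedIn r VY EY n l VA EA ∨
        SubdirectSolutionsIn r VY EY n l VA EA)

/-- The code of `⟨t, k, a, b⟩`. -/
noncomputable abbrev code (t k a b : M.Num) : M.Num := pair (pair (pair t k) a) b

/-- `e ∈ Dₖ` has along an edge `(j, k)` two neighbours `c, d ∈ Dⱼ` with `¬ I(t, j, c, d)`. -/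
def BlockedFwd (l : M.Num) (VA EA I : M.Str) (t j k : M.Num) : Prop :=
  ∃ c, c < l ∧ ∃ d, d < l ∧ ∃ e, e < l ∧ (pair j c ∈ VA ∧ pair j d ∈ VA ∧ pair k e ∈ VA ∧
    ¬ code t j c d ∈ I ∧ EdgeIn EA j c k e ∧ EdgeIn EA j d k e)

/-- `e ∈ Dₖ` has along an edge `(k, j)` two neighbours `c, d ∈ Dⱼ` with `¬ I(t, j, c, d)`. -/
def BlockedBwd (l : M.Num) (VA EA I : M.Str) (t j k : M.Num) : Prop :=
  ∃ c, c < l ∧ ∃ d, d < l ∧ ∃ e, e < l ∧ (pair j c ∈ VA ∧ pair j d ∈ VA ∧ pair k e ∈ VA ∧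
    ¬ code t j c d ∈ I ∧ EdgeIn EA k e j c ∧ EdgeIn EA k e j d)

/-- The right-hand side of the recursion for the propagation. -/
def PropagationStep (EX : M.Str) (n l : M.Num) (VA EA I : M.Str) (t k a b : M.Num) : Prop :=
  code t k a b ∈ I ∨ ∃ j, j < n ∧ ∃ a', a' < l ∧ ∃ b', b' < l ∧ (code t j a' b' ∈ I ∧
    ((pair j k ∈ EX ∧ EdgeIn EA j a' k a ∧ EdgeIn EA j b' k b ∧ ¬ BlockedFwd l VA EA I t j k) ∨
      (pair k j ∈ EX ∧ EdgeIn EA k a j a' ∧ EdgeIn EA k b j b' ∧ ¬ BlockedBwd l VA EA I t j k)))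

/-- `(a, b)` is the image of a pair of `σ`. -/
def RelIn {l : ℕ} (σ : Finset (Fin l × Fin l)) (a b : M.Num) : Prop :=
  ∃ p ∈ σ.toList, a = ((p.1 : ℕ) : M.Num) ∧ b = ((p.2 : ℕ) : M.Num)

/-- Semantics of `isPropagation`. -/
def IsPropagationIn {l₀ : ℕ} (EX : M.Str) (n l : M.Num) (VA EA : M.Str) (i : M.Num)
    (σ : Finset (Fin l₀ × Fin l₀)) (I : M.Str) : Prop :=
  (∀ k, k < n → ∀ a, a < l → ∀ b, b < l → (code 0 k a b ∈ I ↔ (k = i ∧ RelIn σ a b))) ∧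
  ∀ t, t < n → ∀ k, k < n → ∀ a, a < l → ∀ b, b < l →
    (code (t + 1) k a b ∈ I ↔ PropagationStep EX n l VA EA I t k a b)

/-- Semantics of `isReachedSubgraph`. -/
def IsReachedSubgraphIn (r : M.Num) (VY EY EX : M.Str) (n l : M.Num) (I : M.Str) : Prop :=
  (∀ j, j < r → (j ∈ VY ↔ ∃ a, a < l ∧ ∃ b, b < l ∧ code n j a b ∈ I)) ∧
  (∀ s, s < r → ∀ s', s' < r → pair s s' ∈ EY → (s ∈ VY ∧ s' ∈ VY)) ∧
  ∀ s, s < r → ∀ s', s' < r → (s ∈ VY ∧ s' ∈ VY) → (pair s s' ∈ EY ↔ pair s s' ∈ EX)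

/-- Semantics of `domIs`. -/
def DomIsIn {l : ℕ} (VA : M.Str) (i : M.Num) (D : Finset (Fin l)) : Prop :=
  ∀ a ∈ List.finRange l, (pair i ((a : ℕ) : M.Num) ∈ VA ↔ a ∈ D)

/-- Semantics of `edgeIs`. -/
def EdgeIsIn {l : ℕ} (EA : M.Str) (i j : M.Num) (R : Finset (Fin l × Fin l)) : Prop :=
  ∀ a ∈ List.finRange l, ∀ b ∈ List.finRange l,
    (EdgeIn EA i ((a : ℕ) : M.Num) j ((b : ℕ) : M.Num) ↔ (a, b) ∈ R)

/-- Semantics of `isInstanceOver`. -/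
def IsInstanceOverIn {l₀ m : ℕ} (Ω : (Fin m → Fin l₀) → Fin l₀) (t : M.Num) (VX EX : M.Str)
    (n l : M.Num) (VA EA : M.Str) : Prop :=
  IsInstanceIn t VX EX n l VA EA ∧
  (∀ i, i < n → ∃ D ∈ Gamma1 Ω, DomIsIn VA i D) ∧
  ∀ i, i < n → ∀ j, j < n → ∃ R ∈ Gamma2 Ω, EdgeIsIn EA i j R

/-- Semantics of `checkOK`. -/
def CheckOKIn {l₀ m : ℕ} (Ω : (Fin m → Fin l₀) → Fin l₀) (r : M.Num) (EX : M.Str)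
    (n l : M.Num) (VA EA : M.Str) : Prop :=
  ∀ i, i < r → ∀ D ∈ Gamma1 Ω, DomIsIn VA i D → ∀ σ ∈ maximalCongruences Ω D,
    ∀ I, M.len I ≤ pairBound (pairBound (pairBound n n) l) l →
      IsPropagationIn EX n l VA EA i σ I →
        ∀ VY, M.len VY ≤ r → ∀ EY, M.len EY ≤ (1 + 1 + 1 + 1) * (r * r) →
          IsReachedSubgraphIn r VY EY EX n l I → SubdirectSolutionsIn r VY EY n l VA EA

-- The CSP formulas have the intended truth values

namespace FVal

variable {c : Cx M} {VX EX VY EY VG EG VA EA H H' I : SetVar}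
  {VX' EX' VY' EY' VG' EG' VA' EA' h h' I' : M.Str} {t n l r i j a b : NumTerm}
  {t' n' l' r' i' j' a' b' : M.Num}

instance dom [TVal c i i'] [TVal c a a'] [SVal c VA VA'] :
    FVal c (Target.dom ⟨n, l, VA, EA⟩ i a) (pair i' a' ∈ VA') := by
  unfold Target.dom; dsimp only; infer_instance

instance edge [TVal c i i'] [TVal c a a'] [TVal c j j'] [TVal c b b'] [SVal c EA EA'] :
    FVal c (Target.edge ⟨n, l, VA, EA⟩ i a j b) (EdgeIn EA' i' a' j' b') := by
  unfold Target.edge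
  exact exPair (P := fun u => pair u (pair j' b') ∈ EA')

instance isMap [TVal c t t'] [SVal c VG VG'] [TVal c n n'] [SVal c VX VX'] [SVal c H h] :
    FVal c (isMap t VG n VX H) (IsMapIn t' VG' n' VX' h) := by
  unfold BA.isMap IsMapIn; infer_instance

instance isHom [TVal c t t'] [SVal c VG VG'] [SVal c EG EG'] [TVal c n n'] [SVal c VX VX']
    [SVal c EX EX'] [SVal c H h] :
    FVal c (isHom ⟨t, VG, EG⟩ ⟨n, VX, EX⟩ H) (IsHomIn t' VG' EG' n' VX' EX' h) := by
  unfold BA.isHom IsHomIn; dsimp only; infer_instance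

instance isHomT [TVal c t t'] [SVal c VG VG'] [SVal c EG EG'] [TVal c n n'] [TVal c l l']
    [SVal c VA VA'] [SVal c EA EA'] [SVal c H h] :
    FVal c (isHomT ⟨t, VG, EG⟩ ⟨n, l, VA, EA⟩ H) (IsHomTIn t' VG' EG' n' l' VA' EA' h) := by
  unfold BA.isHomT IsHomTIn; dsimp only; infer_instance

instance isSolution [TVal c t t'] [SVal c VG VG'] [SVal c EG EG'] [TVal c n n'] [TVal c l l']
    [SVal c VA VA'] [SVal c EA EA'] [SVal c H h] :
    FVal c (isSolution ⟨t, VG, EG⟩ ⟨n, l, VA, EA⟩ H)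
      (IsSolutionIn t' VG' EG' n' l' VA' EA' h) := by
  unfold BA.isSolution IsSolutionIn; dsimp only; infer_instance

instance isLift [TVal c t t'] [SVal c VG VG'] [SVal c EG EG'] [TVal c n n'] [TVal c l l']
    [SVal c VA VA'] [SVal c EA EA'] [SVal c H h] [SVal c H' h'] :
    FVal c (isLift ⟨t, VG, EG⟩ ⟨n, l, VA, EA⟩ H H')
      (IsLiftIn t' VG' EG' n' l' VA' EA' h h') := by
  unfold BA.isLift IsLiftIn; dsimp only; infer_instance

instance isInstance [TVal c t t'] [SVal c VX VX'] [SVal c EX EX'] [TVal c n n'] [TVal c l l']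
    [SVal c VA VA'] [SVal c EA EA'] :
    FVal c (isInstance ⟨t, VX, EX⟩ ⟨n, l, VA, EA⟩)
      (IsInstanceIn t' VX' EX' n' l' VA' EA') := by
  unfold BA.isInstance IsInstanceIn; dsimp only; infer_instance

instance oneConsistent [SVal c EX EX'] [TVal c n n'] [TVal c l l']
    [SVal c VA VA'] [SVal c EA EA'] :
    FVal c (oneConsistent ⟨t, VX, EX⟩ ⟨n, l, VA, EA⟩)
      (OneConsistentIn EX' n' l' VA' EA') := by
  unfold BA.oneConsistent OneConsistentIn; dsimp only; infer_instance

instance isCycle [TVal c t t'] [SVal c VG VG'] [SVal c EG EG'] :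
    FVal c (isCycle ⟨t, VG, EG⟩) (IsCycleIn t' VG' EG') := by
  unfold BA.isCycle IsCycleIn; dsimp only; infer_instance

instance cycleConsistent [TVal c r r'] [SVal c VX VX'] [SVal c EX EX'] [TVal c n n'] [TVal c l l']
    [SVal c VA VA'] [SVal c EA EA'] :
    FVal c (cycleConsistent ⟨r, VX, EX⟩ ⟨n, l, VA, EA⟩)
      (CycleConsistentIn r' VX' EX' n' l' VA' EA') := by
  unfold BA.cycleConsistent CycleConsistentIn; dsimp only; infer_instance

instance isPath [TVal c t t'] [SVal c VG VG'] [SVal c EG EG'] :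
    FVal c (isPath t ⟨r, VG, EG⟩) (IsPathIn t' VG' EG') := by
  unfold BA.isPath IsPathIn; infer_instance

instance areLinked [TVal c a a'] [TVal c b b'] [TVal c i i'] [TVal c j j'] [TVal c r r']
    [SVal c VX VX'] [SVal c EX EX'] [TVal c n n'] [TVal c l l'] [SVal c VA VA'] [SVal c EA EA'] :
    FVal c (areLinked a b i j ⟨r, VX, EX⟩ ⟨n, l, VA, EA⟩)
      (AreLinkedIn a' b' i' j' r' VX' EX' n' l' VA' EA') := by
  unfold BA.areLinked AreLinkedIn; dsimp only; infer_instance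

instance linked [TVal c r r'] [SVal c VX VX'] [SVal c EX EX'] [TVal c n n'] [TVal c l l']
    [SVal c VA VA'] [SVal c EA EA'] :
    FVal c (linked ⟨r, VX, EX⟩ ⟨n, l, VA, EA⟩) (LinkedIn r' VX' EX' n' l' VA' EA') := by
  unfold BA.linked LinkedIn; dsimp only; infer_instance

instance fragmented [TVal c r r'] [SVal c VX VX'] [SVal c EX EX'] :
    FVal c (fragmented ⟨r, VX, EX⟩) (FragmentedIn r' VX' EX') := by
  unfold BA.fragmented FragmentedIn; dsimp only; infer_instance

instance subdirectSolutions [TVal c r r'] [SVal c VX VX'] [SVal c EX EX'] [TVal c n n']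
    [TVal c l l'] [SVal c VA VA'] [SVal c EA EA'] :
    FVal c (subdirectSolutions ⟨r, VX, EX⟩ ⟨n, l, VA, EA⟩)
      (SubdirectSolutionsIn r' VX' EX' n' l' VA' EA') := by
  unfold BA.subdirectSolutions SubdirectSolutionsIn; dsimp only; infer_instance

instance isSubinstance [TVal c r r'] [SVal c VX VX'] [SVal c EX EX'] [SVal c VY VY']
    [SVal c EY EY'] :
    FVal c (isSubinstance ⟨t, VY, EY⟩ ⟨r, VX, EX⟩) (IsSubinstanceIn r' VY' EY' VX' EX') := by
  unfold BA.isSubinstance IsSubinstanceIn; dsimp only; infer_instance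

instance irreducible [TVal c r r'] [SVal c VX VX'] [SVal c EX EX'] [TVal c n n']
    [TVal c l l'] [SVal c VA VA'] [SVal c EA EA'] :
    FVal c (irreducible ⟨r, VX, EX⟩ ⟨n, l, VA, EA⟩)
      (IrreducibleIn r' VX' EX' n' l' VA' EA') := by
  unfold BA.irreducible IrreducibleIn; dsimp only; infer_instance

instance relHolds {l₀ : ℕ} {σ : Finset (Fin l₀ × Fin l₀)} [TVal c a a'] [TVal c b b'] :
    FVal c (relHolds σ.toList a b) (RelIn σ a' b') := by
  unfold BA.relHolds RelIn; infer_instance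

instance blockedFwd {k : NumTerm} {k' : M.Num} [TVal c t t'] [TVal c l l'] [SVal c VA VA']
    [SVal c EA EA'] [TVal c j j'] [TVal c k k'] [SVal c I I'] :
    FVal c (Fm.exLt l fun c => Fm.exLt l fun d => Fm.exLt l fun e =>
      Target.dom ⟨n, l, VA, EA⟩ j c ⋏ Target.dom ⟨n, l, VA, EA⟩ j d ⋏
      Target.dom ⟨n, l, VA, EA⟩ k e ⋏ Fm.not (BA.mem4 I t j c d) ⋏
      Target.edge ⟨n, l, VA, EA⟩ j c k e ⋏ Target.edge ⟨n, l, VA, EA⟩ j d k e)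
      (BlockedFwd l' VA' EA' I' t' j' k') := by
  unfold BlockedFwd; infer_instance

instance blockedBwd {k : NumTerm} {k' : M.Num} [TVal c t t'] [TVal c l l'] [SVal c VA VA']
    [SVal c EA EA'] [TVal c j j'] [TVal c k k'] [SVal c I I'] :
    FVal c (Fm.exLt l fun c => Fm.exLt l fun d => Fm.exLt l fun e =>
      Target.dom ⟨n, l, VA, EA⟩ j c ⋏ Target.dom ⟨n, l, VA, EA⟩ j d ⋏
      Target.dom ⟨n, l, VA, EA⟩ k e ⋏ Fm.not (BA.mem4 I t j c d) ⋏
      Target.edge ⟨n, l, VA, EA⟩ k e j c ⋏ Target.edge ⟨n, l, VA, EA⟩ k e j d)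
      (BlockedBwd l' VA' EA' I' t' j' k') := by
  unfold BlockedBwd; infer_instance

instance isPropagation {l₀ : ℕ} {σ : Finset (Fin l₀ × Fin l₀)} [SVal c EX EX'] [TVal c n n']
    [TVal c l l'] [SVal c VA VA'] [SVal c EA EA'] [TVal c i i'] [SVal c I I'] :
    FVal c (isPropagation ⟨t, VX, EX⟩ ⟨n, l, VA, EA⟩ i σ I)
      (IsPropagationIn EX' n' l' VA' EA' i' σ I') := by
  unfold BA.isPropagation IsPropagationIn PropagationStep
  refine @FVal.and _ c _ _ _ _ ?_ ?_
  · dsimp only; infer_instance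
  refine @FVal.allLt _ _ c _ _ _ _ ?_ fun t => @FVal.allLt _ _ _ _ _ _ _ ?_ fun k =>
    @FVal.allLt _ _ _ _ _ _ _ ?_ fun a => @FVal.allLt _ _ _ _ _ _ _ ?_ fun b =>
    @FVal.iff _ _ _ _ _ _ ?_ (@FVal.or _ _ _ _ _ _ ?_ ?_)
  all_goals infer_instance

instance isReachedSubgraph [TVal c r r'] [SVal c VY VY'] [SVal c EY EY'] [SVal c EX EX']
    [TVal c n n'] [TVal c l l'] [SVal c I I'] :
    FVal c (isReachedSubgraph ⟨t, VY, EY⟩ ⟨r, VX, EX⟩ ⟨n, l, VA, EA⟩ I)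
      (IsReachedSubgraphIn r' VY' EY' EX' n' l' I') := by
  unfold BA.isReachedSubgraph IsReachedSubgraphIn; dsimp only; infer_instance

instance domIs {l₀ : ℕ} {D : Finset (Fin l₀)} [TVal c i i'] [SVal c VA VA'] :
    FVal c (domIs ⟨n, l, VA, EA⟩ i D) (DomIsIn VA' i' D) := by
  unfold BA.domIs DomIsIn; infer_instance

instance edgeIs {l₀ : ℕ} {R : Finset (Fin l₀ × Fin l₀)} [TVal c i i'] [TVal c j j']
    [SVal c EA EA'] :
    FVal c (edgeIs ⟨n, l, VA, EA⟩ i j R) (EdgeIsIn EA' i' j' R) := by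
  unfold BA.edgeIs EdgeIsIn; infer_instance

variable {l₀ m : ℕ} {Ω : (Fin m → Fin l₀) → Fin l₀}

instance isInstanceOver [TVal c t t'] [SVal c VX VX'] [SVal c EX EX'] [TVal c n n'] [TVal c l l']
    [SVal c VA VA'] [SVal c EA EA'] :
    FVal c (isInstanceOver Ω ⟨t, VX, EX⟩ ⟨n, l, VA, EA⟩)
      (IsInstanceOverIn Ω t' VX' EX' n' l' VA' EA') := by
  unfold BA.isInstanceOver IsInstanceOverIn; dsimp only; infer_instance

instance checkOK [TVal c t t'] [SVal c EX EX'] [TVal c n n'] [TVal c l l']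
    [SVal c VA VA'] [SVal c EA EA'] :
    FVal c (checkOK Ω ⟨t, VX, EX⟩ ⟨n, l, VA, EA⟩)
      (CheckOKIn Ω t' EX' n' l' VA' EA') := by
  unfold BA.checkOK CheckOKIn; dsimp only; infer_instance

end FVal

instance FVal.checkedIsIrreducible {l₀ m : ℕ} (Ω : (Fin m → Fin l₀) → Fin l₀) (c : Cx M) :
    FVal c (Fm.allN fun n => Fm.allS fun VX => Fm.allS fun EX => Fm.allS fun VA => Fm.allS fun EA =>
      (BA.isInstanceOver Ω ⟨n, VX, EX⟩ ⟨n, num l₀, VA, EA⟩ ⋏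
        BA.cycleConsistent ⟨n, VX, EX⟩ ⟨n, num l₀, VA, EA⟩ ⋏
        BA.checkOK Ω ⟨n, VX, EX⟩ ⟨n, num l₀, VA, EA⟩) ⟹
        BA.irreducible ⟨n, VX, EX⟩ ⟨n, num l₀, VA, EA⟩)
    (∀ (n : M.Num) (VX EX VA EA : M.Str),
      (IsInstanceOverIn Ω n VX EX n (l₀ : M.Num) VA EA ∧
        CycleConsistentIn n VX EX n (l₀ : M.Num) VA EA ∧ CheckOKIn Ω n EX n (l₀ : M.Num) VA EA) →
      IrreducibleIn n VX EX n (l₀ : M.Num) VA EA) := by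
  infer_instance

theorem satisfies_checkedIsIrreducible {l₀ m : ℕ} (Ω : (Fin m → Fin l₀) → Fin l₀)
    (h : ∀ (n : M.Num) (VX EX VA EA : M.Str), IsInstanceOverIn Ω n VX EX n (l₀ : M.Num) VA EA →
      CycleConsistentIn n VX EX n (l₀ : M.Num) VA EA → CheckOKIn Ω n EX n (l₀ : M.Num) VA EA →
      IrreducibleIn n VX EX n (l₀ : M.Num) VA EA) : M.Satisfies (checkedIsIrreducible Ω) :=
  fun v w => (FVal.checkedIsIrreducible Ω ⟨v, w, 0, 0⟩).out.2
    fun n VX EX VA EA h' => h n VX EX VA EA h'.1 h'.2.1 h'.2.2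

end

-- Sizes and injectivity of codes

section

variable {M : Model} [hM : M.IsV1]

theorem comprehension_mem_iff (P : M.Num → Prop) [hP : Definable fun e => P e.headN] (N : M.Num) :
    ∃ X : M.Str, M.len X ≤ N ∧ ∀ y, y ∈ X ↔ y < N ∧ P y := by
  obtain ⟨X, hX, h⟩ := comprehension P N
  exact ⟨X, hX, fun y => ⟨fun hy => ⟨(lt_len hy).trans_le hX, (h y ((lt_len hy).trans_le hX)).1 hy⟩,
    fun hy => (h y hy.1).2 hy.2⟩⟩

theorem pair_lt_pairBound {x y n l : M.Num} (hx : x < n) (hy : y < l) :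
    pair x y < pairBound n l := by
  refine (pair_lt_of_lt hx hy).trans_le ?_
  have : n + l ≤ n + l + 1 := le_self_add
  unfold pairBound
  gcongr

/-- The bound is that of `fourSq`. The hypothesis also admits the pairs `(r, r + 1)` and `(r + 1,
r)` with `r < t`, that is, the edges of a path whose last vertex is `t` itself. -/
theorem pair_lt_four_mul {x y t : M.Num} (h : x + y + 1 ≤ t + t) :
    pair x y < (1 + 1 + 1 + 1) * (t * t) :=
  calc pair x y < (x + y + 1) * (x + y + 1) := pair_lt x y
    _ ≤ (t + t) * (t + t) := by gcongr
    _ = (1 + 1 + 1 + 1) * (t * t) := by ring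

theorem pair_lt_four_mul_of_lt {x y t : M.Num} (hx : x < t) (hy : y < t) :
    pair x y < (1 + 1 + 1 + 1) * (t * t) := by
  refine pair_lt_four_mul ?_
  rw [add_assoc]
  exact add_le_add hx.le (Num.lt_iff_add_one_le.1 hy)

/-- Values at variables are numbered by `j * l + x` instead of by pair codes: these numbers lie
below `n * l`, so a graph search among them gives paths within the length bound in the definition of
linkedness. -/
theorem mul_add_inj {l j x k y : M.Num} (hx : x < l) (hy : y < l)
    (h : j * l + x = k * l + y) : j = k ∧ x = y := by
  have key : ∀ {j x k y : M.Num}, x < l → j * l + x = k * l + y → ¬ j < k := by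
    intro j x k y hx h hjk
    refine absurd h (ne_of_lt ?_)
    calc j * l + x < j * l + l := by gcongr
      _ = (j + 1) * l := by ring
      _ ≤ k * l := by gcongr; exact Num.lt_iff_add_one_le.1 hjk
      _ ≤ k * l + y := le_self_add
  obtain rfl : j = k := le_antisymm (not_lt.1 (key hy h.symm)) (not_lt.1 (key hx h))
  exact ⟨rfl, add_left_cancel h⟩

theorem mul_add_lt {n l j x : M.Num} (hj : j < n) (hx : x < l) : j * l + x < n * l :=
  calc j * l + x < j * l + l := by gcongr
    _ = (j + 1) * l := by ring
    _ ≤ n * l := by gcongr; exact Num.lt_iff_add_one_le.1 hj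

/-! ## Paths in the result of a graph search -/

/-- A parent function for the list of vertices found by a graph search. -/
theorem exists_parent {Adj : M.Num → M.Num → Prop}
    [hAdj : Definable fun e => Adj e.tailN.headN e.headN] {f : M.Str} {s : M.Num}
    (hadj : ∀ p, p < s → ∃ q, q ≤ p ∧ Adj (app f q) (app f (p + 1))) :
    ∃ π : M.Str, (∀ p, p ≤ s → app π p ≤ s) ∧
      ∀ p, 0 < p → p ≤ s → app π p < p ∧ Adj (app f (app π p)) (app f p) := by
  have := hAdj.app₂
  obtain ⟨π, -, hπ⟩ := exists_choice
    (P := fun p v => (p = 0 ∧ v = 0) ∨ (v < p ∧ Adj (app f v) (app f p))) (s + 1) (s + 1)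
    (fun p hp => by
      rcases eq_or_ne p 0 with rfl | hp0
      · exact ⟨0, hp, .inl ⟨rfl, rfl⟩⟩
      · obtain ⟨p, rfl⟩ := Num.exists_pred hp0
        have hps : p < s := Num.lt_iff_add_one_le.2 (Num.lt_add_one_iff.1 hp)
        obtain ⟨q, hq, hqp⟩ := hadj p hps
        exact ⟨q, Num.lt_add_one_iff.2 (hq.trans hps.le), .inr ⟨Num.lt_add_one_iff.2 hq, hqp⟩⟩)
  refine ⟨π, fun p hp => Num.lt_add_one_iff.1 (hπ p (Num.lt_add_one_iff.2 hp)).1,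
    fun p hp0 hp => ?_⟩
  exact (hπ p (Num.lt_add_one_iff.2 hp)).2.resolve_left fun h => hp0.ne' h.1

/-- A path from any vertex found by a graph search back to the start. -/
theorem exists_path {Adj : M.Num → M.Num → Prop}
    [hAdj : Definable fun e => Adj e.tailN.headN e.headN] {f : M.Str} {s p₀ : M.Num}
    (hadj : ∀ p, p < s → ∃ q, q ≤ p ∧ Adj (app f q) (app f (p + 1))) (hp₀ : p₀ ≤ s) :
    ∃ (w : M.Str) (t : M.Num), t ≤ s ∧ app w 0 = p₀ ∧ app w t = 0 ∧ (∀ r, r ≤ t → app w r ≤ s) ∧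
      ∀ r, r < t → Adj (app f (app w (r + 1))) (app f (app w r)) := by
  obtain ⟨π, hπs, hπ⟩ := exists_parent hadj
  -- The path iterates the parent function from `p₀`. The relation names the predecessor `q` of `r`,
  -- so that it visibly depends on earlier values only.
  obtain ⟨w, -, hw⟩ := exists_recursive_choice
    (R := fun Z r v => (r = 0 ∧ v = p₀) ∨ ∃ q, q < r ∧ (r = q + 1 ∧ v = app π (app Z q)))
    (p₀ + 1) (s + 1)
    (by
      rintro Z Z' r v hZ (h | ⟨q, hq, h, h'⟩)
      · exact .inl h
      · exact .inr ⟨q, hq, h, by rw [h', hZ q hq]⟩)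
    (by
      intro Z r _ hZ
      rcases eq_or_ne r 0 with rfl | hr0
      · exact ⟨p₀, Num.lt_add_one_iff.2 hp₀, .inl ⟨rfl, rfl⟩⟩
      · obtain ⟨q, rfl⟩ := Num.exists_pred hr0
        have hq : q < q + 1 := Num.lt_add_one_iff.2 le_rfl
        exact ⟨_, Num.lt_add_one_iff.2 (hπs _ (Num.lt_add_one_iff.1 (hZ q hq).1)),
          .inr ⟨q, hq, rfl, rfl⟩⟩)
  have hw0 : app w 0 = p₀ := by
    rcases (hw 0 (Num.lt_add_one_iff.2 zero_le)).2 with h | ⟨q, hq, -⟩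
    · exact h.2
    · exact absurd hq not_lt_zero
  have hws : ∀ r, r ≤ p₀ → app w r ≤ s := fun r hr =>
    Num.lt_add_one_iff.1 (hw r (Num.lt_add_one_iff.2 hr)).1
  have hwstep : ∀ r, r + 1 ≤ p₀ → app w (r + 1) = app π (app w r) := by
    intro r hr
    rcases (hw (r + 1) (Num.lt_add_one_iff.2 hr)).2 with h | ⟨q, hq, h, h'⟩
    · exact absurd h.1 (Num.add_one_ne_zero r)
    · obtain rfl := Num.add_one_inj h
      exact h'
  -- Parents are smaller than their children, so as long as the root has not been met each step
  -- lowers the value by at least one. Hence the root is met within `p₀` steps.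
  have hdec : ∀ r, r ≤ p₀ → (∃ q, q ≤ r ∧ app w q = 0) ∨ app w r + r ≤ p₀ :=
    sigma0_induction (P := fun r => r ≤ p₀ → (∃ q, q ≤ r ∧ app w q = 0) ∨ app w r + r ≤ p₀)
      (fun _ => .inr (by rw [hw0, add_zero]))
      (fun r ih hr => by
        have hrr : r ≤ r + 1 := le_self_add
        rcases ih (hrr.trans hr) with ⟨q, hq, h⟩ | h
        · exact .inl ⟨q, hq.trans hrr, h⟩
        · rcases eq_or_ne (app w r) 0 with h0 | h0
          · exact .inl ⟨r, hrr, h0⟩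
          · have := (hπ _ (pos_iff_ne_zero.2 h0) (hws r (hrr.trans hr))).1
            rw [← hwstep r hr, Num.lt_iff_add_one_le] at this
            refine .inr (le_trans ?_ h)
            calc app w (r + 1) + (r + 1) = app w (r + 1) + 1 + r := by ring
              _ ≤ app w r + r := by gcongr)
  have hex : ∃ t, t ≤ p₀ ∧ app w t = 0 := by
    rcases hdec p₀ le_rfl with h | h
    · exact h
    · refine ⟨p₀, le_rfl, nonpos_iff_eq_zero.1 (le_of_add_le_add_right (a := p₀) ?_)⟩
      rwa [zero_add]
  -- Stopping at the first visit to 0 keeps all earlier entries positive, and only positive entries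
  -- are adjacent to their parents.
  obtain ⟨t, ⟨htp, ht0⟩, htmin⟩ := exists_least (P := fun t => t ≤ p₀ ∧ app w t = 0) hex
  refine ⟨w, t, htp.trans hp₀, hw0, ht0, fun r hr => hws r (hr.trans htp), fun r hr => ?_⟩
  have hrp : r ≤ p₀ := hr.le.trans htp
  have h0 : app w r ≠ 0 := fun h => htmin r hr ⟨hrp, h⟩
  rw [hwstep r ((Num.lt_iff_add_one_le.1 hr).trans htp)]
  exact (hπ _ (pos_iff_ne_zero.2 h0) (hws r hrp)).2

/-! ## Elements that are not linked are separated by a set -/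

/-- The code `u` of a value at a variable is joined to the code `v` by an edge. -/
def FwdEdge (EY : M.Str) (n l : M.Num) (EA : M.Str) (u v : M.Num) : Prop :=
  ∃ j, j < n ∧ ∃ x, x < l ∧ ∃ k, k < n ∧ ∃ y, y < l ∧
    (u = j * l + x ∧ v = k * l + y ∧ pair j k ∈ EY ∧ EdgeIn EA j x k y)

instance {EY : M.Str} {n l : M.Num} {EA : M.Str} {f g : Env M → M.Num} [hf : DefinableFn f]
    [hg : DefinableFn g] : Definable (fun e => FwdEdge EY n l EA (f e) (g e)) := by
  have : Definable fun e : Env M => FwdEdge EY n l EA e.tailN.headN e.headN := by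
    unfold FwdEdge; infer_instance
  exact this.app₂ f g

variable {n l : M.Num} {VY EY VA EA : M.Str}

/-- A path given by the codes of its elements links its ends. -/
theorem areLinkedIn_of_path {i a b t : M.Num}
    (hEY : ∀ j, j < n → ∀ k, k < n → pair j k ∈ EY → j ∈ VY ∧ k ∈ VY)
    (hEA : ∀ j x k y, EdgeIn EA j x k y → pair j x ∈ VA ∧ pair k y ∈ VA)
    (hi : i < n) (hiY : i ∈ VY) (ha : a < l) (hb : b < l) (hDb : pair i b ∈ VA)
    (u : M.Num → M.Num) [hu : DefinableFn fun e => u e.headN] (ht : t < n * l)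
    (hu0 : u 0 = i * l + a) (hut : u t = i * l + b)
    (hstep : ∀ r, r < t → FwdEdge EY n l EA (u r) (u (r + 1)) ∨
      FwdEdge EY n l EA (u (r + 1)) (u r)) :
    AreLinkedIn a b i i n VY EY n l VA EA := by
  have hgraph : Definable fun e : Env M => e.headN = u e.tailN.headN :=
    hu.graph.rename (fun | 0 => 0 | i + 1 => i + 1) id
  have hue : ∀ (g f : Env M → M.Num) [DefinableFn g] [DefinableFn f],
      Definable (fun e => u (f e) = g e) := fun g f _ _ =>
    Definable.congr (Definable.app₂ (P := fun x v => v = u x) hgraph f g) fun e => eq_comm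
  have huF : Definable fun e : Env M => FwdEdge EY n l EA (u e.tailN.headN) (u e.headN) :=
    .congr (P := fun e => ∃ v, v < n * l ∧ ∃ w, w < n * l ∧ (u e.tailN.headN = v ∧ u e.headN = w ∧
      FwdEdge EY n l EA v w)) inferInstance fun e => ⟨fun h => by
        obtain ⟨j, hj, x, hx, k, hk, y, hy, hv, hw, h'⟩ := id h
        exact ⟨_, hv ▸ mul_add_lt hj hx, _, hw ▸ mul_add_lt hk hy, rfl, rfl, h⟩,
      fun ⟨v, _, w, _, hv, hw, h⟩ => by rwa [hv, hw]⟩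
  have huF' : ∀ (f g : Env M → M.Num) [DefinableFn f] [DefinableFn g],
      Definable (fun e => FwdEdge EY n l EA (u (f e)) (u (g e))) := fun f g _ _ =>
    Definable.app₂ (P := fun x y => FwdEdge EY n l EA (u x) (u y)) huF f g
  -- For `r < t` the entry is an end of an edge, hence a value of a vertex in `VY`. The last entry
  -- is treated apart, which also covers the path of length 0.
  have hgood : ∀ r, r ≤ t → ∃ j, j < n ∧ ∃ x, x < l ∧ u r = j * l + x ∧ j ∈ VY ∧
      pair j x ∈ VA := by
    intro r hr
    rcases hr.lt_or_eq with hr | rfl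
    · rcases hstep r hr with ⟨j, hj, x, hx, k, hk, y, hy, hv, hw, h1, h2⟩ |
        ⟨j, hj, x, hx, k, hk, y, hy, hw, hv, h1, h2⟩
      · exact ⟨j, hj, x, hx, hv, (hEY j hj k hk h1).1, (hEA _ _ _ _ h2).1⟩
      · exact ⟨k, hk, y, hy, hv, (hEY j hj k hk h1).2, (hEA _ _ _ _ h2).2⟩
    · exact ⟨i, hi, b, hb, hut, hiY, hDb⟩
  obtain ⟨VP, hVP, hVP'⟩ := comprehension_mem_iff (M := M) (fun _ => True) (t + 1)
  -- The path keeps, for each step, exactly the directions in which that step is an edge between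
  -- values. Therefore the projection `H` and the lift `K` both preserve edges.
  obtain ⟨EP, hEP, hEP'⟩ := comprehension_mem_iff (fun z => ∃ r, r ≤ t ∧ ∃ r', r' ≤ t ∧
    (z = pair r r' ∧ (r' = r + 1 ∨ r = r' + 1) ∧ FwdEdge EY n l EA (u r) (u r')))
    ((1 + 1 + 1 + 1) * (t * t))
  obtain ⟨H, hH, hH'⟩ := comprehension_mem_iff (fun z => ∃ r, r ≤ t ∧ ∃ j, j < n ∧ ∃ x, x < l ∧
    (z = pair r j ∧ u r = j * l + x)) (pairBound (t + 1) n)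
  obtain ⟨K, hK, hK'⟩ := comprehension_mem_iff (fun z => ∃ r, r ≤ t ∧ ∃ j, j < n ∧ ∃ x, x < l ∧
    (z = pair r (pair j x) ∧ u r = j * l + x)) (pairBound (t + 1) (pairBound n l))
  have mEP : ∀ r r', pair r r' ∈ EP → (r' = r + 1 ∨ r = r' + 1) ∧
      FwdEdge EY n l EA (u r) (u r') := by
    intro r r' h
    obtain ⟨-, p, _, p', _, he, h⟩ := (hEP' _).1 h
    obtain ⟨rfl, rfl⟩ := pair_inj he
    exact h
  have mEP₁ : ∀ r, r < t → FwdEdge EY n l EA (u r) (u (r + 1)) → pair r (r + 1) ∈ EP := by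
    intro r hr h
    have hr' := Num.lt_iff_add_one_le.1 hr
    refine (hEP' _).2 ⟨pair_lt_four_mul ?_, r, hr.le, r + 1, hr', rfl, .inl rfl, h⟩
    rw [show r + (r + 1) + 1 = (r + 1) + (r + 1) by ring]
    exact add_le_add hr' hr'
  have mEP₂ : ∀ r, r < t → FwdEdge EY n l EA (u (r + 1)) (u r) → pair (r + 1) r ∈ EP := by
    intro r hr h
    have hr' := Num.lt_iff_add_one_le.1 hr
    refine (hEP' _).2 ⟨pair_lt_four_mul ?_, r + 1, hr', r, hr.le, rfl, .inr rfl, h⟩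
    rw [add_assoc]
    exact add_le_add hr' hr'
  have mH : ∀ r j, pair r j ∈ H → j < n ∧ ∃ x, x < l ∧ u r = j * l + x := by
    intro r j h
    obtain ⟨-, p, _, k, hk, x, hx, he, h⟩ := (hH' _).1 h
    obtain ⟨rfl, rfl⟩ := pair_inj he
    exact ⟨hk, x, hx, h⟩
  have mH' : ∀ r j x, r ≤ t → j < n → x < l → u r = j * l + x → pair r j ∈ H :=
    fun r j x hr hj hx h => (hH' _).2 ⟨pair_lt_pairBound (Num.lt_add_one_iff.2 hr) hj,
      r, hr, j, hj, x, hx, rfl, h⟩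
  have mK : ∀ r z, pair r z ∈ K → ∃ j, j < n ∧ ∃ x, x < l ∧ z = pair j x ∧ u r = j * l + x := by
    intro r z h
    obtain ⟨-, p, _, k, hk, x, hx, he, h'⟩ := (hK' _).1 h
    obtain ⟨rfl, rfl⟩ := pair_inj he
    exact ⟨k, hk, x, hx, rfl, h'⟩
  have mK' : ∀ r j x, r ≤ t → j < n → x < l → u r = j * l + x → pair r (pair j x) ∈ K :=
    fun r j x hr hj hx h => (hK' _).2 ⟨pair_lt_pairBound (Num.lt_add_one_iff.2 hr)
      (pair_lt_pairBound hj hx), r, hr, j, hj, x, hx, rfl, h⟩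
  refine ⟨t, ht, VP, hVP, EP, hEP, H, hH, ⟨?_, ?_, ?_⟩, ⟨⟨?_, ?_⟩, ?_⟩,
    mH' 0 i a zero_le hi ha hu0, mH' t i b le_rfl hi hb hut, K, hK, ⟨⟨⟨?_, ?_⟩, ?_⟩, ?_⟩,
    mK' 0 i a zero_le hi ha hu0, mK' t i b le_rfl hi hb hut⟩
  · exact fun r hr => (hVP' r).2 ⟨Num.lt_add_one_iff.2 hr, trivial⟩
  · exact fun r hr => (hstep r hr).imp (mEP₁ r hr) (mEP₂ r hr)
  · exact fun r _ r' _ h => (mEP r r' h).1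
  · intro r hr _
    obtain ⟨j, hj, x, hx, h, hjY, _⟩ := hgood r (Num.lt_add_one_iff.1 hr)
    exact ⟨j, hj, hjY, mH' r j x (Num.lt_add_one_iff.1 hr) hj hx h⟩
  · rintro r hr _ j₁ _ j₂ _ ⟨-, -, h₁, h₂⟩
    obtain ⟨_, x, hx, hux⟩ := mH _ _ h₁
    obtain ⟨_, y, hy, huy⟩ := mH _ _ h₂
    exact (mul_add_inj hx hy (hux.symm.trans huy)).1
  · rintro r₁ _ r₂ _ j₁ _ j₂ _ ⟨h, h₁, h₂⟩
    obtain ⟨-, j, hj, x, hx, k, hk, y, hy, hv, hw, h1, h2⟩ := mEP _ _ h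
    obtain ⟨_, x', hx', hux⟩ := mH _ _ h₁
    obtain ⟨_, y', hy', huy⟩ := mH _ _ h₂
    rw [(mul_add_inj hx' hx (hux.symm.trans hv)).1, (mul_add_inj hy' hy (huy.symm.trans hw)).1]
    exact h1
  · intro r hr _
    obtain ⟨j, hj, x, hx, h, hjY, hjA⟩ := hgood r (Num.lt_add_one_iff.1 hr)
    exact ⟨_, pair_lt_pairBound hj hx, hjA, mK' r j x (Num.lt_add_one_iff.1 hr) hj hx h⟩
  · rintro r hr _ z₁ _ z₂ _ ⟨-, -, h₁, h₂⟩
    obtain ⟨j, _, x, hx, rfl, hux⟩ := mK _ _ h₁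
    obtain ⟨k, _, y, hy, rfl, huy⟩ := mK _ _ h₂
    obtain ⟨rfl, rfl⟩ := mul_add_inj hx hy (hux.symm.trans huy)
    rfl
  · rintro r₁ _ r₂ _ z₁ _ z₂ _ ⟨h, h₁, h₂⟩
    obtain ⟨-, j, hj, x, hx, k, hk, y, hy, hv, hw, h1, h2⟩ := mEP _ _ h
    obtain ⟨j', _, x', hx', rfl, hux⟩ := mK _ _ h₁
    obtain ⟨k', _, y', hy', rfl, huy⟩ := mK _ _ h₂
    obtain ⟨rfl, rfl⟩ := mul_add_inj hx' hx (hux.symm.trans hv)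
    obtain ⟨rfl, rfl⟩ := mul_add_inj hy' hy (huy.symm.trans hw)
    exact h2
  · intro r hr k _ hk
    obtain ⟨hkn, x, hx, hux⟩ := mH _ _ hk
    obtain ⟨j, hj, y, hy, h, hjY, hjA⟩ := hgood r (Num.lt_add_one_iff.1 hr)
    obtain ⟨rfl, rfl⟩ := mul_add_inj hx hy (hux.symm.trans h)
    exact ⟨x, hx, hjA, mK' r k x (Num.lt_add_one_iff.1 hr) hkn hx hux⟩

/-- `S` is the connected component of `(i, b)` in the graph on all pairs of a variable and a value,
found by graph search. If it contained `(i, a)`, the path back to the start of the search would have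
length below `n * l` and link `a` to `b`. -/
theorem exists_separating {i a b : M.Num}
    (hEY : ∀ j, j < n → ∀ k, k < n → pair j k ∈ EY → j ∈ VY ∧ k ∈ VY)
    (hEA : ∀ j x k y, EdgeIn EA j x k y →
      (j < n ∧ x < l ∧ pair j x ∈ VA) ∧ k < n ∧ y < l ∧ pair k y ∈ VA)
    (hi : i < n) (hiY : i ∈ VY) (ha : a < l) (hb : b < l) (hDb : pair i b ∈ VA)
    (hn : ¬ AreLinkedIn a b i i n VY EY n l VA EA) :
    ∃ S : M.Str, pair i b ∈ S ∧ pair i a ∉ S ∧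
      ∀ j x k y, pair j k ∈ EY → EdgeIn EA j x k y → (pair j x ∈ S ↔ pair k y ∈ S) := by
  obtain ⟨f, s, hs, hf0, hfN, hadj, hclosed⟩ := exists_search
    (Adj := fun u v => FwdEdge EY n l EA u v ∨ FwdEdge EY n l EA v u) (mul_add_lt hi hb)
  obtain ⟨S, -, hS⟩ := comprehension_mem_iff (fun z => ∃ j, j < n ∧ ∃ x, x < l ∧
    (z = pair j x ∧ ∃ p, p ≤ s ∧ app f p = j * l + x)) (pairBound n l)
  have mS : ∀ j x, j < n → x < l → (pair j x ∈ S ↔ ∃ p, p ≤ s ∧ app f p = j * l + x) := by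
    intro j x hj hx
    rw [hS]
    constructor
    · rintro ⟨-, j', _, x', _, he, h⟩
      obtain ⟨rfl, rfl⟩ := pair_inj he
      exact h
    · exact fun h => ⟨pair_lt_pairBound hj hx, j, hj, x, hx, rfl, h⟩
  refine ⟨S, (mS i b hi hb).2 ⟨0, zero_le, hf0⟩, fun h => hn ?_, fun j x k y hE h => ?_⟩
  · obtain ⟨p₀, hp₀, hfp⟩ := (mS i a hi ha).1 h
    obtain ⟨w, t, ht, hw0, hwt, -, hstep⟩ := exists_path
      (Adj := fun u v => FwdEdge EY n l EA u v ∨ FwdEdge EY n l EA v u) hadj hp₀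
    exact areLinkedIn_of_path hEY (fun j x k y h => ⟨(hEA j x k y h).1.2.2, (hEA j x k y h).2.2.2⟩)
      hi hiY ha hb hDb (fun r => app f (app w r)) (ht.trans_lt hs)
      (by rw [hw0, hfp]) (by rw [hwt, hf0]) fun r hr => (hstep r hr).symm
  · obtain ⟨⟨hj, hx, -⟩, hk, hy, -⟩ := hEA j x k y h
    have hF : FwdEdge EY n l EA (j * l + x) (k * l + y) :=
      ⟨j, hj, x, hx, k, hk, y, hy, rfl, rfl, hE, h⟩
    rw [mS j x hj hx, mS k y hk hy]
    constructor
    · rintro ⟨p, hp, hfp⟩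
      exact hclosed p hp _ (mul_add_lt hk hy) (.inl (by rwa [hfp]))
    · rintro ⟨p, hp, hfp⟩
      exact hclosed p hp _ (mul_add_lt hj hx) (.inr (by rwa [hfp]))

/-! ## Existence of the propagation -/

variable {EX : M.Str}

instance {I : Env M → M.Str} {t k a b : Env M → M.Num} [hI : IsSet I] [ht : DefinableFn t]
    [hk : DefinableFn k] [ha : DefinableFn a] [hb : DefinableFn b] :
    Definable (fun e => PropagationStep EX n l VA EA (I e) (t e) (k e) (a e) (b e)) := by
  have hI' : ∀ (s) [IsShift s], IsSet fun e => I (s e) := fun s _ => IsShift.isSet hI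
  have ht' : ∀ (s) [IsShift s], DefinableFn fun e => t (s e) := fun s _ => IsShift.definableFn ht
  have hk' : ∀ (s) [IsShift s], DefinableFn fun e => k (s e) := fun s _ => IsShift.definableFn hk
  have ha' : ∀ (s) [IsShift s], DefinableFn fun e => a (s e) := fun s _ => IsShift.definableFn ha
  have hb' : ∀ (s) [IsShift s], DefinableFn fun e => b (s e) := fun s _ => IsShift.definableFn hb
  set_option synthInstance.maxSize 2000 in
  set_option synthInstance.maxHeartbeats 400000 in
  unfold PropagationStep BlockedFwd BlockedBwd
  infer_instance

/-- The final stage `t = n` is allowed; it is covered by the summand 1 in `pairBound`. -/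
theorem code_lt {t k a b : M.Num} (ht : t ≤ n) (hk : k < n) (ha : a < l) (hb : b < l) :
    code t k a b < pairBound (pairBound (pairBound n n) l) l := by
  refine pair_lt_pairBound (pair_lt_pairBound ((pair_lt t k).trans_le ?_) ha) hb
  have : t + k + 1 ≤ n + n + 1 := by gcongr
  unfold pairBound
  gcongr

theorem code_inj {t k a b t' k' a' b' : M.Num} (h : code t k a b = code t' k' a' b') :
    t = t' ∧ k = k' ∧ a = a' ∧ b = b' := by
  simpa [and_assoc] using h

/-- A step consults only layer `t` of the propagation, so adding layer `t + 1` does not disturb the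
equations already satisfied. -/
theorem propagationStep_congr {I I' : M.Str} {t k a b : M.Num} (hk : k < n) (ha : a < l)
    (hb : b < l)
    (h : ∀ j, j < n → ∀ c, c < l → ∀ d, d < l → (code t j c d ∈ I ↔ code t j c d ∈ I')) :
    PropagationStep EX n l VA EA I t k a b ↔ PropagationStep EX n l VA EA I' t k a b := by
  have hf : ∀ j, j < n → (BlockedFwd l VA EA I t j k ↔ BlockedFwd l VA EA I' t j k) := by
    intro j hj
    refine exists_congr fun c => and_congr_right fun hc => exists_congr fun d =>
      and_congr_right fun hd => ?_
    rw [h j hj c hc d hd]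
  have hw : ∀ j, j < n → (BlockedBwd l VA EA I t j k ↔ BlockedBwd l VA EA I' t j k) := by
    intro j hj
    refine exists_congr fun c => and_congr_right fun hc => exists_congr fun d =>
      and_congr_right fun hd => ?_
    rw [h j hj c hc d hd]
  refine or_congr (h k hk a ha b hb) (exists_congr fun j => and_congr_right fun hj =>
    exists_congr fun c => and_congr_right fun hc => exists_congr fun d =>
      and_congr_right fun hd => ?_)
  rw [h j hj c hc d hd, hf j hj, hw j hj]

/-- The propagation of a relation exists. -/
theorem exists_propagation {l₀ : ℕ} (σ : Finset (Fin l₀ × Fin l₀)) (EX : M.Str) (n l : M.Num)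
    (VA EA : M.Str) (i : M.Num) :
    ∃ I, M.len I ≤ pairBound (pairBound (pairBound n n) l) l ∧
      IsPropagationIn EX n l VA EA i σ I := by
  have hσ : ∀ (f g : Env M → M.Num) [DefinableFn f] [DefinableFn g],
      Definable (fun e => RelIn σ (f e) (g e)) := fun f g _ _ =>
    Definable.congr (P := fun e => ∃ p : σ, f e = ((p.1.1 : ℕ) : M.Num) ∧
      g e = ((p.1.2 : ℕ) : M.Num)) inferInstance fun e => by
        simp only [RelIn, Finset.mem_toList, Subtype.exists, exists_prop]
  -- Induction on the number of computed layers. All of them fit under one length bound, as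
  -- Σ₁-induction requires.
  obtain ⟨I, hI, h0, hstep⟩ := sigma1_induction (P := fun x I =>
    (∀ k, k < n → ∀ a, a < l → ∀ b, b < l → (code 0 k a b ∈ I ↔ (k = i ∧ RelIn σ a b))) ∧
    ∀ t, t < x → t < n → ∀ k, k < n → ∀ a, a < l → ∀ b, b < l →
      (code (t + 1) k a b ∈ I ↔ PropagationStep EX n l VA EA I t k a b))
    (pairBound (pairBound (pairBound n n) l) l)
    (by
      obtain ⟨I, hI, hI'⟩ := comprehension_mem_iff (fun z => ∃ k, k < n ∧ ∃ a, a < l ∧ ∃ b, b < l ∧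
        (z = code 0 k a b ∧ k = i ∧ RelIn σ a b)) (pairBound (pairBound (pairBound n n) l) l)
      refine ⟨I, hI, fun k hk a ha b hb => (hI' _).trans ⟨?_, fun h =>
        ⟨code_lt zero_le hk ha hb, k, hk, a, ha, b, hb, rfl, h⟩⟩,
        fun t ht => absurd ht not_lt_zero⟩
      rintro ⟨-, k', _, a', _, b', _, he, h⟩
      obtain ⟨-, rfl, rfl, rfl⟩ := code_inj he
      exact h)
    (fun x ⟨I, hI, h0, h⟩ => by
      rcases lt_or_ge x n with hx | hx
      swap
      · exact ⟨I, hI, h0, fun t _ htn => h t (htn.trans_le hx) htn⟩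
      -- The new set keeps the layers up to `x`, receives layer `x + 1` from the recursion, and
      -- drops whatever `I` contained above.
      obtain ⟨I', hI', hmem⟩ := comprehension_mem_iff (fun z => ∃ t, t ≤ n ∧ ∃ k, k < n ∧
        ∃ a, a < l ∧ ∃ b, b < l ∧ (z = code t k a b ∧ ((t ≤ x ∧ z ∈ I) ∨
          (t = x + 1 ∧ PropagationStep EX n l VA EA I x k a b))))
        (pairBound (pairBound (pairBound n n) l) l)
      have mI' : ∀ t, t ≤ n → ∀ k, k < n → ∀ a, a < l → ∀ b, b < l → (code t k a b ∈ I' ↔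
          (t ≤ x ∧ code t k a b ∈ I) ∨
            (t = x + 1 ∧ PropagationStep EX n l VA EA I x k a b)) := by
        intro t ht k hk a ha b hb
        refine (hmem _).trans ⟨?_, fun h =>
          ⟨code_lt ht hk ha hb, t, ht, k, hk, a, ha, b, hb, rfl, h⟩⟩
        rintro ⟨-, t', _, k', _, a', _, b', _, he, h⟩
        obtain ⟨rfl, rfl, rfl, rfl⟩ := code_inj he
        exact h
      have hold : ∀ t, t ≤ x → ∀ k, k < n → ∀ a, a < l → ∀ b, b < l →
          (code t k a b ∈ I ↔ code t k a b ∈ I') := by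
        intro t ht k hk a ha b hb
        rw [mI' t (ht.trans hx.le) k hk a ha b hb]
        exact ⟨fun h => .inl ⟨ht, h⟩, fun h => h.elim And.right fun h =>
          absurd ht (not_le.2 (h.1 ▸ Num.lt_add_one_iff.2 le_rfl))⟩
      refine ⟨I', hI', fun k hk a ha b hb => (hold 0 zero_le k hk a ha b hb).symm.trans
        (h0 k hk a ha b hb), fun t ht htn k hk a ha b hb => ?_⟩
      rcases (Num.lt_add_one_iff.1 ht).lt_or_eq with htx | rfl
      · rw [← hold (t + 1) (Num.lt_iff_add_one_le.1 htx) k hk a ha b hb,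
          h t htx htn k hk a ha b hb]
        exact propagationStep_congr hk ha hb (hold t htx.le)
      · rw [mI' (t + 1) (Num.lt_iff_add_one_le.1 htn) k hk a ha b hb,
          ← propagationStep_congr hk ha hb (hold t le_rfl)]
        exact ⟨fun h => h.elim (fun h => absurd h.1 (not_le.2 (Num.lt_add_one_iff.2 le_rfl)))
          And.right, fun h => .inr ⟨rfl, h⟩⟩) n
  exact ⟨I, hI, h0, fun t ht => hstep t ht ht⟩

end

-- Maximal congruences, invariant relations and standard values

section

variable {l₀ m : ℕ} {Ω : (Fin m → Fin l₀) → Fin l₀}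

theorem exists_maximalCongruence {D : Finset (Fin l₀)} {τ : Finset (Fin l₀ × Fin l₀)}
    (hτ : IsCongruence Ω D τ) (hne : τ ≠ D ×ˢ D) : ∃ σ ∈ maximalCongruences Ω D, τ ⊆ σ := by
  obtain ⟨σ, hle, hmax⟩ := (Set.toFinite {σ | IsCongruence Ω D σ ∧ σ ≠ D ×ˢ D}).exists_le_maximal
    ⟨hτ, hne⟩
  refine ⟨σ, ?_, hle⟩
  simp only [maximalCongruences, Finset.mem_toList, Finset.mem_filter, Finset.mem_univ, true_and]
  refine ⟨hmax.prop.1, hmax.prop.2, fun ρ hρ hσρ => ?_⟩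
  by_cases h : ρ = D ×ˢ D
  · exact .inr h
  · exact .inl ((hmax.le_of_ge ⟨hρ, h⟩ hσρ).antisymm hσρ)

theorem mem_gamma1 {D : Finset (Fin l₀)} : D ∈ Gamma1 Ω ↔ Preserves1 Ω D := by
  simp [Gamma1]

theorem mem_gamma2 {R : Finset (Fin l₀ × Fin l₀)} : R ∈ Gamma2 Ω ↔ Preserves2 Ω R := by
  simp [Gamma2]

variable {M : Model} [hM : M.IsV1]

/-- Below a standard numeral even a nonstandard model has only standard elements. This carries
values between the model and the fixed algebra. -/
theorem exists_fin_of_lt : ∀ {l : ℕ} {x : M.Num}, x < (l : M.Num) → ∃ a : Fin l, x = (a : ℕ)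
  | 0, x, h => absurd h (by rw [Nat.cast_zero]; exact not_lt_zero)
  | l + 1, x, h => by
    rw [Nat.cast_succ, Num.lt_add_one_iff] at h
    rcases h.lt_or_eq with h | h
    · obtain ⟨a, ha⟩ := exists_fin_of_lt h
      exact ⟨a.castSucc, ha⟩
    · exact ⟨Fin.last l, h⟩

theorem fin_cast_inj {l : ℕ} {a b : Fin l} (h : ((a : ℕ) : M.Num) = (b : ℕ)) : a = b :=
  Fin.ext (Nat.cast_injective h)

/-! ## Instances on a tree -/

/-- A `1`-consistent instance on the tree with vertices `0, …, s` and parent function `π`: the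
domain of `p` is `Dm p`, and `C p` is the relation between the values at `π p` and at `p`. -/
structure IsTreeInstance (Ω : (Fin m → Fin l₀) → Fin l₀) (s : M.Num) (π : M.Str)
    (Dm : M.Num → M.Num → Prop) (C : M.Num → M.Num → M.Num → Prop) : Prop where
  definable_dom : Definable fun e : Env M => Dm e.tailN.headN e.headN
  definable_rel : Definable fun e : Env M => C e.tailN.tailN.headN e.tailN.headN e.headN
  parent_lt : ∀ p, 0 < p → p ≤ s → app π p < p
  lt : ∀ p x, p ≤ s → Dm p x → x < (l₀ : M.Num)
  dom : ∀ p, 0 < p → p ≤ s → ∀ x y, C p x y → Dm (app π p) x ∧ Dm p y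
  exists_child : ∀ p, 0 < p → p ≤ s → ∀ x, Dm (app π p) x → ∃ y, C p x y
  exists_parent : ∀ p, 0 < p → p ≤ s → ∀ y, Dm p y → ∃ x, C p x y
  invariant : ∀ p, 0 < p → p ≤ s → ∀ a b : Fin m → Fin l₀,
    (∀ r, C p ((a r : ℕ) : M.Num) ((b r : ℕ) : M.Num)) → C p ((Ω a : ℕ) : M.Num) ((Ω b : ℕ) : M.Num)

namespace IsTreeInstance

variable {s : M.Num} {π : M.Str} {Dm : M.Num → M.Num → Prop} {C : M.Num → M.Num → M.Num → Prop}

/-- Parents have smaller numbers than their children, so values can be chosen greedily in increasing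
order, each compatible with the value already given to the parent. -/
theorem exists_solution (h : IsTreeInstance Ω s π Dm C) {c : M.Num} (hc : Dm 0 c) :
    ∃ G : M.Str, app G 0 = c ∧ (∀ p, p ≤ s → Dm p (app G p)) ∧
      ∀ p, 0 < p → p ≤ s → C p (app G (app π p)) (app G p) := by
  have h₁ := h.definable_dom.app₂
  have h₂ := h.definable_rel.app₃
  obtain ⟨G, -, hG⟩ := exists_recursive_choice
    -- The conjunct `app π p < p` makes the relation depend on earlier values of `Z` for every `p`,
    -- including those where `π` means nothing.
    (R := fun Z p v => Dm p v ∧ ((p = 0 ∧ v = c) ∨ (app π p < p ∧ C p (app Z (app π p)) v)))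
    (s + 1) (l₀ : M.Num)
    (fun Z Z' p v hZ ⟨hv, hR⟩ => ⟨hv, hR.imp_right fun ⟨hp, hC⟩ => ⟨hp, by rwa [← hZ _ hp]⟩⟩)
    (fun Z p hp hZ => by
      have hps := Num.lt_add_one_iff.1 hp
      rcases eq_or_ne p 0 with rfl | hp0
      · exact ⟨c, h.lt 0 c hps hc, hc, .inl ⟨rfl, rfl⟩⟩
      · have hp0 := pos_iff_ne_zero.2 hp0
        have hlt := h.parent_lt p hp0 hps
        obtain ⟨y, hy⟩ := h.exists_child p hp0 hps _ (hZ _ hlt).2.1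
        have hD := (h.dom p hp0 hps _ _ hy).2
        exact ⟨y, h.lt p y hps hD, hD, .inr ⟨hlt, hy⟩⟩)
  have hG' : ∀ p, p ≤ s → _ := fun p hp => (hG p (Num.lt_add_one_iff.2 hp)).2
  refine ⟨G, ?_, fun p hp => (hG' p hp).1, fun p hp0 hp => ?_⟩
  · exact ((hG' 0 zero_le).2.resolve_right fun h => not_lt_zero h.1).2
  · exact ((hG' p hp).2.resolve_left fun h => hp0.ne' h.1).2

/-- `S` is closed under the constraints of the tree in both directions. -/
def Closed (s : M.Num) (π : M.Str) (C : M.Num → M.Num → M.Num → Prop) (S : M.Str) : Prop :=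
  ∀ p, 0 < p → p ≤ s → ∀ x y, C p x y → (pair (app π p) x ∈ S ↔ pair p y ∈ S)

/-- The values `c` and `d` at the root are not separated by a closed set. -/
def Rel (s : M.Num) (π : M.Str) (C : M.Num → M.Num → M.Num → Prop) (c d : M.Num) : Prop :=
  ∀ S : M.Str, Closed s π C S → pair 0 c ∈ S → pair 0 d ∈ S

/-- The complement of a closed set, taken among the codes of tree vertices with possible values, is
again closed. -/
theorem rel_symm (h : IsTreeInstance Ω s π Dm C) {c d : M.Num} (hc : c < (l₀ : M.Num))
    (hd : d < (l₀ : M.Num)) (hcd : Rel s π C c d) : Rel s π C d c := by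
  intro S hS hdS
  obtain ⟨S', -, hS'⟩ := comprehension_mem_iff (fun z => z ∉ S) (pairBound (s + 1) (l₀ : M.Num))
  have mS' : ∀ p, p ≤ s → ∀ x, x < (l₀ : M.Num) → (pair p x ∈ S' ↔ pair p x ∉ S) := fun p hp x hx =>
    (hS' _).trans (and_iff_right (pair_lt_pairBound (Num.lt_add_one_iff.2 hp) hx))
  by_contra hcS
  refine (mS' 0 zero_le d hd).1 (hcd S' (fun p hp0 hp x y hC => ?_)
    ((mS' 0 zero_le c hc).2 hcS)) hdS
  have hlt := (h.parent_lt p hp0 hp).le.trans hp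
  obtain ⟨hx, hy⟩ := h.dom p hp0 hp x y hC
  rw [mS' _ hlt x (h.lt _ x hlt hx), mS' p hp y (h.lt p y hp hy), hS p hp0 hp x y hC]

/-- Extend each `a r` to a solution `G r` of the tree. Given a closed `S`, let `T` consist of the
pairs `(p, x)` for which `Ω`, applied to `x` in place `r₀` and to `G r p` in the other places, gives
a value that lies in `S` at `p`. The constraints are invariant under `Ω` and hold along each `G r`,
so `T` is closed. Since `T` does not separate `a r₀` from `b`, `S` does not separate the two
results. -/
theorem rel_update (h : IsTreeInstance Ω s π Dm C) {a : Fin m → Fin l₀}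
    (ha : ∀ r, Dm 0 ((a r : ℕ) : M.Num)) {r₀ : Fin m} {b : Fin l₀}
    (hb : Rel s π C ((a r₀ : ℕ) : M.Num) ((b : ℕ) : M.Num)) :
    Rel s π C ((Ω a : ℕ) : M.Num) ((Ω (Function.update a r₀ b) : ℕ) : M.Num) := by
  intro S hS haS
  choose G hG0 hGD hGC using fun r => h.exists_solution (ha r)
  obtain ⟨T, -, hT⟩ := comprehension_mem_iff (fun z => ∃ p, p ≤ s ∧ ∃ x, x < (l₀ : M.Num) ∧
    ∃ Y : Fin m → Fin l₀, z = pair p x ∧ ((Y r₀ : ℕ) : M.Num) = x ∧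
      (∀ r, r ≠ r₀ → app (G r) p = ((Y r : ℕ) : M.Num)) ∧ pair p ((Ω Y : ℕ) : M.Num) ∈ S)
    (pairBound (s + 1) (l₀ : M.Num))
  have mT : ∀ p, p ≤ s → ∀ Y : Fin m → Fin l₀, (∀ r, r ≠ r₀ → app (G r) p = ((Y r : ℕ) : M.Num)) →
      (pair p ((Y r₀ : ℕ) : M.Num) ∈ T ↔ pair p ((Ω Y : ℕ) : M.Num) ∈ S) := by
    intro p hp Y hY
    have hlt : ((Y r₀ : ℕ) : M.Num) < (l₀ : M.Num) := Nat.cast_lt.2 (Y r₀).2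
    refine (hT _).trans ⟨?_, fun hS' =>
      ⟨pair_lt_pairBound (Num.lt_add_one_iff.2 hp) hlt, p, hp, _, hlt, Y, rfl, rfl, hY, hS'⟩⟩
    rintro ⟨-, p', _, x, _, Y', he, hx, hY', hS'⟩
    obtain ⟨rfl, rfl⟩ := pair_inj he
    -- The tuple is determined by `x` at `r₀` and by the fixed solutions elsewhere, so membership in
    -- `T` does not depend on the witness.
    obtain rfl : Y' = Y := by
      funext r
      by_cases hr : r = r₀
      · subst hr; exact fin_cast_inj hx
      · exact fin_cast_inj ((hY' r hr).symm.trans (hY r hr))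
    exact hS'
  have hTc : Closed s π C T := by
    intro p hp0 hp x y hC
    have hq := (h.parent_lt p hp0 hp).le.trans hp
    have hxy := h.dom p hp0 hp x y hC
    obtain ⟨x, rfl⟩ := exists_fin_of_lt (h.lt _ x hq hxy.1)
    obtain ⟨y, rfl⟩ := exists_fin_of_lt (h.lt p y hp hxy.2)
    choose Y hY using fun r => exists_fin_of_lt (h.lt _ _ hq (hGD r _ hq))
    choose Z hZ using fun r => exists_fin_of_lt (h.lt _ _ hp (hGD r _ hp))
    have h₁ := mT _ hq (Function.update Y r₀ x)
      fun r hr => by rw [Function.update_of_ne hr]; exact hY r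
    have h₂ := mT p hp (Function.update Z r₀ y)
      fun r hr => by rw [Function.update_of_ne hr]; exact hZ r
    rw [Function.update_self] at h₁ h₂
    rw [h₁, h₂]
    refine hS p hp0 hp _ _ (h.invariant p hp0 hp _ _ fun r => ?_)
    by_cases hr : r = r₀
    · subst hr; rwa [Function.update_self, Function.update_self]
    · rw [Function.update_of_ne hr, Function.update_of_ne hr, ← hY, ← hZ]
      exact hGC r p hp0 hp
  have h₁ := mT 0 zero_le a fun r _ => hG0 r
  have h₂ := mT 0 zero_le (Function.update a r₀ b)
    fun r hr => by rw [Function.update_of_ne hr]; exact hG0 r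
  rw [Function.update_self] at h₂
  exact h₂.1 (hb T hTc (h₁.2 haS))

/-- The tuple `a` is turned into `b` one coordinate at a time, and the relation is transitive. -/
theorem rel_apply (h : IsTreeInstance Ω s π Dm C) {a b : Fin m → Fin l₀}
    (ha : ∀ r, Dm 0 ((a r : ℕ) : M.Num)) (hb : ∀ r, Dm 0 ((b r : ℕ) : M.Num))
    (hab : ∀ r, Rel s π C ((a r : ℕ) : M.Num) ((b r : ℕ) : M.Num)) :
    Rel s π C ((Ω a : ℕ) : M.Num) ((Ω b : ℕ) : M.Num) := by
  classical
  have key : ∀ T : Finset (Fin m),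
      Rel s π C ((Ω a : ℕ) : M.Num) ((Ω (T.piecewise b a) : ℕ) : M.Num) := by
    intro T
    induction T using Finset.induction_on with
    | empty => rw [Finset.piecewise_empty]; exact fun S _ hS => hS
    | insert r T hr ih =>
      rw [Finset.piecewise_insert]
      have hT : ∀ r, Dm 0 ((T.piecewise b a r : ℕ) : M.Num) := fun r => by
        by_cases hr : r ∈ T
        · rw [Finset.piecewise_eq_of_mem _ _ _ hr]; exact hb r
        · rw [Finset.piecewise_eq_of_notMem _ _ _ hr]; exact ha r
      refine fun S hS haS => h.rel_update hT ?_ S hS (ih S hS haS)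
      rw [Finset.piecewise_eq_of_notMem _ _ _ hr]
      exact hab r
  have := key Finset.univ
  rwa [Finset.piecewise_univ] at this

open Classical in
/-- The elements of the root domain that are not separated form a congruence. -/
theorem isCongruence (h : IsTreeInstance Ω s π Dm C) {D : Finset (Fin l₀)} (hΩ : Preserves1 Ω D)
    (hD : ∀ a : Fin l₀, a ∈ D → Dm 0 ((a : ℕ) : M.Num)) :
    IsCongruence Ω D ((D ×ˢ D).filter fun p => Rel s π C ((p.1 : ℕ) : M.Num) ((p.2 : ℕ) : M.Num))
    where
  subset := Finset.filter_subset _ _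
  refl a ha := Finset.mem_filter.2 ⟨Finset.mem_product.2 ⟨ha, ha⟩, fun _ _ hS => hS⟩
  symm a b hab := by
    simp only [Finset.mem_filter, Finset.mem_product] at hab ⊢
    exact ⟨hab.1.symm, h.rel_symm (Nat.cast_lt.2 a.2) (Nat.cast_lt.2 b.2) hab.2⟩
  trans a b c hab hbc := by
    simp only [Finset.mem_filter, Finset.mem_product] at hab hbc ⊢
    exact ⟨⟨hab.1.1, hbc.1.2⟩, fun S hS ha => hbc.2 S hS (hab.2 S hS ha)⟩
  compatible a b hab := by
    simp only [Finset.mem_filter, Finset.mem_product] at hab ⊢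
    exact ⟨⟨hΩ a fun r => (hab r).1.1, hΩ b fun r => (hab r).1.2⟩,
      h.rel_apply (fun r => hD _ (hab r).1.1) (fun r => hD _ (hab r).1.2) fun r => (hab r).2⟩

end IsTreeInstance

/-! ## A spanning tree of a subinstance that is not fragmented -/

/-- A search from `i` along edges in either direction must meet all of `VY`; otherwise the vertices
met and those missed would fragment the subinstance. The bound `s < n` ensures that `n` rounds of
propagation suffice for the whole tree. -/
theorem exists_spanning_tree {n i : M.Num} {VY EY : M.Str}
    (hi : i < n) (hiY : i ∈ VY) (hF : ¬ FragmentedIn n VY EY) :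
    ∃ (f π : M.Str) (s : M.Num), s < n ∧ app f 0 = i ∧ (∀ p, p ≤ s → app f p < n) ∧
      (∀ p, 0 < p → p ≤ s → app π p < p ∧ (pair (app f (app π p)) (app f p) ∈ EY ∨
        pair (app f p) (app f (app π p)) ∈ EY)) ∧
      ∀ j, j < n → j ∈ VY → ∃ p, p ≤ s ∧ app f p = j := by
  have : Definable fun e : Env M =>
      pair e.tailN.headN e.headN ∈ EY ∨ pair e.headN e.tailN.headN ∈ EY := inferInstance
  obtain ⟨f, s, hs, hf0, hfn, hadj, hclosed⟩ := exists_search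
    (Adj := fun u v => pair u v ∈ EY ∨ pair v u ∈ EY) hi
  obtain ⟨π, -, hπ⟩ := exists_parent (Adj := fun u v => pair u v ∈ EY ∨ pair v u ∈ EY) hadj
  refine ⟨f, π, s, hs, hf0, hfn, hπ, ?_⟩
  by_contra! hcon
  obtain ⟨j, hj, hjY, hjf⟩ := hcon
  obtain ⟨V₁, hV₁, mV₁⟩ := comprehension_mem_iff (fun j => j ∈ VY ∧ ∃ p, p ≤ s ∧ app f p = j) n
  obtain ⟨V₂, hV₂, mV₂⟩ := comprehension_mem_iff (fun j => j ∈ VY ∧ ¬ ∃ p, p ≤ s ∧ app f p = j) n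
  refine hF ⟨V₁, hV₁, V₂, hV₂, fun k _ hk => ((mV₁ k).1 hk).2.1, fun k _ hk => ((mV₂ k).1 hk).2.1,
    ⟨i, hi, (mV₁ i).2 ⟨hi, hiY, 0, zero_le, hf0⟩⟩,
    ⟨j, hj, (mV₂ j).2 ⟨hj, hjY, fun ⟨p, hp, h⟩ => hjf p hp h⟩⟩, fun k hk hkY => ?_,
    fun k hk k' hk' ⟨h₁, h₂⟩ => ?_⟩
  · rw [mV₁, mV₂]
    simp only [hk, hkY, true_and, not_not]
  · obtain ⟨-, -, p, hp, rfl⟩ := (mV₁ k).1 h₁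
    have h₂ := ((mV₂ k').1 h₂).2.2
    exact ⟨fun h => h₂ (hclosed p hp k' hk' (.inl h)), fun h => h₂ (hclosed p hp k' hk' (.inr h))⟩

/-! ## Instances over the invariant relations -/

variable {n : M.Num} {VX EX VA EA : M.Str}

theorem IsInstanceIn.dom_lt {t l : M.Num} (h : IsInstanceIn t VX EX n l VA EA) {j x : M.Num}
    (hx : pair j x ∈ VA) : j < n ∧ x < l := by
  obtain ⟨j', hj', x', hx', he⟩ := h.2.2.2.1 _ (lt_len hx) hx
  obtain ⟨rfl, rfl⟩ := pair_inj he
  exact ⟨hj', hx'⟩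

theorem IsInstanceIn.edge_dom {t l : M.Num} (h : IsInstanceIn t VX EX n l VA EA) {j x k y : M.Num}
    (hxy : EdgeIn EA j x k y) :
    (j < n ∧ x < l ∧ pair j x ∈ VA) ∧ k < n ∧ y < l ∧ pair k y ∈ VA := by
  have hlt := lt_len hxy
  obtain ⟨j', hj', k', hk', x', hx', y', hy', he, he', h₁, h₂⟩ := h.2.2.2.2 _
    ((le_pair_left _ _).trans_lt hlt) _ ((le_pair_right _ _).trans_lt hlt) hxy
  obtain ⟨rfl, rfl⟩ := pair_inj he
  obtain ⟨rfl, rfl⟩ := pair_inj he'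
  exact ⟨⟨hj', hx', h₁⟩, hk', hy', h₂⟩

/-- The constraint of a tree of edges of `EY` between the variables `f (π p)` and `f p`. -/
def TreeRel (EY EA f π : M.Str) (p x y : M.Num) : Prop :=
  (pair (app f (app π p)) (app f p) ∈ EY ∧ EdgeIn EA (app f (app π p)) x (app f p) y) ∨
    -- If both directions are edges, only the forward constraint is used: a union of two invariant
    -- relations need not be invariant.
    (¬ pair (app f (app π p)) (app f p) ∈ EY ∧ EdgeIn EA (app f p) y (app f (app π p)) x)

theorem isTreeInstance {EY f π : M.Str} {s : M.Num}
    (h : IsInstanceOverIn Ω n VX EX n (l₀ : M.Num) VA EA)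
    (hc : OneConsistentIn EX n (l₀ : M.Num) VA EA)
    (hEY : ∀ j, j < n → ∀ k, k < n → pair j k ∈ EY → pair j k ∈ EX)
    (hfn : ∀ p, p ≤ s → app f p < n)
    (hπ : ∀ p, 0 < p → p ≤ s → app π p < p ∧ (pair (app f (app π p)) (app f p) ∈ EY ∨
      pair (app f p) (app f (app π p)) ∈ EY)) :
    IsTreeInstance Ω s π (fun p x => pair (app f p) x ∈ VA) (TreeRel EY EA f π) where
  definable_dom := inferInstance
  definable_rel := by unfold TreeRel; infer_instance
  parent_lt p hp0 hp := (hπ p hp0 hp).1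
  lt p x hp hx := (h.1.dom_lt hx).2
  dom p hp0 hp x y := by
    rintro (⟨-, hC⟩ | ⟨-, hC⟩)
    · exact ⟨(h.1.edge_dom hC).1.2.2, (h.1.edge_dom hC).2.2.2⟩
    · exact ⟨(h.1.edge_dom hC).2.2.2, (h.1.edge_dom hC).1.2.2⟩
  exists_child p hp0 hp x hx := by
    obtain ⟨hlt, hE⟩ := hπ p hp0 hp
    have hq := hfn _ (hlt.le.trans hp)
    have hc' := hc _ hq x (h.1.dom_lt hx).2 hx _ (hfn p hp)
    by_cases he : pair (app f (app π p)) (app f p) ∈ EY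
    · obtain ⟨b, -, -, hb⟩ := hc'.1 (hEY _ hq _ (hfn p hp) he)
      exact ⟨b, .inl ⟨he, hb⟩⟩
    · obtain ⟨b, -, -, hb⟩ := hc'.2 (hEY _ (hfn p hp) _ hq (hE.resolve_left he))
      exact ⟨b, .inr ⟨he, hb⟩⟩
  exists_parent p hp0 hp y hy := by
    obtain ⟨hlt, hE⟩ := hπ p hp0 hp
    have hq := hfn _ (hlt.le.trans hp)
    have hc' := hc _ (hfn p hp) y (h.1.dom_lt hy).2 hy _ hq
    by_cases he : pair (app f (app π p)) (app f p) ∈ EY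
    · obtain ⟨b, -, -, hb⟩ := hc'.2 (hEY _ hq _ (hfn p hp) he)
      exact ⟨b, .inl ⟨he, hb⟩⟩
    · obtain ⟨b, -, -, hb⟩ := hc'.1 (hEY _ (hfn p hp) _ hq (hE.resolve_left he))
      exact ⟨b, .inr ⟨he, hb⟩⟩
  invariant p hp0 hp a b hab := by
    have hq := hfn _ ((hπ p hp0 hp).1.le.trans hp)
    by_cases he : pair (app f (app π p)) (app f p) ∈ EY
    · obtain ⟨R, hR, hE⟩ := h.2.2 _ hq _ (hfn p hp)
      have hE' := fun x y => hE x (List.mem_finRange x) y (List.mem_finRange y)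
      exact .inl ⟨he, (hE' _ _).2 (mem_gamma2.1 hR _ _ fun r => (hE' _ _).1
        ((hab r).resolve_right fun h => h.1 he).2)⟩
    · obtain ⟨R, hR, hE⟩ := h.2.2 _ (hfn p hp) _ hq
      have hE' := fun x y => hE x (List.mem_finRange x) y (List.mem_finRange y)
      exact .inr ⟨he, (hE' _ _).2 (mem_gamma2.1 hR _ _ fun r => (hE' _ _).1
        ((hab r).resolve_left fun h => he h.1).2)⟩

/-- The propagation of a congruence reaches every vertex of the tree, if the congruence contains
all pairs of elements of the root domain that are not separated by one of the given sets. -/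
theorem code_mem_of_tree {EY f π I : M.Str} {s i : M.Num} {σ : Finset (Fin l₀ × Fin l₀)}
    {ι : Type} [Finite ι] (S : ι → M.Str)
    (hT : IsTreeInstance Ω s π (fun p x => pair (app f p) x ∈ VA) (TreeRel EY EA f π))
    (hEY : ∀ j, j < n → ∀ k, k < n → pair j k ∈ EY → pair j k ∈ EX)
    (hfn : ∀ p, p ≤ s → app f p < n)
    (hπ : ∀ p, 0 < p → p ≤ s → (pair (app f (app π p)) (app f p) ∈ EY ∨
      pair (app f p) (app f (app π p)) ∈ EY))
    (hS : ∀ c, IsTreeInstance.Closed s π (TreeRel EY EA f π) (S c))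
    (hI : IsPropagationIn EX n (l₀ : M.Num) VA EA i σ I) (hf0 : app f 0 = i)
    (hσ : ∀ x y, pair i x ∈ VA → pair i y ∈ VA → (∀ c, pair 0 x ∈ S c ↔ pair 0 y ∈ S c) →
      RelIn σ x y) :
    ∀ t, t ≤ n → ∀ p, p ≤ s → p ≤ t → ∀ x, x < (l₀ : M.Num) → ∀ y, y < (l₀ : M.Num) → pair (app f p) x ∈ VA →
      pair (app f p) y ∈ VA → (∀ c, pair p x ∈ S c ↔ pair p y ∈ S c) →
        code t (app f p) x y ∈ I :=
  -- The separating sets are finitely many fixed parameters, so the statement is bounded. A vertex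
  -- `p` is handled from stage `p` on, its parent having been handled earlier.
  sigma0_induction (P := fun t => t ≤ n → ∀ p, p ≤ s → p ≤ t → ∀ x, x < (l₀ : M.Num) → ∀ y, y < (l₀ : M.Num) →
      pair (app f p) x ∈ VA → pair (app f p) y ∈ VA → (∀ c, pair p x ∈ S c ↔ pair p y ∈ S c) →
        code t (app f p) x y ∈ I)
    (by
      intro _ p hp hp0 x hx y hy hxD hyD hxy
      obtain rfl := nonpos_iff_eq_zero.1 hp0
      refine (hI.1 _ (hfn 0 hp) x hx y hy).2 ⟨hf0, ?_⟩
      rw [hf0] at hxD hyD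
      exact hσ x y hxD hyD hxy)
    (by
      intro t ih ht p hp hpt x hx y hy hxD hyD hxy
      have htn : t < n := Num.lt_iff_add_one_le.2 ht
      refine (hI.2 t htn _ (hfn p hp) x hx y hy).2 ?_
      rcases hpt.lt_or_eq with hpt | rfl
      · exact .inl (ih htn.le p hp (Num.lt_add_one_iff.1 hpt) x hx y hy hxD hyD hxy)
      have hp0 : 0 < t + 1 := pos_iff_ne_zero.2 (Num.add_one_ne_zero t)
      have hqt := Num.lt_add_one_iff.1 (hT.parent_lt _ hp0 hp)
      have hq := (hT.parent_lt _ hp0 hp).le.trans hp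
      -- Closed sets carry non-separation from two values at `t + 1` to any neighbours of theirs at
      -- the parent, where the induction hypothesis applies.
      have ihq : ∀ {x y x' y'}, TreeRel EY EA f π (t + 1) x' x → TreeRel EY EA f π (t + 1) y' y →
          (∀ c, pair (t + 1) x ∈ S c ↔ pair (t + 1) y ∈ S c) →
          code t (app f (app π (t + 1))) x' y' ∈ I := fun hx hy hxy =>
        have hx' := (hT.dom _ hp0 hp _ _ hx).1
        have hy' := (hT.dom _ hp0 hp _ _ hy).1
        ih htn.le _ hq hqt _ (hT.lt _ _ hq hx') _ (hT.lt _ _ hq hy') hx' hy' fun c =>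
          by rw [hS c _ hp0 hp _ _ hx, hS c _ hp0 hp _ _ hy, hxy c]
      obtain ⟨x', hx'⟩ := hT.exists_parent _ hp0 hp x hxD
      obtain ⟨y', hy'⟩ := hT.exists_parent _ hp0 hp y hyD
      refine .inr ⟨_, hfn _ hq, x', hT.lt _ _ hq (hT.dom _ hp0 hp _ _ hx').1,
        y', hT.lt _ _ hq (hT.dom _ hp0 hp _ _ hy').1, ihq hx' hy' hxy, ?_⟩
      by_cases he : pair (app f (app π (t + 1))) (app f (t + 1)) ∈ EY
      · refine .inl ⟨hEY _ (hfn _ hq) _ (hfn _ hp) he, (hx'.resolve_right fun h => h.1 he).2,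
          (hy'.resolve_right fun h => h.1 he).2, ?_⟩
        -- Two neighbours of the same `e` lie in the same chosen sets, so the propagation already
        -- relates them and the step is not blocked.
        rintro ⟨c, -, d, -, e, -, -, -, -, hn, h₁, h₂⟩
        exact hn (ihq (.inl ⟨he, h₁⟩) (.inl ⟨he, h₂⟩) fun _ => Iff.rfl)
      · refine .inr ⟨hEY _ (hfn _ hp) _ (hfn _ hq) ((hπ _ hp0 hp).resolve_left he),
          (hx'.resolve_left fun h => he h.1).2, (hy'.resolve_left fun h => he h.1).2, ?_⟩
        rintro ⟨c, -, d, -, e, -, -, -, -, hn, h₁, h₂⟩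
        exact hn (ihq (.inr ⟨he, h₁⟩) (.inr ⟨he, h₂⟩) fun _ => Iff.rfl))

-- The reached subgraph and the proof of irreducibility

/-- A vertex set and an edge set of the subgraph reached by the propagation. -/
theorem exists_reachedSubgraph (n : M.Num) (EX : M.Str) (l : M.Num) (I : M.Str) :
    ∃ VZ, M.len VZ ≤ n ∧ ∃ EZ, M.len EZ ≤ (1 + 1 + 1 + 1) * (n * n) ∧
      IsReachedSubgraphIn n VZ EZ EX n l I := by
  obtain ⟨VZ, hVZ, mVZ⟩ := comprehension_mem_iff
    (fun j => ∃ a, a < l ∧ ∃ b, b < l ∧ code n j a b ∈ I) n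
  obtain ⟨EZ, hEZ, mEZ⟩ := comprehension_mem_iff
    (fun z => z ∈ EX ∧ ∃ s, s < n ∧ ∃ s', s' < n ∧ (z = pair s s' ∧ s ∈ VZ ∧ s' ∈ VZ))
    ((1 + 1 + 1 + 1) * (n * n))
  have mEZ' : ∀ s s', pair s s' ∈ EZ → s ∈ VZ ∧ s' ∈ VZ ∧ pair s s' ∈ EX := by
    intro s s' h
    obtain ⟨-, hX, t, _, t', _, he, h₁, h₂⟩ := (mEZ _).1 h
    obtain ⟨rfl, rfl⟩ := pair_inj he
    exact ⟨h₁, h₂, hX⟩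
  refine ⟨VZ, hVZ, EZ, hEZ, fun j hj => (mVZ j).trans (and_iff_right hj),
    fun s _ s' _ h => ⟨(mEZ' s s' h).1, (mEZ' s s' h).2.1⟩, fun s hs s' hs' h =>
      ⟨fun h' => (mEZ' s s' h').2.2, fun h' => (mEZ _).2 ⟨pair_lt_four_mul_of_lt hs hs',
        h', s, hs, s', hs', rfl, h⟩⟩⟩

theorem SubdirectSolutionsIn.mono {l : M.Num} {VY EY VZ EZ : M.Str}
    (h : SubdirectSolutionsIn n VZ EZ n l VA EA) (hV : ∀ j, j < n → j ∈ VY → j ∈ VZ)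
    (hE : ∀ j, j < n → ∀ k, k < n → pair j k ∈ EY → pair j k ∈ EZ) :
    SubdirectSolutionsIn n VY EY n l VA EA := by
  intro i hi hiY a ha hD
  obtain ⟨H, hH, ⟨⟨⟨h₁, h₂⟩, h₃⟩, h₄⟩, h₅⟩ := h i hi (hV i hi hiY) a ha hD
  exact ⟨H, hH, ⟨⟨⟨fun j hj hjY => h₁ j hj (hV j hj hjY), fun j hj hjY => h₂ j hj (hV j hj hjY)⟩,
    fun j hj k hk u hu v hv h => h₃ j hj k hk u hu v hv ⟨hE j hj k hk h.1, h.2⟩⟩, h₄⟩, h₅⟩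

open Classical in
theorem irreducibleIn_of_check (h : IsInstanceOverIn Ω n VX EX n (l₀ : M.Num) VA EA)
    (hc : OneConsistentIn EX n (l₀ : M.Num) VA EA)
    (hOK : CheckOKIn Ω n EX n (l₀ : M.Num) VA EA) :
    IrreducibleIn n VX EX n (l₀ : M.Num) VA EA := by
  intro VY _ EY _ ⟨_, hsub⟩
  refine or_iff_not_imp_left.2 fun hF => or_iff_not_imp_left.2 fun hL => ?_
  unfold LinkedIn at hL
  push Not at hL
  obtain ⟨i, hi, hiY, a, ha, b, hb, ⟨haD, hbD⟩, hab⟩ := hL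
  have hEX := fun j hj k hk h => (hsub j hj k hk h).1
  have hEY := fun j hj k hk h => (hsub j hj k hk h).2
  obtain ⟨f, π, s, hs, hf0, hfn, hπ, hcover⟩ := exists_spanning_tree hi hiY hF
  have hT := isTreeInstance h hc hEX hfn hπ
  obtain ⟨S, hSb, hSa, hS⟩ := exists_separating hEY (fun _ _ _ _ => h.1.edge_dom) hi hiY ha hb hbD hab
  obtain ⟨D, hDΓ, hD⟩ := h.2.1 i hi
  have hD' : ∀ a : Fin l₀, a ∈ D ↔ pair i ((a : ℕ) : M.Num) ∈ VA :=
    fun a => (hD a (List.mem_finRange a)).symm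
  obtain ⟨a, rfl⟩ := exists_fin_of_lt ha
  obtain ⟨b, rfl⟩ := exists_fin_of_lt hb
  have hτ := hT.isCongruence (mem_gamma1.1 hDΓ) fun a ha => by rw [hf0]; exact (hD' a).1 ha
  obtain ⟨σ, hσ, hτσ⟩ := exists_maximalCongruence hτ (fun hτD => by
    have hba : (b, a) ∈ D ×ˢ D := Finset.mem_product.2 ⟨(hD' b).2 hbD, (hD' a).2 haD⟩
    rw [← hτD, Finset.mem_filter] at hba
    -- The separating set `S` lives on variables and is closed under all constraints of the
    -- subinstance. Its pullback along `f` to tree vertices is closed for the tree and separates `b`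
    -- from `a`, so the congruence is not full.
    obtain ⟨T, -, mT⟩ := comprehension_mem_iff (fun z => ∃ p, p ≤ s ∧ ∃ x, x < (l₀ : M.Num) ∧
      (z = pair p x ∧ pair (app f p) x ∈ S)) (pairBound (s + 1) (l₀ : M.Num))
    have mT' : ∀ p x, p ≤ s → x < (l₀ : M.Num) → (pair p x ∈ T ↔ pair (app f p) x ∈ S) := by
      refine fun p x hp hx => (mT _).trans ⟨?_, fun h =>
        ⟨pair_lt_pairBound (Num.lt_add_one_iff.2 hp) hx, p, hp, x, hx, rfl, h⟩⟩
      rintro ⟨-, p', _, x', _, he, h⟩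
      obtain ⟨rfl, rfl⟩ := pair_inj he
      exact h
    have hT0 := hba.2 T (fun p hp0 hp x y hC => by
      have hq := (hT.parent_lt p hp0 hp).le.trans hp
      have hxy := hT.dom p hp0 hp x y hC
      rw [mT' _ _ hq (hT.lt _ _ hq hxy.1), mT' _ _ hp (hT.lt _ _ hp hxy.2)]
      rcases hC with hC | hC
      · exact hS _ _ _ _ hC.1 hC.2
      · exact (hS _ _ _ _ ((hπ p hp0 hp).2.resolve_left hC.1) hC.2).symm)
      ((mT' _ _ zero_le hb).2 (by rwa [hf0]))
    rw [mT' _ _ zero_le ha, hf0] at hT0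
    exact hSa hT0)
  obtain ⟨I, hI, hI'⟩ := exists_propagation σ EX n (l₀ : M.Num) VA EA i
  obtain ⟨VZ, hVZ, EZ, hEZ, hZ⟩ := exists_reachedSubgraph n EX (l₀ : M.Num) I
  have hVYZ : ∀ j, j < n → j ∈ VY → j ∈ VZ := by
    -- One closed set for each pair of elements of the algebra, a standard finite number of choices.
    -- Pairs of `D` in the congruence lie in `σ` and need no separation, so the empty set serves for
    -- them.
    have hsep : ∀ c : Fin l₀ × Fin l₀, ∃ T, IsTreeInstance.Closed s π (TreeRel EY EA f π) T ∧
        (c.1 ∈ D → c.2 ∈ D → c ∉ σ → pair 0 ((c.1 : ℕ) : M.Num) ∈ T ∧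
          pair 0 ((c.2 : ℕ) : M.Num) ∉ T) := by
      intro c
      by_cases hcr : IsTreeInstance.Rel s π (TreeRel EY EA f π) ((c.1 : ℕ) : M.Num)
          ((c.2 : ℕ) : M.Num)
      · obtain ⟨T, -, mT⟩ := comprehension_mem_iff (M := M) (fun _ => False) 0
        refine ⟨T, fun p _ _ x y _ => by simp [mT], fun h₁ h₂ hcσ => (hcσ (hτσ ?_)).elim⟩
        exact Finset.mem_filter.2 ⟨Finset.mem_product.2 ⟨h₁, h₂⟩, hcr⟩
      · unfold IsTreeInstance.Rel at hcr
        push Not at hcr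
        obtain ⟨T, hTc, hT₁, hT₂⟩ := hcr
        exact ⟨T, hTc, fun _ _ _ => ⟨hT₁, hT₂⟩⟩
    choose T hTc hTs using hsep
    have hcode := code_mem_of_tree T hT hEX hfn (fun p hp0 hp => (hπ p hp0 hp).2) hTc hI' hf0
      (fun x y hx hy hxy => by
        obtain ⟨x, rfl⟩ := exists_fin_of_lt (h.1.dom_lt hx).2
        obtain ⟨y, rfl⟩ := exists_fin_of_lt (h.1.dom_lt hy).2
        by_contra hn
        have := hTs (x, y) ((hD' x).2 hx) ((hD' y).2 hy) fun h =>
          hn ⟨(x, y), Finset.mem_toList.2 h, rfl, rfl⟩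
        exact this.2 ((hxy (x, y)).1 this.1)) n le_rfl
    intro j hj hjY
    obtain ⟨p, hp, rfl⟩ := hcover j hj hjY
    -- To be reached, a vertex needs at least one value in its domain. A solution of the tree
    -- through `a` supplies one, and a value is never separated from itself.
    obtain ⟨G, -, hG, -⟩ := hT.exists_solution (c := ((a : ℕ) : M.Num)) (by rwa [hf0])
    have hlt := hT.lt p _ hp (hG p hp)
    exact (hZ.1 _ hj).2 ⟨_, hlt, _, hlt,
      hcode p hp (hp.trans hs.le) _ hlt _ hlt (hG p hp) (hG p hp) fun _ => Iff.rfl⟩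
  -- The reached subgraph is induced, so it contains the edges of the subinstance along with its
  -- vertices.
  exact (hOK i hi D hDΓ hD σ hσ I hI hI' VZ hVZ EZ hEZ hZ).mono hVYZ fun j hj k hk h =>
    (hZ.2.2 j hj k hk ⟨hVYZ j hj (hEY j hj k hk h).1, hVYZ k hk (hEY j hj k hk h).2⟩).2
      (hEX j hj k hk h)

end

end BA

theorem mainTheorem6 {l m : ℕ} (Ω : (Fin m → Fin l) → Fin l) (hΩ : BA.IsSpecialWNU Ω) :
    BA.Proves BA.V1 (BA.checkedIsIrreducible Ω) := by
  intro M hM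
  have : M.IsV1 := ⟨hM⟩
  exact BA.satisfies_checkedIsIrreducible Ω fun _ _ _ _ _ h hc hOK =>
    BA.irreducibleIn_of_check h hc.1 hOK
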